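/- In what follows, a hyperbolic surface is a compact connected orientable hyperbolic surface with nonempty totally geodesic boundary, with its path metric (its Euler characteristic is then negative). An orthogeodesic of $X$ is a geodesic arc of positive length that meets $\partial X$ perpendicularly at both endpoints; $X$ is ortho-integral (OI) if $\cosh \ell(\mu)\in\mathbb{Z}$ for every orthogeodesic $\mu$ of $X$. Two hyperbolic surfaces are commensurable if they share an isometric finite sheeted covering, and commensurability classes are the classes of the equivalence relation generated by this relation. For $a>1$ let $H(a,a,a)\subset\mathbb{H}^2$ be the right-angled hexagon with three alternating sides (the seams) of length $\operatorname{arcosh}(a)$, and let $P(a,a,a)$ be the pair of pants obtained by gluing two copies of $H(a,a,a)$ along the seams by the identity. Number its boundary components $0,1,2$. For $n\ge 0$ let $X_n=X_n(a)$ be the surface glued from copies of $P(a,a,a)$ indexed by the words $w$ of length at most $n$ in the letters $0,1,2$ without two equal consecutive letters, where the copies $w$ and $iw$ are glued along their $i$-th boundary components by the identity. Thus $X_0=P(a,a,a)$, and $X_{n+1}$ arises from $X_n$ by gluing one copy of $P(a,a,a)$, by a reflection and without twist, along each boundary component of $X_n$. The inradius of a closed region $C\subset\mathbb{H}^2$ is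 $\sup_{x\in C} d(x,\partial C)$. **Theorem.** There are infinitely many commensurability classes of OI surfaces. Moreover, for each $a\in\{2,3\}$ and all $n\ge 0$, the surface $X_n(a)$ exists as a hyperbolic surface, is an OI surface, and has genus zero and $3\cdot 2^n$ boundary components. The universal covers $\widetilde X_n$ are realized as regions of $\mathbb{H}^2$, and their inradii strictly increase with $n$. For $m\neq n$ the surfaces $X_m(a)$ and $X_n(a)$ are not commensurable. -/

import Mathlib

open Set Filter Topology
open scoped UpperHalfPlane MatrixGroups ENNReal

namespace OrthoIntegral

/-- The model of a hyperbolic surface with geodesic boundary: the closed half-plane of the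
hyperbolic plane to the right of the complete geodesic `re = 0`. -/
def halfPlane : Set ℍ := {z | 0 ≤ z.re}

/-- A chart of a metric space `X`: an isometry from an open set `U` of `X` onto a relatively open
subset of the closed half-plane. Such a subset may avoid the geodesic `re = 0`, so that interior
points have charts as well. -/
def IsChart {X : Type*} [MetricSpace X] (U : Set X) (φ : X → ℍ) : Prop :=
  IsOpen U ∧ (∀ x ∈ U, ∀ y ∈ U, dist (φ x) (φ y) = dist x y) ∧
    ∃ V : Set ℍ, IsOpen V ∧ φ '' U = V ∩ halfPlane

/-- The geodesic boundary: the points that some chart sends to the geodesic `re = 0`. -/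
def boundary (X : Type*) [MetricSpace X] : Set X :=
  {x | ∃ (U : Set X) (φ : X → ℍ), IsChart U φ ∧ x ∈ U ∧ (φ x).re = 0}

/-- `X` has an oriented hyperbolic atlas: charts covering `X` whose changes of coordinates are
locally restrictions of orientation preserving isometries of the hyperbolic plane. -/
def HasOrientedAtlas (X : Type*) [MetricSpace X] : Prop :=
  ∃ A : Set (Set X × (X → ℍ)),
    (∀ c ∈ A, IsChart c.1 c.2) ∧ (∀ x, ∃ c ∈ A, x ∈ c.1) ∧
    ∀ c ∈ A, ∀ c' ∈ A, ∀ x ∈ c.1 ∩ c'.1,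
      ∃ g : SL(2, ℝ), ∀ᶠ y in 𝓝 x, c'.2 y = g • c.2 y

/-- The metric of `X` is a length metric whose infimum is attained: any two points are joined by
a path of length equal to their distance, here parametrized by arc length. -/
def IsGeodesicSpace (X : Type*) [MetricSpace X] : Prop :=
  ∀ x y : X, ∃ γ : ℝ → X, γ 0 = x ∧ γ (dist x y) = y ∧
    ∀ s ∈ Icc 0 (dist x y), ∀ t ∈ Icc 0 (dist x y), dist (γ s) (γ t) = |s - t|

/-- Compact connected orientable hyperbolic surfaces with nonempty totally geodesic boundary,
with the path metric. By the Gauss-Bonnet formula the Euler characteristic is automatically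
negative. -/
structure HyperbolicSurface where
  carrier : Type
  [metricSpace : MetricSpace carrier]
  [compactSpace : CompactSpace carrier]
  [connectedSpace : ConnectedSpace carrier]
  geodesic : IsGeodesicSpace carrier
  atlas : HasOrientedAtlas carrier
  boundary_nonempty : (boundary carrier).Nonempty

instance : CoeSort HyperbolicSurface Type := ⟨HyperbolicSurface.carrier⟩

attribute [instance] HyperbolicSurface.metricSpace HyperbolicSurface.compactSpace
  HyperbolicSurface.connectedSpace

/-- Near the parameter `0`, the curve `γ` is (for `t ≥ 0`) perpendicular to the boundary and
starts on it: in a chart, it follows the geodesic `‖z‖ = const`, which is the geodesic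
perpendicular to the boundary line `re = 0`. -/
def StartsPerpendicularly {X : Type*} [MetricSpace X] (γ : ℝ → X) : Prop :=
  ∃ (U : Set X) (φ : X → ℍ), IsChart U φ ∧ γ 0 ∈ U ∧ (φ (γ 0)).re = 0 ∧
    ∀ᶠ t in 𝓝[≥] (0 : ℝ), ‖(φ (γ t) : ℂ)‖ = ‖(φ (γ 0) : ℂ)‖

/-- An orthogeodesic of length `L`: a unit speed geodesic arc `γ : [0, L] → X` (locally distance
preserving) that meets the boundary perpendicularly at both endpoints. Only the values of `γ` on
`[0, L]` matter. -/
def IsOrthogeodesic {X : Type*} [MetricSpace X] (L : ℝ) (γ : ℝ → X) : Prop :=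
  0 < L ∧
  (∀ t ∈ Icc 0 L, ∃ ε > 0, ∀ s ∈ Icc 0 L, ∀ s' ∈ Icc 0 L, |s - t| < ε → |s' - t| < ε →
    dist (γ s) (γ s') = |s - s'|) ∧
  StartsPerpendicularly γ ∧ StartsPerpendicularly (fun t => γ (L - t))

/-- Ortho-integral (OI) surfaces. -/
def IsOI (X : HyperbolicSurface) : Prop :=
  ∀ (L : ℝ) (γ : ℝ → X), IsOrthogeodesic L γ → ∃ m : ℤ, Real.cosh L = m

/-- Local isometries between metric spaces. -/
def IsLocalIsometry {X Y : Type*} [MetricSpace X] [MetricSpace Y] (f : X → Y) : Prop :=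
  ∀ x, ∃ U ∈ 𝓝 x, ∀ y ∈ U, ∀ z ∈ U, dist (f y) (f z) = dist y z

/-- Isometric finite sheeted coverings. -/
def IsFiniteIsometricCovering {Z X : Type*} [MetricSpace Z] [MetricSpace X] (p : Z → X) : Prop :=
  IsCoveringMap p ∧ IsLocalIsometry p ∧ ∀ x, (p ⁻¹' {x}).Finite

/-- Two surfaces are commensurable if they share an isometric finite sheeted covering. -/
def Commensurable (X Y : HyperbolicSurface) : Prop :=
  ∃ (Z : HyperbolicSurface) (p : Z → X) (q : Z → Y),
    IsFiniteIsometricCovering p ∧ IsFiniteIsometricCovering q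

/-- The commensurability classes of OI surfaces. -/
def OICommensurabilityClass : Type 1 :=
  Quot (fun X Y : {X : HyperbolicSurface // IsOI X} => Commensurable X.1 Y.1)

/-! ### The pair of pants `P(a,a,a)` -/

/-- The constant `c` of the hexagon `H(a,a,a)`. -/
noncomputable def hexC (a : ℝ) : ℝ := a / √(a ^ 2 - 1)

/-- The constant `k` of the hexagon `H(a,a,a)`. -/
noncomputable def hexK (a : ℝ) : ℝ := (a + √(2 * a - 1)) / (a - 1)

/-- Defining functions of the three geodesics (the line `re = 0` and two half circles) that
carry the sides of `H(a,a,a)` lying on the boundary of the pair of pants. -/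
noncomputable def cuffFun (a : ℝ) (i : Fin 3) (z : ℍ) : ℝ :=
  ![z.re,
    Complex.normSq z - 2 * hexC a * z.re + 1,
    Complex.normSq z - 2 * (hexC a * hexK a) * z.re + hexK a ^ 2] i

/-- Defining functions of the three geodesics (half circles) that carry the other three sides of
`H(a,a,a)`, the seams. Seam `0` is perpendicular to cuffs `0` and `1`, seam `1` to cuffs `0` and
`2`, seam `2` to cuffs `1` and `2`. -/
noncomputable def seamFun (a : ℝ) (i : Fin 3) (z : ℍ) : ℝ :=
  ![Complex.normSq z - 1,
    hexK a ^ 2 - Complex.normSq z,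
    Complex.normSq z - (hexK a + 1) / hexC a * z.re + hexK a] i

/-- The right-angled hexagon `H(a,a,a)` (for `a > 1`): cuff sides and seams alternate, and each
of the three seams has length `arcosh a`. -/
def hexagon (a : ℝ) : Set ℍ := {z | (∀ i, 0 ≤ cuffFun a i z) ∧ ∀ i, 0 ≤ seamFun a i z}

/-- `z` lies on a seam of `H(a,a,a)`. -/
def OnSeam {a : ℝ} (z : hexagon a) : Prop := ∃ i, seamFun a i z = 0

/-- `P` is the pair of pants `P(a,a,a)`: the union of two copies of `H(a,a,a)`, placed by `h false`
and `h true`, that are glued along their seams by the identity. -/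
def IsPants (a : ℝ) (P : HyperbolicSurface) (h : Bool → hexagon a → P) : Prop :=
  (∀ s, Isometry (h s)) ∧ (∀ p, ∃ s z, h s z = p) ∧
    ∀ s z s' z', h s z = h s' z' ↔ z = z' ∧ (s = s' ∨ OnSeam z)

/-- The three boundary components of `P(a,a,a)`. -/
def cuff {a : ℝ} {P : HyperbolicSurface} (h : Bool → hexagon a → P) (i : Fin 3) : Set P :=
  {p | ∃ s z, h s z = p ∧ cuffFun a i z = 0}

/-- Reduced words of length at most `n` in three letters. They index the copies of `P(a,a,a)` of
which the surface `X_n` is built: the empty word is the initial copy, and the words of length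
`m + 1` are the copies attached in step `m + 1`. -/
def ReducedWord (n : ℕ) : Type :=
  {w : List (Fin 3) // w.length ≤ n ∧ w.IsChain (· ≠ ·)}

/-- `X` is the surface `X_n`: the union of copies of `P(a,a,a)` indexed by the reduced words of
length at most `n`, in which the copies `w` and `i :: w` are glued along their `i`-th boundary
components by the identity (that is, `i :: w` is a mirror image of `w`, attached without twist),
and there is no other gluing. The reduced words `i :: w` with `w` of length `n` correspond to the
boundary components of `X_n`, so `X_{n+1}` arises from `X_n` by gluing one copy of `P(a,a,a)` to
each boundary component. -/
def IsTreeGluing {a : ℝ} {P : HyperbolicSurface} (h : Bool → hexagon a → P) (n : ℕ)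
    (X : HyperbolicSurface) : Prop :=
  ∃ k : ReducedWord n → P → X,
    (∀ w, IsLocalIsometry (k w)) ∧ (∀ x, ∃ w p, k w p = x) ∧
    ∀ w p w' p', k w p = k w' p' ↔
      p = p' ∧ (w = w' ∨ ∃ i, p ∈ cuff h i ∧ (w'.1 = i :: w.1 ∨ w.1 = i :: w'.1))

/-! ### Topological type and universal covers -/

/-- A surface with nonempty boundary has genus zero if it is planar, that is, if it embeds
topologically in the sphere. -/
def HasGenusZero (X : HyperbolicSurface) : Prop :=
  ∃ f : X → Metric.sphere (0 : EuclideanSpace ℝ (Fin 3)) 1, IsEmbedding f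

/-- The number of boundary components. -/
noncomputable def numBoundaryComponents (X : HyperbolicSurface) : ℕ :=
  Nat.card (ConnectedComponents (boundary X))

/-- The region `C` of the hyperbolic plane is a universal cover of the surface `X`. -/
def IsUniversalCover (C : Set ℍ) (X : HyperbolicSurface) : Prop :=
  SimplyConnectedSpace C ∧ ∃ p : C → X, IsCoveringMap p ∧ IsLocalIsometry p

/-- The inradius of a region of the hyperbolic plane: the supremum over its points of the distance
to its frontier. -/
noncomputable def inradius (C : Set ℍ) : ℝ≥0∞ := ⨆ x ∈ C, Metric.infEDist x (frontier C)

end OrthoIntegral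

/-!
The surfaces are built from a reflection group. The hyperbolic plane is realized as a sheet of the
hyperboloid in Lorentz space `ℝ³`, so that a geodesic is given by a unit normal `v`, and the signed
distance of a point `z` from it by `side v z`. The reflections in the six sides of the right-angled
hexagon `H(a,a,a)` satisfy the relations of the right-angled Coxeter group `HexGroup a`, and an
induction on the length of words, as in Tits' representation, shows that the images of the hexagon
under the group tile the plane.

The group also acts combinatorially on the `6 · 2ⁿ - 4` copies of the hexagon that form `X_n`: each
copy carries a reduced word and a sign; the seam reflections flip the sign, and the reflection in
the cuff `i` prepends or removes the letter `i`, or fixes the copy where this cuff is on the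
boundary. The surface `X_n` is the quotient `TreeSpace a n` of `ℍ × Copy n` by this action. In it,
the region `region a σ` of the plane that contains the hexagon and is cut out by the mirrors which
fix the copy `σ` is a fundamental domain of the group generated by the reflections in these mirrors.
The region is convex, its projection to `X_n` is isometric on balls of a uniform radius `rad a` and
hence a universal covering, and its frontier is carried by the `boundaryMirrors`. All metric and
topological properties of `X_n` are read off from this covering. For genus zero, the front sides of
the pairs of pants are developed in the plane and lifted to the graph of a concave height function,
the back sides to the mirror image of this graph; the surface then lies on the boundary of a convex
body, and radial projection embeds it in the sphere (`hasGenusZero`). The boundary components are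
indexed by the words of length `n` with a letter that extends them
(`numBoundaryComponents_treeSurface`).

An orthogeodesic lifts to a segment of the region that is perpendicular to two boundary mirrors, and
the hyperbolic cosine of its length is, up to sign, the product of their unit normals. These normals
are images of the normals of the three cuffs of the hexagon, whose mutual products are `-a`. The
lattice `cuffLattice a` that the three span is integral if `a` is an integer. It is invariant under
the reflections in the cuffs, and under those in the seams if `2 a / (a - 1)` is an integer as well
(`vecReflect_mem_cuffLattice`); `2` and `3` satisfy both conditions (`isOI`).

The inradius of the universal cover is the largest distance of a point of the surface from the
boundary. It can be computed in any covering, hence it is an invariant of the commensurability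
class. The region of `X_n` is contained in that of `X_{n+1}`, and from a point of the former every
path to the frontier of the latter leaves the former and then has to run at least a fixed distance
further, since the frontiers are disjoint. As the inradius is attained, it strictly increases
(`strictMono_inradius`), and the surfaces `X_n` are pairwise not commensurable.
-/

namespace OrthoIntegral

/-! ### The hyperboloid model of the upper half-plane -/

/-- Three-dimensional Lorentz space. The triple `(p, q, r)` stands for the traceless matrix
`!![p, q; r, -p]`, and `bil` is half the trace form, of signature `(2, 1)`. -/
abbrev Vec : Type := ℝ × ℝ × ℝ

/-- The Lorentz form `½ tr (v w)` on traceless matrices. -/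
noncomputable def bil (v w : Vec) : ℝ := v.1 * w.1 + (v.2.1 * w.2.2 + v.2.2 * w.2.1) / 2

/-- The point of the hyperboloid `bil v v = -1` that corresponds to `z`. -/
noncomputable def toVec (z : ℍ) : Vec :=
  (z.re / z.im, -(z.re ^ 2 + z.im ^ 2) / z.im, 1 / z.im)

/-- For a vector `v` with `bil v v = 1`, the hyperbolic sine of the signed distance from `z` to
the geodesic orthogonal to `v`. -/
noncomputable def side (v : Vec) (z : ℍ) : ℝ := -bil v (toVec z)

lemma side_eq (v : Vec) (z : ℍ) :
    side v z = (v.2.2 * (z.re ^ 2 + z.im ^ 2) - 2 * v.1 * z.re - v.2.1) / (2 * z.im) := by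
  have := z.im_pos.ne'
  simp only [side, bil, toVec]
  field_simp
  ring

lemma bil_comm (v w : Vec) : bil v w = bil w v := by simp only [bil]; ring

lemma bil_add_left (u v w : Vec) : bil (u + v) w = bil u w + bil v w := by
  simp only [bil, Prod.fst_add, Prod.snd_add]; ring

lemma bil_smul_left (c : ℝ) (v w : Vec) : bil (c • v) w = c * bil v w := by
  simp only [bil, Prod.smul_fst, Prod.smul_snd, smul_eq_mul]; ring

lemma bil_sub_left (u v w : Vec) : bil (u - v) w = bil u w - bil v w := by
  simp only [bil, Prod.fst_sub, Prod.snd_sub]; ring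

lemma bil_add_right (u v w : Vec) : bil u (v + w) = bil u v + bil u w := by
  simp only [bil, Prod.fst_add, Prod.snd_add]; ring

lemma bil_smul_right (c : ℝ) (v w : Vec) : bil v (c • w) = c * bil v w := by
  simp only [bil, Prod.smul_fst, Prod.smul_snd, smul_eq_mul]; ring

lemma bil_sub_right (u v w : Vec) : bil u (v - w) = bil u v - bil u w := by
  simp only [bil, Prod.fst_sub, Prod.snd_sub]; ring

lemma bil_neg_left (v w : Vec) : bil (-v) w = -bil v w := by
  simp only [bil, Prod.fst_neg, Prod.snd_neg]; ring

lemma bil_neg_right (v w : Vec) : bil v (-w) = -bil v w := by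
  simp only [bil, Prod.fst_neg, Prod.snd_neg]; ring

lemma side_add (u v : Vec) (z : ℍ) : side (u + v) z = side u z + side v z := by
  simp only [side, bil_add_left]; ring

lemma side_neg (v : Vec) (z : ℍ) : side (-v) z = -side v z := by
  simp only [side, bil_neg_left]

lemma bil_toVec_self (z : ℍ) : bil (toVec z) (toVec z) = -1 := by
  have := z.im_pos.ne'
  simp only [bil, toVec]
  field_simp
  ring

lemma toVec_injective : Function.Injective toVec := by
  intro z w h
  have h1 : z.re / z.im = w.re / w.im := congrArg Prod.fst h
  have h2 : 1 / z.im = 1 / w.im := congrArg (fun v : Vec => v.2.2) h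
  have h3 : z.im = w.im := by simpa using h2
  rw [h3] at h1
  have := w.im_pos.ne'
  have h4 : z.re = w.re := by field_simp at h1; exact h1
  exact UpperHalfPlane.ext (Complex.ext h4 h3)

lemma cosh_dist_eq (z w : ℍ) : Real.cosh (dist z w) = -bil (toVec z) (toVec w) := by
  rw [UpperHalfPlane.cosh_dist, Complex.dist_eq, Complex.sq_norm, Complex.normSq_apply]
  have := z.im_pos.ne'
  have := w.im_pos.ne'
  simp only [bil, toVec, Complex.sub_re, Complex.sub_im, UpperHalfPlane.coe_re,
    UpperHalfPlane.coe_im]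
  field_simp
  ring

lemma cosh_inj_of_nonneg {s t : ℝ} (hs : 0 ≤ s) (ht : 0 ≤ t) (h : Real.cosh s = Real.cosh t) :
    s = t := Real.cosh_strictMonoOn.injOn hs ht h

lemma dist_eq_of_bil {z w : ℍ} {d : ℝ} (hd : 0 ≤ d)
    (h : -bil (toVec z) (toVec w) = Real.cosh d) : dist z w = d :=
  cosh_inj_of_nonneg dist_nonneg hd (by rw [cosh_dist_eq, h])

/-- The point of `ℍ` on the positive ray of a vector of the upper sheet of the hyperboloid. -/
noncomputable def ofVec (v : Vec) (h : 0 < v.2.2) : ℍ :=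
  UpperHalfPlane.mk ⟨v.1 / v.2.2, 1 / v.2.2⟩ (by positivity)

lemma toVec_ofVec {v : Vec} (h : 0 < v.2.2) (hv : bil v v = -1) : toVec (ofVec v h) = v := by
  have h' := h.ne'
  have hre : (ofVec v h).re = v.1 / v.2.2 := rfl
  have him : (ofVec v h).im = 1 / v.2.2 := rfl
  have hq : v.2.1 = -(v.1 ^ 2 + 1) / v.2.2 := by
    simp only [bil] at hv
    field_simp
    linarith
  obtain ⟨p, q, r⟩ := v
  simp only at *
  subst hq
  simp only [toVec, hre, him, Prod.mk.injEq]
  refine ⟨by field_simp, by field_simp, by field_simp⟩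

lemma toVec_pos (z : ℍ) : 0 < (toVec z).2.2 := by
  have := z.im_pos
  simp only [toVec]; positivity

/-- The tangent space of the hyperboloid is positive definite. -/
lemma bil_self_of_side_eq_zero {v : Vec} {z : ℍ} (h : side v z = 0) :
    bil v v = (v.1 - v.2.2 * z.re) ^ 2 + (v.2.2 * z.im) ^ 2 := by
  have hy := z.im_pos
  rw [side_eq, div_eq_zero_iff] at h
  have h' : v.2.1 = v.2.2 * (z.re ^ 2 + z.im ^ 2) - 2 * v.1 * z.re := by
    rcases h with h | h
    · linarith
    · linarith
  simp only [bil, h']; ring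

lemma eq_zero_of_side_eq_zero {v : Vec} {z : ℍ} (h : side v z = 0) (hv : bil v v ≤ 0) :
    v = 0 := by
  have hy := z.im_pos
  have h1 := bil_self_of_side_eq_zero h
  have h2 : v.2.2 * z.im = 0 := by
    nlinarith [sq_nonneg (v.1 - v.2.2 * z.re), sq_nonneg (v.2.2 * z.im)]
  have h3 : v.2.2 = 0 := by
    rcases mul_eq_zero.1 h2 with h | h
    · exact h
    · linarith
  have h4 : v.1 = 0 := by
    rw [h3] at h1
    nlinarith [sq_nonneg v.1]
  have h5 : v.2.1 = 0 := by
    rw [side_eq, h3, h4, div_eq_zero_iff] at h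
    rcases h with h | h
    · linarith
    · linarith
  exact Prod.ext h4 (Prod.ext h5 h3)

/-- Equality in the triangle inequality: three points in this position lie on a geodesic, that is,
their vectors are linearly dependent. -/
lemma toVec_of_between {x y z : ℍ} {s t : ℝ} (hxy : dist x y = s)
    (hyz : dist y z = t) (hxz : dist x z = s + t) :
    Real.sinh (s + t) • toVec y = Real.sinh t • toVec x + Real.sinh s • toVec z := by
  have h1 := cosh_dist_eq x y
  have h2 := cosh_dist_eq y z
  have h3 := cosh_dist_eq x z
  rw [hxy] at h1; rw [hyz] at h2; rw [hxz] at h3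
  have hx := bil_toVec_self x
  have hy := bil_toVec_self y
  have hz := bil_toVec_self z
  set v : Vec := Real.sinh t • toVec x + Real.sinh s • toVec z - Real.sinh (s + t) • toVec y
    with hv
  have hside : side v y = 0 := by
    simp only [side, hv, bil_sub_left, bil_add_left, bil_smul_left, hy, bil_comm (toVec z)]
    rw [show bil (toVec x) (toVec y) = -Real.cosh s by linarith,
      show bil (toVec y) (toVec z) = -Real.cosh t by linarith, Real.sinh_add]
    ring
  have hsq : bil v v = 0 := by
    simp only [hv, bil_sub_left, bil_add_left, bil_smul_left, bil_sub_right, bil_add_right,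
      bil_smul_right, hx, hy, hz, bil_comm (toVec z), bil_comm (toVec y) (toVec x)]
    rw [show bil (toVec x) (toVec y) = -Real.cosh s by linarith,
      show bil (toVec y) (toVec z) = -Real.cosh t by linarith,
      show bil (toVec x) (toVec z) = -Real.cosh (s + t) by linarith, Real.sinh_add, Real.cosh_add]
    have e1 := Real.cosh_sq s
    have e2 := Real.cosh_sq t
    ring_nf
    rw [e1, e2]
    ring
  have := eq_zero_of_side_eq_zero hside hsq.le
  rw [hv, sub_eq_zero] at this
  exact this.symm

/-- Geodesic segments: they are positive linear combinations of their endpoints. -/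
lemma exists_geodesic (x y : ℍ) : ∃ γ : ℝ → ℍ, γ 0 = x ∧ γ (dist x y) = y ∧
    (∀ s ∈ Icc 0 (dist x y), ∀ t ∈ Icc 0 (dist x y), dist (γ s) (γ t) = |s - t|) ∧
    ∀ t ∈ Icc 0 (dist x y), ∃ α β : ℝ, 0 ≤ α ∧ 0 ≤ β ∧ (x ≠ y → t < dist x y → 0 < α) ∧
      toVec (γ t) = α • toVec x + β • toVec y := by
  rcases eq_or_ne x y with rfl | hne
  · refine ⟨fun _ => x, rfl, by simp, ?_, ?_⟩
    · intro s hs t ht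
      rw [dist_self] at hs ht
      have := hs.1; have := hs.2; have := ht.1; have := ht.2
      rw [dist_self, show s - t = 0 by linarith, abs_zero]
    · intro t ht
      refine ⟨1, 0, zero_le_one, le_rfl, fun h => absurd rfl h, by simp⟩
  set d := dist x y with hd
  have hd0 : 0 < d := dist_pos.2 hne
  have hS : 0 < Real.sinh d := Real.sinh_pos_iff.2 hd0
  let V : ℝ → Vec := fun t => (Real.sinh (d - t) / Real.sinh d) • toVec x +
    (Real.sinh t / Real.sinh d) • toVec y
  have hVpos : ∀ t ∈ Icc 0 d, 0 < (V t).2.2 := by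
    intro t ht
    have h1 := toVec_pos x
    have h2 := toVec_pos y
    have h3 : 0 ≤ Real.sinh (d - t) := Real.sinh_nonneg_iff.2 (by linarith [ht.2])
    have h4 : 0 ≤ Real.sinh t := Real.sinh_nonneg_iff.2 ht.1
    simp only [V, Prod.snd_add, Prod.smul_snd, smul_eq_mul]
    rcases eq_or_lt_of_le ht.1 with h | h
    · rw [← h, sub_zero, Real.sinh_zero, div_self hS.ne']
      simpa using h1
    · have h5 : 0 < Real.sinh t := Real.sinh_pos_iff.2 h
      positivity
  have hVV : ∀ s t, bil (V s) (V t) = -Real.cosh (s - t) := by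
    intro s t
    have hxy : bil (toVec x) (toVec y) = -Real.cosh d := by rw [hd, cosh_dist_eq]; ring
    simp only [V, bil_add_left, bil_add_right, bil_smul_left, bil_smul_right, bil_toVec_self,
      bil_comm (toVec y) (toVec x), hxy]
    field_simp
    rw [Real.sinh_sub, Real.sinh_sub, Real.cosh_sub]
    have e1 := Real.cosh_sq d
    have e2 := Real.cosh_sq s
    have e3 := Real.cosh_sq t
    ring_nf
    have e4 : Real.cosh d ^ 2 = Real.sinh d ^ 2 + 1 := e1
    rw [e4]
    ring
  have hV1 : ∀ t, bil (V t) (V t) = -1 := by intro t; rw [hVV, sub_self, Real.cosh_zero]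
  classical
  let γ : ℝ → ℍ := fun t => if h : 0 < (V t).2.2 then ofVec (V t) h else x
  have hγ : ∀ t ∈ Icc 0 d, toVec (γ t) = V t := by
    intro t ht
    simp only [γ, dif_pos (hVpos t ht)]
    exact toVec_ofVec _ (hV1 t)
  refine ⟨γ, ?_, ?_, ?_, ?_⟩
  · apply toVec_injective
    rw [hγ 0 ⟨le_rfl, hd0.le⟩]
    simp [V, hS.ne']
  · apply toVec_injective
    rw [hγ d ⟨hd0.le, le_rfl⟩]
    simp [V, hS.ne']
  · intro s hs t ht
    apply dist_eq_of_bil (abs_nonneg _)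
    rw [hγ s hs, hγ t ht, hVV, neg_neg, Real.cosh_abs]
  · intro t ht
    refine ⟨Real.sinh (d - t) / Real.sinh d, Real.sinh t / Real.sinh d, ?_, ?_, ?_, hγ t ht⟩
    · exact div_nonneg (Real.sinh_nonneg_iff.2 (by linarith [ht.2])) hS.le
    · exact div_nonneg (Real.sinh_nonneg_iff.2 ht.1) hS.le
    · intro _ h
      exact div_pos (Real.sinh_pos_iff.2 (by linarith)) hS

/-! ### Reflections and half-planes -/

/-- The orthogonal reflection in the complement of a unit vector `v`. -/
noncomputable def vecReflect (v w : Vec) : Vec := w - (2 * bil w v) • v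

lemma bil_vecReflect {v : Vec} (hv : bil v v = 1) (u w : Vec) :
    bil (vecReflect v u) (vecReflect v w) = bil u w := by
  simp only [vecReflect, bil_sub_left, bil_sub_right, bil_smul_left, bil_smul_right, hv,
    bil_comm v w]
  ring

lemma vecReflect_vecReflect {v : Vec} (hv : bil v v = 1) (w : Vec) :
    vecReflect v (vecReflect v w) = w := by
  have : bil (vecReflect v w) v = -bil w v := by
    simp only [vecReflect, bil_sub_left, bil_smul_left, hv]; ring
  rw [vecReflect, this, vecReflect]
  module

lemma vecReflect_toVec_pos {v : Vec} (hv : bil v v = 1) (z : ℍ) :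
    0 < (vecReflect v (toVec z)).2.2 := by
  have hy := z.im_pos
  have h : (vecReflect v (toVec z)).2.2 =
      ((v.2.2 * z.re - v.1) ^ 2 + (v.2.2 * z.im) ^ 2) / z.im := by
    have hv' : v.1 * v.1 + v.2.1 * v.2.2 = 1 := by
      simp only [bil] at hv; linarith
    simp only [vecReflect, bil, toVec, Prod.snd_sub, Prod.smul_snd, smul_eq_mul]
    field_simp
    linear_combination -hv'
  rw [h]
  apply div_pos _ hy
  by_contra hcon
  have h1 : v.2.2 * z.im = 0 := by
    nlinarith [sq_nonneg (v.2.2 * z.re - v.1), sq_nonneg (v.2.2 * z.im)]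
  have h3 : v.2.2 = 0 := (mul_eq_zero.1 h1).resolve_right hy.ne'
  have h4 : v.1 = 0 := by
    rw [h3] at hcon
    nlinarith [sq_nonneg v.1]
  simp [bil, h3, h4] at hv

/-- The reflection of the hyperbolic plane in the geodesic orthogonal to the unit vector `v`. -/
noncomputable def reflect (v : {v : Vec // bil v v = 1}) (z : ℍ) : ℍ :=
  ofVec (vecReflect v (toVec z)) (vecReflect_toVec_pos v.2 z)

lemma toVec_reflect (v : {v : Vec // bil v v = 1}) (z : ℍ) :
    toVec (reflect v z) = vecReflect v (toVec z) :=
  toVec_ofVec _ (by rw [bil_vecReflect v.2, bil_toVec_self])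

lemma reflect_reflect (v : {v : Vec // bil v v = 1}) (z : ℍ) : reflect v (reflect v z) = z := by
  apply toVec_injective
  rw [toVec_reflect, toVec_reflect, vecReflect_vecReflect v.2]

lemma side_reflect_eq (v : {v : Vec // bil v v = 1}) (w : Vec) (z : ℍ) :
    side w (reflect v z) = side w z - 2 * bil w v * side v z := by
  simp only [side, toVec_reflect, vecReflect, bil_sub_right, bil_smul_right, bil_comm (toVec z)]
  ring

lemma side_reflect_self (v : {v : Vec // bil v v = 1}) (z : ℍ) :
    side v (reflect v z) = -side v z := by
  rw [side_reflect_eq, v.2]; ring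

lemma reflect_eq_self_iff (v : {v : Vec // bil v v = 1}) (z : ℍ) :
    reflect v z = z ↔ side v z = 0 := by
  constructor
  · intro h
    have := side_reflect_self v z
    rw [h] at this
    linarith
  · intro h
    apply toVec_injective
    rw [side, neg_eq_zero] at h
    rw [toVec_reflect, vecReflect, bil_comm, h]
    simp

/-- The reflection as an isometry. -/
noncomputable def reflectIso (v : {v : Vec // bil v v = 1}) : ℍ ≃ᵢ ℍ where
  toFun := reflect v
  invFun := reflect v
  left_inv := reflect_reflect v
  right_inv := reflect_reflect v
  isometry_toFun := Isometry.of_dist_eq fun z w => dist_eq_of_bil dist_nonneg <| by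
    rw [toVec_reflect, toVec_reflect, bil_vecReflect v.2, cosh_dist_eq]

/-- How far a reflection moves a point away from another one, in terms of the sides of the mirror
on which they lie. -/
lemma cosh_dist_reflect (v : {v : Vec // bil v v = 1}) (x y : ℍ) :
    Real.cosh (dist x (reflect v y)) = Real.cosh (dist x y) + 2 * side v x * side v y := by
  rw [cosh_dist_eq, cosh_dist_eq, toVec_reflect]
  simp only [vecReflect, side, bil_sub_right, bil_smul_right, bil_comm v]
  ring

lemma dist_le_dist_reflect (v : {v : Vec // bil v v = 1}) {x y : ℍ}
    (h : 0 ≤ side v x * side v y) : dist x y ≤ dist x (reflect v y) := by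
  have := cosh_dist_reflect v x y
  have h2 : Real.cosh (dist x y) ≤ Real.cosh (dist x (reflect v y)) := by linarith
  rwa [Real.cosh_le_cosh, abs_of_nonneg dist_nonneg, abs_of_nonneg dist_nonneg] at h2

lemma dist_reflect_lt (v : {v : Vec // bil v v = 1}) {x y : ℍ}
    (h : side v x * side v y < 0) : dist x (reflect v y) < dist x y := by
  have := cosh_dist_reflect v x y
  have h2 : Real.cosh (dist x (reflect v y)) < Real.cosh (dist x y) := by linarith
  rwa [Real.cosh_lt_cosh, abs_of_nonneg dist_nonneg, abs_of_nonneg dist_nonneg] at h2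

/-- Mirrors whose unit normals have inner product at most `-1`, and that have a point on the
positive side of both, bound disjoint half-planes: the sum of the normals is not spacelike. -/
lemma side_add_side_pos {v w : Vec} (hv : bil v v = 1) (hw : bil w w = 1) (hvw : bil v w ≤ -1)
    {o : ℍ} (hvo : 0 < side v o) (hwo : 0 < side w o) (z : ℍ) : 0 < side v z + side w z := by
  have hu : bil (v + w) (v + w) ≤ 0 := by
    rw [bil_add_left, bil_add_right, bil_add_right, hv, hw, bil_comm w v]; linarith
  have ho : 0 < side (v + w) o := by rw [side_add]; linarith
  rw [← side_add]
  set u := v + w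
  have hne : u ≠ 0 := by
    intro h
    rw [h] at ho
    simp [side, bil] at ho
  have hyo := o.im_pos
  have hyz := z.im_pos
  -- completing the square, the numerator of `side u` has the sign of its leading coefficient
  have key : ∀ x : ℍ, u.2.2 * (u.2.2 * (x.re ^ 2 + x.im ^ 2) - 2 * u.1 * x.re - u.2.1) =
      (u.2.2 * x.re - u.1) ^ 2 + (u.2.2 * x.im) ^ 2 - bil u u := by
    intro x; simp only [bil]; ring
  rw [side_eq] at ho ⊢
  have ho' : 0 < u.2.2 * (o.re ^ 2 + o.im ^ 2) - 2 * u.1 * o.re - u.2.1 := by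
    by_contra hcon
    have : (u.2.2 * (o.re ^ 2 + o.im ^ 2) - 2 * u.1 * o.re - u.2.1) / (2 * o.im) ≤ 0 :=
      div_nonpos_of_nonpos_of_nonneg (by linarith) (by positivity)
    linarith
  apply div_pos _ (by positivity)
  rcases eq_or_ne u.2.2 0 with h0 | h0
  · have h1 : u.1 = 0 := by
      have : bil u u = u.1 ^ 2 := by simp only [bil, h0]; ring
      nlinarith [sq_nonneg u.1]
    rw [h0, h1] at ho' ⊢
    linarith
  · have h1 : 0 < u.2.2 := by
      have h2 := key o
      have h3 : 0 < (u.2.2 * o.im) ^ 2 := by positivity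
      by_contra hcon
      have : u.2.2 * (u.2.2 * (o.re ^ 2 + o.im ^ 2) - 2 * u.1 * o.re - u.2.1) ≤ 0 :=
        mul_nonpos_of_nonpos_of_nonneg (by linarith) ho'.le
      nlinarith [sq_nonneg (u.2.2 * o.re - u.1)]
    have h2 := key z
    have h3 : 0 < (u.2.2 * z.im) ^ 2 := by positivity
    have h4 : 0 < u.2.2 * (u.2.2 * (z.re ^ 2 + z.im ^ 2) - 2 * u.1 * z.re - u.2.1) := by
      nlinarith [sq_nonneg (u.2.2 * z.re - u.1)]
    exact pos_of_mul_pos_right h4 h1.le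

lemma continuous_side (v : Vec) : Continuous (side v) := by
  have : side v = fun z : ℍ =>
      (v.2.2 * (z.re ^ 2 + z.im ^ 2) - 2 * v.1 * z.re - v.2.1) / (2 * z.im) := by
    ext z; exact side_eq v z
  rw [this]
  apply Continuous.div
  · have h1 := UpperHalfPlane.continuous_re
    have h2 := UpperHalfPlane.continuous_im
    fun_prop
  · have h2 := UpperHalfPlane.continuous_im
    fun_prop
  · intro z; have := z.im_pos; positivity

/-! ### The right-angled hexagon -/

/-- The six sides of the hexagon: `inl i` is the `i`-th cuff, `inr j` is the `j`-th seam. -/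
abbrev Wall : Type := Fin 3 ⊕ Fin 3

/-- Perpendicular sides of the hexagon. The seam opposite to the cuff `i` is the seam `2 - i`. -/
def Perp : Wall → Wall → Prop
  | .inl i, .inr j => i.val + j.val ≠ 2
  | .inr j, .inl i => i.val + j.val ≠ 2
  | _, _ => False

instance : DecidableRel Perp := fun i j => by
  rcases i with i | i <;> rcases j with j | j <;> simp only [Perp] <;> infer_instance

lemma Perp.symm {i j : Wall} (h : Perp i j) : Perp j i := by
  rcases i with i | i <;> rcases j with j | j <;> simp_all [Perp]

lemma Perp.ne {i j : Wall} (h : Perp i j) : i ≠ j := by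
  rintro rfl
  rcases i with i | i <;> simp [Perp] at h

/-- The hyperbolic sine of the length of the seams. -/
noncomputable def hexT (a : ℝ) : ℝ := √(a ^ 2 - 1)

/-- The normalization of the unit normal of the last seam. -/
noncomputable def hexN (a : ℝ) : ℝ := √(2 / (hexK a * (a - 1)))

/-- The unit normals of the sides of the hexagon, pointing inwards. -/
noncomputable def wallVec (a : ℝ) : Wall → Vec
  | .inl i => ![(-1, 0, 0), (a, -hexT a, hexT a), (a, -(hexT a * hexK a), hexT a / hexK a)] i
  | .inr j => ![(0, 1, 1), (0, -hexK a, -(1 / hexK a)),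
      ((hexK a + 1) * hexT a * hexN a / 2, -(a * hexK a * hexN a), a * hexN a)] j

lemma hexC_eq (a : ℝ) : hexC a = a / hexT a := rfl

section HexagonConstants

variable {a : ℝ} (ha : 1 < a)
include ha

lemma hexT_pos : 0 < hexT a := Real.sqrt_pos.2 (by nlinarith)

lemma hexT_sq : hexT a ^ 2 = a ^ 2 - 1 := Real.sq_sqrt (by nlinarith)

lemma mul_hexK : hexK a * (a - 1) = a + √(2 * a - 1) := by
  have : a - 1 ≠ 0 := by linarith
  simp only [hexK]; field_simp

lemma hexK_mul_gt : a + 1 < hexK a * (a - 1) := by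
  rw [mul_hexK ha]
  have : 1 < √(2 * a - 1) := Real.lt_sqrt_of_sq_lt (by linarith)
  linarith

lemma one_lt_hexK : 1 < hexK a := by
  have := hexK_mul_gt ha
  nlinarith

lemma hexK_eq : (a - 1) * (hexK a ^ 2 + 1) = 2 * a * hexK a := by
  have h1 := mul_hexK ha
  have h2 : √(2 * a - 1) ^ 2 = 2 * a - 1 := Real.sq_sqrt (by linarith)
  have h3 : √(2 * a - 1) = hexK a * (a - 1) - a := by linarith
  rw [h3] at h2
  have h4 : (a - 1) ≠ 0 := by linarith
  apply mul_left_cancel₀ h4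
  linear_combination h2

lemma hexN_pos : 0 < hexN a := by
  have := one_lt_hexK ha
  refine Real.sqrt_pos.2 (div_pos two_pos (mul_pos (by linarith) (by linarith)))

lemma hexN_sq : hexN a ^ 2 * (hexK a * (a - 1)) = 2 := by
  have := one_lt_hexK ha
  have h : 0 < hexK a * (a - 1) := mul_pos (by linarith) (by linarith)
  rw [hexN, Real.sq_sqrt (by positivity), div_mul_cancel₀ _ h.ne']

lemma gram_cuff_seam : 2 ≤ (hexK a + 1) * hexT a * hexN a := by
  have h1 := hexT_pos ha
  have h2 := hexT_sq ha
  have h3 := one_lt_hexK ha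
  have h4 := hexK_eq ha
  have h5 := hexN_pos ha
  have h6 := hexN_sq ha
  have h7 : ((hexK a + 1) * hexT a * hexN a) ^ 2 * (a - 1) = 4 * ((2 * a - 1) * (a + 1)) := by
    have : (a - 1) * (hexK a + 1) ^ 2 = 2 * hexK a * (2 * a - 1) := by linear_combination h4
    calc _ = ((a - 1) * (hexK a + 1) ^ 2) * hexT a ^ 2 * hexN a ^ 2 := by ring
      _ = 2 * (2 * a - 1) * (a + 1) * (hexN a ^ 2 * (hexK a * (a - 1))) := by rw [this, h2]; ring
      _ = _ := by rw [h6]; ring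
  refine le_of_sq_le_sq ?_ (by positivity)
  have : (a - 1) ≤ (2 * a - 1) * (a + 1) := by nlinarith
  refine le_of_mul_le_mul_right ?_ (show 0 < a - 1 by linarith)
  rw [h7]
  linarith

lemma gram_cuff_seam' : 2 * hexK a ≤ hexT a * (hexK a ^ 2 - 1) := by
  have h1 := hexT_pos ha
  have h2 := hexT_sq ha
  have h3 := one_lt_hexK ha
  have h4 := hexK_eq ha
  have h7 : (hexT a * (hexK a ^ 2 - 1)) ^ 2 * (a - 1) ^ 2 =
      (a ^ 2 - 1) * (2 * a - 1) * (2 * hexK a) ^ 2 := by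
    have e1 : (a - 1) * (hexK a + 1) ^ 2 = 2 * hexK a * (2 * a - 1) := by linear_combination h4
    have e2 : (a - 1) * (hexK a - 1) ^ 2 = 2 * hexK a := by linear_combination h4
    calc _ = ((a - 1) * (hexK a + 1) ^ 2) * ((a - 1) * (hexK a - 1) ^ 2) * hexT a ^ 2 := by ring
      _ = _ := by rw [e1, e2, h2]; ring
  refine le_of_sq_le_sq ?_ (mul_nonneg h1.le (by nlinarith))
  have h8 : (a - 1) ^ 2 ≤ (a ^ 2 - 1) * (2 * a - 1) := by
    nlinarith [mul_pos (show 0 < a - 1 by linarith) (show 0 < a by linarith)]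
  refine le_of_mul_le_mul_right ?_ (show 0 < (a - 1) ^ 2 by nlinarith)
  rw [h7, mul_comm]
  exact mul_le_mul_of_nonneg_right h8 (sq_nonneg _)

lemma gram_seam_seam : 2 ≤ a * hexN a * (hexK a - 1) := by
  have h3 := one_lt_hexK ha
  have h4 := hexK_eq ha
  have h5 := hexN_pos ha
  have h6 := hexN_sq ha
  have h7 : (a * hexN a * (hexK a - 1)) ^ 2 * (a - 1) ^ 2 = (2 * a) ^ 2 := by
    have e2 : (a - 1) * (hexK a - 1) ^ 2 = 2 * hexK a := by linear_combination h4
    calc _ = ((a - 1) * (hexK a - 1) ^ 2) * (a - 1) * hexN a ^ 2 * a ^ 2 := by ring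
      _ = 2 * (hexN a ^ 2 * (hexK a * (a - 1))) * a ^ 2 := by rw [e2]; ring
      _ = _ := by rw [h6]; ring
  refine le_of_sq_le_sq ?_ (mul_nonneg (by positivity) (by linarith))
  refine le_of_mul_le_mul_right ?_ (show 0 < (a - 1) ^ 2 by nlinarith)
  rw [h7]; nlinarith

lemma bil_wallVec_self (i : Wall) : bil (wallVec a i) (wallVec a i) = 1 := by
  have h2 := hexT_sq ha
  have h3 := one_lt_hexK ha
  have h3' : hexK a ≠ 0 := by linarith
  have h4 := hexK_eq ha
  have h6 := hexN_sq ha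
  rcases i with i | i <;> fin_cases i <;> simp [bil, wallVec]
  · nlinarith
  · field_simp; nlinarith
  · field_simp; norm_num
  · have e1 : (a - 1) * (hexK a + 1) ^ 2 = 2 * hexK a * (2 * a - 1) := by linear_combination h4
    linear_combination (hexK a + 1) ^ 2 * hexN a ^ 2 / 4 * h2 + (a + 1) * hexN a ^ 2 / 4 * e1 +
      (1 / 2) * h6

lemma bil_wallVec_of_perp {i j : Wall} (h : Perp i j) :
    bil (wallVec a i) (wallVec a j) = 0 := by
  have h3 := one_lt_hexK ha
  have h3' : hexK a ≠ 0 := by linarith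
  rcases i with i | i <;> rcases j with j | j <;> fin_cases i <;> fin_cases j <;>
    simp [Perp] at h <;> simp [bil, wallVec] <;> field_simp <;> ring

lemma bil_wallVec_le {i j : Wall} (hij : i ≠ j) (h : ¬ Perp i j) :
    bil (wallVec a i) (wallVec a j) ≤ -1 := by
  have h1 := hexT_pos ha
  have h2 := hexT_sq ha
  have h3 := one_lt_hexK ha
  have h3' : 0 < hexK a := by linarith
  have h4 := hexK_eq ha
  have g1 := gram_cuff_seam ha
  have g2 := gram_cuff_seam' ha
  have g3 := gram_seam_seam ha
  have g4 : bil (wallVec a (.inl 1)) (wallVec a (.inl 2)) ≤ -1 := by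
    simp only [bil, wallVec, Matrix.cons_val]
    have : (a * a + (-hexT a * (hexT a / hexK a) + hexT a * -(hexT a * hexK a)) / 2) *
        (2 * hexK a) = -a * (2 * hexK a) := by
      field_simp
      rw [h2]
      linear_combination (-(a + 1)) * h4
    have := mul_right_cancel₀ (by positivity) this
    rw [this]; linarith
  have g5 : bil (wallVec a (.inr 0)) (wallVec a (.inr 1)) ≤ -1 := by
    simp only [bil, wallVec, Matrix.cons_val]
    have : 2 ≤ 1 / hexK a + hexK a := by
      have : 1 / hexK a + hexK a - 2 = (hexK a - 1) ^ 2 / hexK a := by field_simp; ring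
      have : 0 ≤ (hexK a - 1) ^ 2 / hexK a := by positivity
      linarith
    linarith
  have g6 : 1 ≤ (hexT a * hexK a - hexT a / hexK a) / 2 := by
    have : (hexT a * hexK a - hexT a / hexK a) / 2 =
        (hexT a * (hexK a ^ 2 - 1)) / (2 * hexK a) := by
      field_simp
    rw [this, le_div_iff₀ (by positivity)]; linarith
  have g7 : 1 ≤ a * hexN a * (hexK a - 1) / 2 := by linarith
  have g8 : bil (wallVec a (.inr 1)) (wallVec a (.inr 2)) ≤ -1 := by
    simp only [bil, wallVec, Matrix.cons_val]
    have : (1 / hexK a) * (a * hexK a * hexN a) = a * hexN a := by field_simp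
    linarith
  rcases i with i | i <;> rcases j with j | j <;> fin_cases i <;> fin_cases j <;>
    first
    | exact absurd rfl hij
    | (simp [Perp] at h; done)
    | exact g4
    | exact (bil_comm _ _).trans_le g4
    | exact g5
    | exact (bil_comm _ _).trans_le g5
    | exact g8
    | exact (bil_comm _ _).trans_le g8
    | (simp only [bil, wallVec, Matrix.cons_val, Fin.zero_eta, Fin.mk_one, Fin.reduceFinMk,
        mul_zero, zero_mul, add_zero, zero_add, mul_one, one_mul]
       ring_nf; ring_nf at g1 g6 g7; linarith)

lemma side_wall_cuff (i : Fin 3) (z : ℍ) :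
    ∃ c > 0, side (wallVec a (.inl i)) z = c * cuffFun a i z := by
  have h1 := hexT_pos ha
  have h3 := one_lt_hexK ha
  have h3' : 0 < hexK a := by linarith
  have hy := z.im_pos
  fin_cases i
  · refine ⟨1 / z.im, by positivity, ?_⟩
    rw [side_eq]; simp [wallVec, cuffFun]; field_simp
  · refine ⟨hexT a / (2 * z.im), by positivity, ?_⟩
    rw [side_eq]; simp [wallVec, cuffFun, Complex.normSq_apply, hexC_eq]; field_simp
  · refine ⟨hexT a / hexK a / (2 * z.im), by positivity, ?_⟩
    rw [side_eq]; simp [wallVec, cuffFun, Complex.normSq_apply, hexC_eq]; field_simp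

lemma side_wall_seam (i : Fin 3) (z : ℍ) :
    ∃ c > 0, side (wallVec a (.inr i)) z = c * seamFun a i z := by
  have h1 := hexT_pos ha
  have h3 := one_lt_hexK ha
  have h3' : 0 < hexK a := by linarith
  have h5 := hexN_pos ha
  have ha' : 0 < a := by linarith
  have hy := z.im_pos
  fin_cases i
  · refine ⟨1 / (2 * z.im), by positivity, ?_⟩
    rw [side_eq]; simp [wallVec, seamFun, Complex.normSq_apply]; field_simp
  · refine ⟨1 / hexK a / (2 * z.im), by positivity, ?_⟩
    rw [side_eq]; simp [wallVec, seamFun, Complex.normSq_apply]; field_simp; ring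
  · refine ⟨a * hexN a / (2 * z.im), by positivity, ?_⟩
    rw [side_eq]; simp [wallVec, seamFun, Complex.normSq_apply, hexC_eq]; field_simp

lemma side_wall_cuff_eq_zero (i : Fin 3) (z : ℍ) :
    side (wallVec a (.inl i)) z = 0 ↔ cuffFun a i z = 0 := by
  obtain ⟨c, hc, h⟩ := side_wall_cuff ha i z
  rw [h, mul_eq_zero, or_iff_right hc.ne']

lemma side_wall_seam_eq_zero (i : Fin 3) (z : ℍ) :
    side (wallVec a (.inr i)) z = 0 ↔ seamFun a i z = 0 := by
  obtain ⟨c, hc, h⟩ := side_wall_seam ha i z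
  rw [h, mul_eq_zero, or_iff_right hc.ne']

lemma mem_hexagon_iff (z : ℍ) : z ∈ hexagon a ↔ ∀ i, 0 ≤ side (wallVec a i) z := by
  constructor
  · rintro ⟨h1, h2⟩ (i | i)
    · obtain ⟨c, hc, h⟩ := side_wall_cuff ha i z
      rw [h]; exact mul_nonneg hc.le (h1 i)
    · obtain ⟨c, hc, h⟩ := side_wall_seam ha i z
      rw [h]; exact mul_nonneg hc.le (h2 i)
  · intro h
    refine ⟨fun i => ?_, fun i => ?_⟩
    · obtain ⟨c, hc, h'⟩ := side_wall_cuff ha i z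
      have := h (.inl i)
      rw [h'] at this
      exact nonneg_of_mul_nonneg_right this hc
    · obtain ⟨c, hc, h'⟩ := side_wall_seam ha i z
      have := h (.inr i)
      rw [h'] at this
      exact nonneg_of_mul_nonneg_right this hc

/-- The hexagon has a point in its interior. -/
lemma exists_center : ∃ o : ℍ, ∀ i, 0 < side (wallVec a i) o := by
  have h1 := hexT_pos ha
  have h2 := hexT_sq ha
  have h3 := one_lt_hexK ha
  have ha' : 0 < a := by linarith
  set x := hexT a / (2 * a) with hx
  have hx0 : 0 < x := by positivity
  have hxa : 2 * a * x = hexT a := by rw [hx]; field_simp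
  have hx1 : x ^ 2 < 1 := by
    rw [hx, div_pow, h2, div_lt_one (by positivity)]; nlinarith
  have hC : 2 * hexC a * x = 1 := by rw [hexC_eq, hx]; field_simp
  have hC' : (hexK a + 1) / hexC a * x < hexK a + 1 := by
    have e : (hexK a + 1) / hexC a * x = (hexK a + 1) * ((a ^ 2 - 1) / (2 * a ^ 2)) := by
      rw [hexC_eq, hx, ← h2]; field_simp
    have : (a ^ 2 - 1) / (2 * a ^ 2) < 1 := by rw [div_lt_one (by positivity)]; nlinarith
    rw [e]; nlinarith
  have hy : 0 < √(hexK a - x ^ 2) := Real.sqrt_pos.2 (by linarith)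
  let o : ℍ := UpperHalfPlane.mk ⟨x, √(hexK a - x ^ 2)⟩ hy
  have hre : o.re = x := rfl
  have him : o.im = √(hexK a - x ^ 2) := rfl
  have hn : Complex.normSq o = hexK a := by
    rw [Complex.normSq_apply, UpperHalfPlane.coe_re, UpperHalfPlane.coe_im, hre, him,
      Real.mul_self_sqrt (by linarith)]
    ring
  have hc : ∀ i, 0 < cuffFun a i o := by
    intro i
    fin_cases i <;> simp [cuffFun, hn, hre]
    · exact hx0
    · linarith
    · nlinarith
  have hs : ∀ i, 0 < seamFun a i o := by
    intro i
    fin_cases i <;> simp [seamFun, hn, hre]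
    · linarith
    · nlinarith
    · linarith
  refine ⟨o, ?_⟩
  rintro (i | i)
  · obtain ⟨c, hc', h⟩ := side_wall_cuff ha i o
    rw [h]; exact mul_pos hc' (hc i)
  · obtain ⟨c, hc', h⟩ := side_wall_seam ha i o
    rw [h]; exact mul_pos hc' (hs i)

/-- The hexagon has no point at infinity. -/
lemma hexagon_no_ideal_point {t : ℝ} (h0 : 0 ≤ t) (h1 : 1 ≤ t ^ 2) (h2 : t ^ 2 ≤ hexK a ^ 2)
    (h3 : 0 ≤ t ^ 2 - 2 * hexC a * t + 1)
    (h4 : 0 ≤ t ^ 2 - 2 * (hexC a * hexK a) * t + hexK a ^ 2)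
    (h5 : 0 ≤ t ^ 2 - (hexK a + 1) / hexC a * t + hexK a) : False := by
  have hT := hexT_pos ha
  have hT2 := hexT_sq ha
  have hk := one_lt_hexK ha
  have hk2 := hexK_mul_gt ha
  have ha' : 0 < a := by linarith
  have ht1 : 1 ≤ t := by nlinarith
  have htk : t ≤ hexK a := by nlinarith
  set T := hexT a
  set k := hexK a
  set s := T * t with hs
  have hTa : a - 1 < T := by nlinarith
  have hTa' : T < a + 1 := by nlinarith
  have e3 : 0 ≤ (s - a) ^ 2 - 1 := by
    have : (s - a) ^ 2 - 1 = T ^ 2 * (t ^ 2 - 2 * (a / T) * t + 1) := by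
      rw [hs]; field_simp; linear_combination - hT2
    rw [this]; exact mul_nonneg (sq_nonneg _) h3
  have e4 : 0 ≤ (s - a * k) ^ 2 - k ^ 2 := by
    have : (s - a * k) ^ 2 - k ^ 2 = T ^ 2 * (t ^ 2 - 2 * (a / T * k) * t + k ^ 2) := by
      rw [hs]; field_simp; linear_combination - k ^ 2 * hT2
    rw [this]; exact mul_nonneg (sq_nonneg _) h4
  have e5 : 0 ≤ a * s ^ 2 - (k + 1) * T ^ 2 * s + a * k * T ^ 2 := by
    have : a * s ^ 2 - (k + 1) * T ^ 2 * s + a * k * T ^ 2 =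
        a * T ^ 2 * (t ^ 2 - (k + 1) / (a / T) * t + k) := by
      rw [hs]; field_simp
    rw [this]; exact mul_nonneg (by positivity) h5
  have hs1 : a + 1 ≤ s := by
    have : a - 1 < s := by nlinarith
    nlinarith
  have hs2 : s ≤ (a - 1) * k := by
    have : s < (a + 1) * k := by nlinarith
    by_contra hcon
    nlinarith
  have h6 := mul_nonneg ha'.le (mul_nonneg (sub_nonneg.2 hs1) (sub_nonneg.2 hs2))
  rw [hT2] at e5
  have h7 : s * (k * (a - 1) - (a + 1)) ≤ 0 := by linarith
  nlinarith

lemma isCompact_hexagon : IsCompact (hexagon a) := by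
  rw [UpperHalfPlane.isOpenEmbedding_coe.isEmbedding.isCompact_iff]
  set K : Set ℂ := {z | 0 ≤ z.re ∧ 0 ≤ z.im ∧ 1 ≤ Complex.normSq z ∧
    Complex.normSq z ≤ hexK a ^ 2 ∧ 0 ≤ Complex.normSq z - 2 * hexC a * z.re + 1 ∧
    0 ≤ Complex.normSq z - 2 * (hexC a * hexK a) * z.re + hexK a ^ 2 ∧
    0 ≤ Complex.normSq z - (hexK a + 1) / hexC a * z.re + hexK a} with hK
  have hclosed : IsClosed K := by
    have hn : Continuous Complex.normSq := Complex.continuous_normSq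
    have hr := Complex.continuous_re
    have hi := Complex.continuous_im
    refine (isClosed_le continuous_const hr).and <| (isClosed_le continuous_const hi).and <|
      (isClosed_le continuous_const hn).and <| (isClosed_le hn continuous_const).and <|
      (isClosed_le continuous_const ?_).and <| (isClosed_le continuous_const ?_).and <|
      isClosed_le continuous_const ?_
    all_goals fun_prop
  have hbdd : Bornology.IsBounded K := by
    refine (Metric.isBounded_closedBall (x := (0 : ℂ)) (r := hexK a)).subset ?_
    intro z hz
    rw [mem_closedBall_zero_iff]
    have := hz.2.2.2.1
    rw [← Complex.sq_norm] at this
    exact le_of_sq_le_sq this (by linarith [one_lt_hexK ha])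
  have himg : (fun z : ℍ => (z : ℂ)) '' hexagon a = K := by
    ext z
    constructor
    · rintro ⟨w, ⟨hw1, hw2⟩, rfl⟩
      have c0 := hw1 0; have c1 := hw1 1; have c2 := hw1 2
      have s0 := hw2 0; have s1 := hw2 1; have s2 := hw2 2
      simp only [cuffFun, seamFun, Matrix.cons_val] at c0 c1 c2 s0 s1 s2
      exact ⟨c0, w.im_pos.le, by linarith, by linarith, c1, c2, s2⟩
    · rintro ⟨c0, h0, s0, s1, c1, c2, s2⟩
      rcases eq_or_lt_of_le h0 with h0 | h0
      · have hn : Complex.normSq z = z.re ^ 2 := by rw [Complex.normSq_apply, ← h0]; ring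
        rw [hn] at s0 s1 c1 c2 s2
        exact (hexagon_no_ideal_point ha c0 s0 s1 c1 c2 s2).elim
      · refine ⟨UpperHalfPlane.mk z h0, ⟨fun i => ?_, fun i => ?_⟩, rfl⟩
        · fin_cases i
          · exact c0
          · exact c1
          · exact c2
        · fin_cases i
          · exact sub_nonneg.2 s0
          · exact sub_nonneg.2 s1
          · exact s2
  rw [himg]
  exact Metric.isCompact_of_isClosed_isBounded hclosed hbdd

end HexagonConstants

/-! ### The reflection group of the hexagon -/

/-- The Coxeter matrix of the hexagon: reflections in perpendicular sides commute, and there are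
no other relations. -/
def hexMatrix : CoxeterMatrix Wall where
  M := Matrix.of fun i j => if i = j then 1 else if Perp i j then 2 else 0
  isSymm := by
    ext i j
    have h : Perp i j ↔ Perp j i := ⟨Perp.symm, Perp.symm⟩
    simp [h, eq_comm]
  diagonal i := by simp
  off_diagonal i j h := by
    simp only [Matrix.of_apply, if_neg h]
    split_ifs <;> simp

/-- The right-angled Coxeter group with Coxeter matrix `hexMatrix`. The parameter records the
hexagon on whose sides the generators act as reflections. -/
def HexGroup (_a : ℝ) : Type := hexMatrix.Group

instance (a : ℝ) : Group (HexGroup a) := inferInstanceAs (Group hexMatrix.Group)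

/-- The Coxeter system of the reflection group. -/
def hexSystem (a : ℝ) : CoxeterSystem hexMatrix (HexGroup a) := hexMatrix.toCoxeterSystem

/-- The generators of the reflection group. -/
def gen (a : ℝ) (i : Wall) : HexGroup a := (hexSystem a).simple i

lemma gen_mul_gen (a : ℝ) (i : Wall) : gen a i * gen a i = 1 :=
  (hexSystem a).simple_mul_simple_self i

lemma gen_inv (a : ℝ) (i : Wall) : (gen a i)⁻¹ = gen a i := (hexSystem a).inv_simple i

lemma gen_comm (a : ℝ) {i j : Wall} (h : Perp i j) : gen a i * gen a j = gen a j * gen a i := by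
  have h1 := (hexSystem a).simple_mul_simple_pow i j
  have h2 : hexMatrix i j = 2 := by simp [hexMatrix, h, h.ne]
  rw [h2, pow_two] at h1
  have h3 : gen a i * gen a j * (gen a i * gen a j) = 1 := h1
  rw [mul_eq_one_iff_eq_inv, mul_inv_rev, gen_inv, gen_inv] at h3
  exact h3

/-- A map on the walls that respects the relations extends to the reflection group. -/
lemma isLiftable_hexMatrix {G : Type*} [Group G] {f : Wall → G} (h1 : ∀ i, f i * f i = 1)
    (h2 : ∀ i j, Perp i j → f i * f j = f j * f i) : hexMatrix.IsLiftable f := by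
  intro i j
  by_cases hij : i = j
  · subst hij; rw [hexMatrix.diagonal, pow_one, h1]
  · by_cases hp : Perp i j
    · have : hexMatrix i j = 2 := by simp [hexMatrix, hp, hp.ne]
      rw [this, pow_two]
      calc f i * f j * (f i * f j) = f i * f j * (f j * f i) := by rw [h2 i j hp]
        _ = f i * (f j * f j) * f i := by group
        _ = 1 := by rw [h1, mul_one, h1]
    · have : hexMatrix i j = 0 := by simp [hexMatrix, hp, hij]
      rw [this, pow_zero]

/-- The side of a wall of the hexagon on which a point lies. -/
noncomputable abbrev wallSide (a : ℝ) (i : Wall) (z : ℍ) : ℝ := side (wallVec a i) z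

section Action

variable {a : ℝ} [ha : Fact (1 < a)]

/-- The normal of a wall as a unit vector. -/
noncomputable def wallUnit (a : ℝ) [ha : Fact (1 < a)] (i : Wall) : {v : Vec // bil v v = 1} :=
  ⟨wallVec a i, bil_wallVec_self ha.out i⟩

lemma reflect_comm {i j : Wall} (h : Perp i j) (z : ℍ) :
    reflect (wallUnit a i) (reflect (wallUnit a j) z) =
      reflect (wallUnit a j) (reflect (wallUnit a i) z) := by
  apply toVec_injective
  have h1 : bil (wallVec a i) (wallVec a j) = 0 := bil_wallVec_of_perp ha.out h
  have h2 : bil (wallVec a j) (wallVec a i) = 0 := bil_wallVec_of_perp ha.out h.symm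
  simp only [toVec_reflect, wallUnit, vecReflect, bil_sub_left, bil_smul_left, h1, h2]
  module

/-- The action of the reflection group by isometries of the hyperbolic plane. -/
noncomputable def hexHom (a : ℝ) [ha : Fact (1 < a)] : HexGroup a →* (ℍ ≃ᵢ ℍ) :=
  (hexSystem a).lift ⟨fun i => reflectIso (wallUnit a i), isLiftable_hexMatrix
    (fun _ => IsometryEquiv.ext fun z => reflect_reflect _ z)
    (fun _ _ h => IsometryEquiv.ext fun z => reflect_comm h z)⟩

noncomputable instance : MulAction (HexGroup a) ℍ where
  smul g z := hexHom a g z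
  one_smul z := by change hexHom a 1 z = z; rw [map_one]; rfl
  mul_smul g h z := by
    change hexHom a (g * h) z = hexHom a g (hexHom a h z)
    rw [map_mul]; rfl

instance : IsIsometricSMul (HexGroup a) ℍ where
  isometry_smul g := (hexHom a g).isometry

lemma gen_smul (i : Wall) (z : ℍ) : gen a i • z = reflect (wallUnit a i) z := by
  change hexHom a (gen a i) z = _
  rw [hexHom, gen, CoxeterSystem.lift_apply_simple]
  rfl

lemma wallSide_gen_smul_self (i : Wall) (z : ℍ) :
    wallSide a i (gen a i • z) = -wallSide a i z := by
  rw [gen_smul]; exact side_reflect_self (wallUnit a i) z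

lemma wallSide_gen_smul_of_perp {i j : Wall} (h : Perp i j) (z : ℍ) :
    wallSide a i (gen a j • z) = wallSide a i z := by
  rw [gen_smul]
  have := side_reflect_eq (wallUnit a j) (wallVec a i) z
  rw [show bil (wallVec a i) (wallUnit a j) = 0 from bil_wallVec_of_perp ha.out h] at this
  simpa using this

lemma wallSide_gen_smul (i j : Wall) (z : ℍ) :
    wallSide a i (gen a j • z) =
      wallSide a i z - 2 * bil (wallVec a i) (wallVec a j) * wallSide a j z := by
  rw [gen_smul]; exact side_reflect_eq (wallUnit a j) (wallVec a i) z

lemma gen_smul_eq_self_iff (i : Wall) (z : ℍ) : gen a i • z = z ↔ wallSide a i z = 0 := by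
  rw [gen_smul]; exact reflect_eq_self_iff _ z

lemma wallSide_add_pos {i j : Wall} (hij : i ≠ j) (h : ¬ Perp i j) (z : ℍ) :
    0 < wallSide a i z + wallSide a j z := by
  obtain ⟨o, ho⟩ := exists_center ha.out
  exact side_add_side_pos (bil_wallVec_self ha.out i) (bil_wallVec_self ha.out j)
    (bil_wallVec_le ha.out hij h) (ho i) (ho j) z

lemma mem_hexagon {z : ℍ} : z ∈ hexagon a ↔ ∀ i, 0 ≤ wallSide a i z := mem_hexagon_iff ha.out z

/-- Word length in the reflection group. -/
noncomputable abbrev len (w : HexGroup a) : ℕ := (hexSystem a).length w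

/-- Tits' lemma: if multiplication by the reflection in a wall makes `w` longer, then `w` does not
move the hexagon across that wall. -/
lemma wallSide_nonneg_of_length_lt {w : HexGroup a} {i : Wall} (h : len w < len (gen a i * w))
    {z : ℍ} (hz : z ∈ hexagon a) : 0 ≤ wallSide a i (w • z) := by
  induction hn : len w using Nat.strong_induction_on generalizing w i with
  | _ n ih =>
    subst hn
    rcases eq_or_ne w 1 with rfl | hw
    · rw [one_smul]; exact mem_hexagon.1 hz i
    obtain ⟨j, hj⟩ := (hexSystem a).exists_leftDescent_of_ne_one hw
    change len (gen a j * w) < len w at hj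
    set w' := gen a j * w with hw'
    have hww' : w = gen a j * w' := by rw [hw', ← mul_assoc, gen_mul_gen, one_mul]
    have hij : i ≠ j := by rintro rfl; exact absurd h (not_lt.2 hj.le)
    by_cases hp : Perp i j
    · have h1 : len w' < len (gen a i * w') := by
        by_contra hcon
        have h2 : len (gen a i * w') < len w' :=
          lt_of_le_of_ne (not_lt.1 hcon) ((hexSystem a).length_simple_mul_ne w' i)
        have h3 : gen a i * w = gen a j * (gen a i * w') := by
          calc gen a i * w = gen a i * (gen a j * w') := by rw [← hww']
            _ = gen a j * (gen a i * w') := by rw [← mul_assoc, gen_comm a hp, mul_assoc]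
        have h4 : len (gen a i * w) ≤ len (gen a j) + len (gen a i * w') := by
          rw [h3]; exact (hexSystem a).length_mul_le _ _
        have h5 : len (gen a j) = 1 := (hexSystem a).length_simple j
        omega
      have := ih _ hj h1 rfl
      rwa [hww', mul_smul, wallSide_gen_smul_of_perp hp]
    · have h1 : len w' < len (gen a j * w') := by rw [← hww']; exact hj
      have h2 := ih _ hj h1 rfl
      have h3 : wallSide a j (w • z) ≤ 0 := by
        rw [hww', mul_smul, wallSide_gen_smul_self]; linarith
      have := wallSide_add_pos (a := a) hij hp (w • z)
      linarith

/-- The reflections in the walls through `z` generate this subgroup. -/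
def wallGroup (a : ℝ) (z : ℍ) : Subgroup (HexGroup a) :=
  Subgroup.closure (gen a '' {i | wallSide a i z = 0})

omit ha in
lemma gen_mem_wallGroup {i : Wall} {z : ℍ} (h : wallSide a i z = 0) : gen a i ∈ wallGroup a z :=
  Subgroup.subset_closure ⟨i, h, rfl⟩

lemma smul_eq_of_mem_wallGroup {w : HexGroup a} {z : ℍ} (h : w ∈ wallGroup a z) : w • z = z := by
  have : wallGroup a z ≤ MulAction.stabilizer (HexGroup a) z := by
    rw [wallGroup, Subgroup.closure_le]
    rintro _ ⟨i, hi, rfl⟩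
    exact (gen_smul_eq_self_iff i z).2 hi
  exact this h

/-- The hexagon is a strict fundamental domain: an element of the reflection group that moves a
point of the hexagon into the hexagon fixes it, and is a product of reflections in walls through
this point. -/
theorem smul_eq_self_of_mem_hexagon {w : HexGroup a} {z : ℍ} (hz : z ∈ hexagon a)
    (hw : w • z ∈ hexagon a) : w • z = z ∧ w ∈ wallGroup a z := by
  induction hn : len w using Nat.strong_induction_on generalizing w with
  | _ n ih =>
    subst hn
    rcases eq_or_ne w 1 with rfl | hw1
    · exact ⟨one_smul _ z, one_mem _⟩
    obtain ⟨j, hj⟩ := (hexSystem a).exists_leftDescent_of_ne_one hw1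
    change len (gen a j * w) < len w at hj
    set w' := gen a j * w with hw'
    have hww' : w = gen a j * w' := by rw [hw', ← mul_assoc, gen_mul_gen, one_mul]
    have h1 : len w' < len (gen a j * w') := by rw [← hww']; exact hj
    have h2 := wallSide_nonneg_of_length_lt h1 hz
    have h3 := mem_hexagon.1 hw j
    rw [hww', mul_smul, wallSide_gen_smul_self] at h3
    have h4 : wallSide a j (w' • z) = 0 := le_antisymm (by linarith) h2
    have h5 : w • z = w' • z := by rw [hww', mul_smul]; exact (gen_smul_eq_self_iff _ _).2 h4
    obtain ⟨h6, h7⟩ := ih _ hj (h5 ▸ hw) rfl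
    rw [h6] at h4 h5
    refine ⟨h5, ?_⟩
    rw [hww']
    exact mul_mem (gen_mem_wallGroup h4) h7

lemma cuff_unique {z : ℍ} {i j : Fin 3} (hi : wallSide a (.inl i) z = 0)
    (hj : wallSide a (.inl j) z = 0) : i = j := by
  by_contra h
  have := wallSide_add_pos (a := a) (i := .inl i) (j := .inl j) (by simpa using h) id z
  linarith

lemma seam_unique {z : ℍ} {i j : Fin 3} (hi : wallSide a (.inr i) z = 0)
    (hj : wallSide a (.inr j) z = 0) : i = j := by
  by_contra h
  have := wallSide_add_pos (a := a) (i := .inr i) (j := .inr j) (by simpa using h) id z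
  linarith

lemma perp_of_wallSide {z : ℍ} {i j : Wall} (hi : wallSide a i z = 0)
    (hj : wallSide a j z = 0) (hij : i ≠ j) : Perp i j := by
  by_contra h
  have := wallSide_add_pos (a := a) hij h z
  linarith

/-- At most one cuff and one seam pass through a point, so the group generated by the reflections
in the walls through it has at most four elements. -/
lemma mem_wallGroup_cases {w : HexGroup a} {z : ℍ} (h : w ∈ wallGroup a z) :
    w = 1 ∨ (∃ i, wallSide a (.inl i) z = 0 ∧ w = gen a (.inl i)) ∨
      (∃ j, wallSide a (.inr j) z = 0 ∧ w = gen a (.inr j)) ∨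
      ∃ i j, wallSide a (.inl i) z = 0 ∧ wallSide a (.inr j) z = 0 ∧
        w = gen a (.inl i) * gen a (.inr j) := by
  induction h using Subgroup.closure_induction_left with
  | one => exact .inl rfl
  | inv_mul_cancel x hx y _ ih | mul_left x hx y _ ih =>
    obtain ⟨k, hk, rfl⟩ := hx
    try rw [gen_inv]
    rcases k with k | k
    · rcases ih with rfl | ⟨i, hi, rfl⟩ | ⟨j, hj, rfl⟩ | ⟨i, j, hi, hj, rfl⟩
      · exact .inr (.inl ⟨k, hk, mul_one _⟩)
      · obtain rfl := cuff_unique hk hi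
        exact .inl (gen_mul_gen _ _)
      · exact .inr (.inr (.inr ⟨k, j, hk, hj, rfl⟩))
      · obtain rfl := cuff_unique hk hi
        exact .inr (.inr (.inl ⟨j, hj, by rw [← mul_assoc, gen_mul_gen, one_mul]⟩))
    · rcases ih with rfl | ⟨i, hi, rfl⟩ | ⟨j, hj, rfl⟩ | ⟨i, j, hi, hj, rfl⟩
      · exact .inr (.inr (.inl ⟨k, hk, mul_one _⟩))
      · exact .inr (.inr (.inr ⟨i, k, hi, hk,
          gen_comm a (perp_of_wallSide hk hi (by simp))⟩))
      · obtain rfl := seam_unique hk hj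
        exact .inl (gen_mul_gen _ _)
      · obtain rfl := seam_unique hk hj
        refine .inr (.inl ⟨i, hi, ?_⟩)
        rw [gen_comm a (perp_of_wallSide hi hk (by simp)), ← mul_assoc, gen_mul_gen, one_mul]

lemma finite_wallGroup (z : ℍ) : (wallGroup a z : Set (HexGroup a)).Finite := by
  have : (wallGroup a z : Set (HexGroup a)) ⊆ insert 1 (range (fun i => gen a (.inl i)) ∪
      (range (fun j => gen a (.inr j)) ∪
        range (fun p : Fin 3 × Fin 3 => gen a (.inl p.1) * gen a (.inr p.2)))) := by
    intro w hw
    rcases mem_wallGroup_cases hw with rfl | ⟨i, -, rfl⟩ | ⟨j, -, rfl⟩ | ⟨i, j, -, -, rfl⟩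
    · exact .inl rfl
    · exact .inr (.inl ⟨i, rfl⟩)
    · exact .inr (.inr (.inl ⟨j, rfl⟩))
    · exact .inr (.inr (.inr ⟨(i, j), rfl⟩))
  exact (((finite_range _).union ((finite_range _).union (finite_range _))).insert 1).subset this

/-! ### The tessellation by hexagons -/

/-- Folding along the walls through `z`: some product of reflections in these walls moves `x` to
the inner side of each of them. -/
lemma exists_fold (z x : ℍ) :
    ∃ s ∈ wallGroup a z, ∀ i, wallSide a i z = 0 → 0 ≤ wallSide a i (s • x) := by
  suffices h : ∀ T : Finset Wall, (∀ i ∈ T, wallSide a i z = 0) →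
      ∃ s ∈ wallGroup a z, ∀ i ∈ T, 0 ≤ wallSide a i (s • x) by
    obtain ⟨s, hs, h'⟩ := h (Finset.univ.filter fun i => wallSide a i z = 0) (by simp)
    exact ⟨s, hs, fun i hi => h' i (by simp [hi])⟩
  intro T
  induction T using Finset.induction_on with
  | empty => exact fun _ => ⟨1, one_mem _, by simp⟩
  | insert j T hj ih =>
    intro hT
    obtain ⟨s, hs, h⟩ := ih fun i hi => hT i (Finset.mem_insert_of_mem hi)
    have hjz := hT j (Finset.mem_insert_self j T)
    rcases le_total 0 (wallSide a j (s • x)) with h0 | h0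
    · exact ⟨s, hs, fun i hi => (Finset.mem_insert.1 hi).elim (fun e => e ▸ h0) (h i)⟩
    · refine ⟨gen a j * s, mul_mem (gen_mem_wallGroup hjz) hs, fun i hi => ?_⟩
      rw [mul_smul]
      rcases Finset.mem_insert.1 hi with rfl | hi'
      · rw [wallSide_gen_smul_self]; linarith
      · have hij : i ≠ j := fun e => hj (e ▸ hi')
        rw [wallSide_gen_smul_of_perp (perp_of_wallSide (hT i hi) hjz hij)]
        exact h i hi'

lemma exists_ball_wallSide {z : ℍ} (hz : z ∈ hexagon a) : ∃ δ > 0, ∀ x ∈ Metric.ball z δ,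
    ∀ i, wallSide a i z = 0 ∨ 0 < wallSide a i x := by
  have : ∀ᶠ x in 𝓝 z, ∀ i, wallSide a i z = 0 ∨ 0 < wallSide a i x := by
    rw [eventually_all]
    intro i
    rcases eq_or_lt_of_le (mem_hexagon.1 hz i) with h | h
    · exact .of_forall fun x => .inl h.symm
    · exact ((continuous_side _).continuousAt.eventually (lt_mem_nhds h)).mono fun x hx => .inr hx
  exact Metric.eventually_nhds_iff_ball.1 this

/-- The first property of this uniform radius is that a ball of this radius around a point of the
hexagon only meets walls through a common point. -/
lemma exists_uniform_ball : ∃ ε > 0, ∀ x ∈ hexagon a, ∃ z ∈ hexagon a, ∃ δ,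
    Metric.ball x ε ⊆ Metric.ball z δ ∧
      ∀ y ∈ Metric.ball z δ, ∀ i, wallSide a i z = 0 ∨ 0 < wallSide a i y := by
  choose! δ hδ h using fun z hz => exists_ball_wallSide (a := a) (z := z) hz
  obtain ⟨ε, hε, h'⟩ := lebesgue_number_lemma_of_metric (isCompact_hexagon ha.out)
    (c := fun z : hexagon a => Metric.ball (z : ℍ) (δ z)) (fun _ => Metric.isOpen_ball)
    (fun z hz => mem_iUnion.2 ⟨⟨z, hz⟩, Metric.mem_ball_self (hδ z hz)⟩)
  refine ⟨ε, hε, fun x hx => ?_⟩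
  obtain ⟨z, hz⟩ := h' x hx
  exact ⟨z, z.2, δ z, hz, h z z.2⟩

lemma exists_fold_mem_hexagon {z : ℍ} {δ : ℝ}
    (h : ∀ y ∈ Metric.ball z δ, ∀ i, wallSide a i z = 0 ∨ 0 < wallSide a i y) {x : ℍ}
    (hx : x ∈ Metric.ball z δ) :
    ∃ s ∈ wallGroup a z, s • x ∈ hexagon a ∧ s • x ∈ Metric.ball z δ := by
  obtain ⟨s, hs, h'⟩ := exists_fold (a := a) z x
  have hsx : s • x ∈ Metric.ball z δ := by
    rw [Metric.mem_ball, ← smul_eq_of_mem_wallGroup hs, dist_smul]; exact hx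
  refine ⟨s, hs, mem_hexagon.2 fun i => ?_, hsx⟩
  rcases h _ hsx i with hi | hi
  · exact h' i hi
  · exact hi.le

/-- The images of the hexagon cover the hyperbolic plane. -/
theorem exists_smul_mem_hexagon (x : ℍ) : ∃ g : HexGroup a, g • x ∈ hexagon a := by
  obtain ⟨ε, hε, hU⟩ := exists_uniform_ball (a := a)
  set S : Set ℍ := {x | ∃ g : HexGroup a, g • x ∈ hexagon a}
  have step : ∀ x ∈ S, ∀ y ∈ Metric.ball x ε, y ∈ S := by
    rintro x ⟨g, hg⟩ y hy
    obtain ⟨z, hz, δ, hδ, h⟩ := hU _ hg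
    have : g • y ∈ Metric.ball z δ := hδ (by rwa [Metric.mem_ball, dist_smul])
    obtain ⟨s, -, hs, -⟩ := exists_fold_mem_hexagon h this
    exact ⟨s * g, by rwa [mul_smul]⟩
  have hS : IsClopen S := by
    refine ⟨⟨Metric.isOpen_iff.2 fun y hy => ⟨ε, hε, fun x hx hxS => ?_⟩⟩,
      Metric.isOpen_iff.2 fun x hx => ⟨ε, hε, step x hx⟩⟩
    exact hy (step x hxS y (by rwa [Metric.mem_ball_comm]))
  obtain ⟨o, ho⟩ := exists_center ha.out
  have : S = univ := hS.eq_univ ⟨o, 1, by rw [one_smul]; exact mem_hexagon.2 fun i => (ho i).le⟩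
  exact eq_univ_iff_forall.1 this x

/-- A uniform form of proper discontinuity: the elements of the reflection group that move some
point of a small ball into the same ball have a common fixed point. -/
theorem exists_uniform_radius : ∃ ε > 0, ∀ x : ℍ, ∃ z : ℍ, ∀ (g : HexGroup a),
    ∀ y ∈ Metric.ball x ε, g • y ∈ Metric.ball x ε → g • z = z := by
  obtain ⟨ε, hε, hU⟩ := exists_uniform_ball (a := a)
  refine ⟨ε, hε, fun x => ?_⟩
  obtain ⟨h, hh⟩ := exists_smul_mem_hexagon (a := a) x
  obtain ⟨z, hz, δ, hδ, hw⟩ := hU _ hh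
  refine ⟨h⁻¹ • z, fun g y hy hgy => ?_⟩
  have h1 : h • y ∈ Metric.ball z δ := hδ (by rwa [Metric.mem_ball, dist_smul])
  have h2 : h • g • y ∈ Metric.ball z δ := hδ (by rwa [Metric.mem_ball, dist_smul])
  obtain ⟨s, hs, hs1, hs2⟩ := exists_fold_mem_hexagon hw h1
  obtain ⟨t, ht, ht1, -⟩ := exists_fold_mem_hexagon hw h2
  have e : (t * h * g * h⁻¹ * s⁻¹) • (s • h • y) = t • h • g • y := by
    simp only [mul_smul, inv_smul_smul]
  obtain ⟨-, hmem⟩ := smul_eq_self_of_mem_hexagon hs1 (by rw [e]; exact ht1)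
  have hle : wallGroup a (s • h • y) ≤ wallGroup a z := by
    refine Subgroup.closure_mono (image_mono fun i (hi : wallSide a i _ = 0) => ?_)
    rcases hw _ hs2 i with h0 | h0
    · exact h0
    · exact absurd hi h0.ne'
  have h3 := mul_mem (mul_mem (inv_mem ht) (hle hmem)) hs
  have h4 := smul_eq_of_mem_wallGroup h3
  have h5 : t⁻¹ * (t * h * g * h⁻¹ * s⁻¹) * s = h * g * h⁻¹ := by group
  rw [h5] at h4
  calc g • h⁻¹ • z = h⁻¹ • ((h * g * h⁻¹) • z) := by simp only [mul_smul, inv_smul_smul]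
    _ = h⁻¹ • z := by rw [h4]

lemma finite_stabilizer (z : ℍ) : {g : HexGroup a | g • z = z}.Finite := by
  obtain ⟨k, hk⟩ := exists_smul_mem_hexagon (a := a) z
  refine ((finite_wallGroup (a := a) (k • z)).image fun w => k⁻¹ * w * k).subset fun g hg => ?_
  refine ⟨k * g * k⁻¹, (smul_eq_self_of_mem_hexagon hk ?_).2, by group⟩
  rw [mul_smul, mul_smul, inv_smul_smul, hg]
  exact hk

/-- The reflection group acts properly. -/
theorem finite_dist_smul_le (x y : ℍ) (R : ℝ) :
    {g : HexGroup a | dist x (g • y) ≤ R}.Finite := by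
  obtain ⟨ε, hε, hU⟩ := exists_uniform_radius (a := a)
  have hfin : ∀ c : ℍ, {g : HexGroup a | g • y ∈ Metric.ball c ε}.Finite := by
    intro c
    rcases eq_empty_or_nonempty {g : HexGroup a | g • y ∈ Metric.ball c ε} with h | ⟨g₀, h₀⟩
    · rw [h]; exact finite_empty
    obtain ⟨z, hz⟩ := hU c
    refine ((finite_stabilizer (a := a) z).image fun k => k * g₀).subset fun g hg => ?_
    refine ⟨g * g₀⁻¹, hz _ _ h₀ ?_, by group⟩
    rw [mul_smul, inv_smul_smul]; exact hg
  obtain ⟨t, -, ht, hcov⟩ := (isCompact_closedBall x R).finite_cover_balls hε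
  refine (ht.biUnion fun c _ => hfin c).subset fun g hg => ?_
  have : g • y ∈ Metric.closedBall x R := by rw [Metric.mem_closedBall, dist_comm]; exact hg
  exact mem_iUnion₂.2 (by simpa using hcov this)

end Action

/-! ### The copies of the hexagon in the surface -/

/-- The index set of the copies of the hexagon that form the surface `X_n`: each of the copies of
the pair of pants consists of two hexagons. -/
@[ext] structure Copy (n : ℕ) where
  word : ReducedWord n
  flag : Bool

/-- Crossing the cuff `i` in the tree of copies of the pair of pants. If there is no copy on the
other side, the word stays the same. -/
def crossList (n : ℕ) (i : Fin 3) : List (Fin 3) → List (Fin 3)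
  | [] => if 0 < n then [i] else []
  | j :: w => if j = i then w else if w.length + 1 < n then i :: j :: w else j :: w

lemma crossList_of_head {n : ℕ} {i : Fin 3} (w : List (Fin 3)) :
    crossList n i (i :: w) = w := by simp [crossList]

lemma crossList_of_chain {n : ℕ} {i : Fin 3} {w : List (Fin 3)}
    (h : (i :: w).IsChain (· ≠ ·)) :
    crossList n i w = if w.length < n then i :: w else w := by
  cases w with
  | nil => rfl
  | cons j w =>
    rw [List.isChain_cons_cons] at h
    simp [crossList, h.1.symm]

lemma chain_or_head {i : Fin 3} {w : List (Fin 3)} (hw : w.IsChain (· ≠ ·)) :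
    (i :: w).IsChain (· ≠ ·) ∨ ∃ v, w = i :: v := by
  cases w with
  | nil => exact .inl (List.isChain_singleton _)
  | cons j v =>
    by_cases h : i = j
    · exact .inr ⟨v, by rw [h]⟩
    · exact .inl (List.isChain_cons_cons.2 ⟨h, hw⟩)

lemma ReducedWord.ext_iff {n : ℕ} {w w' : ReducedWord n} : w = w' ↔ w.1 = w'.1 :=
  Subtype.ext_iff

/-- `crossList` on reduced words. -/
def cross (n : ℕ) (i : Fin 3) (w : ReducedWord n) : ReducedWord n :=
  ⟨crossList n i w.1, by
    obtain ⟨w, hl, hw⟩ := w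
    rcases chain_or_head (i := i) hw with h | ⟨v, rfl⟩
    · rw [crossList_of_chain h]
      split_ifs with h'
      · exact ⟨h', h⟩
      · exact ⟨hl, hw⟩
    · rw [crossList_of_head]
      exact ⟨by rw [List.length_cons] at hl; omega, hw.tail⟩⟩

lemma cross_cross (n : ℕ) (i : Fin 3) (w : ReducedWord n) : cross n i (cross n i w) = w := by
  obtain ⟨w, hl, hw⟩ := w
  apply Subtype.ext
  change crossList n i (crossList n i w) = w
  rcases chain_or_head (i := i) hw with h | ⟨v, rfl⟩
  · rw [crossList_of_chain h]
    split_ifs with h'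
    · rw [crossList_of_head]
    · rw [crossList_of_chain h, if_neg h']
  · rw [crossList_of_head, crossList_of_chain hw]
    rw [List.length_cons] at hl
    rw [if_pos (by omega)]

lemma cross_eq_self_iff {n : ℕ} {i : Fin 3} {w : ReducedWord n} :
    cross n i w = w ↔ w.1.length = n ∧ (i :: w.1).IsChain (· ≠ ·) := by
  rw [ReducedWord.ext_iff]
  obtain ⟨w, hl, hw⟩ := w
  change crossList n i w = w ↔ w.length = n ∧ (i :: w).IsChain (· ≠ ·)
  rcases chain_or_head (i := i) hw with h | ⟨v, rfl⟩
  · rw [crossList_of_chain h]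
    constructor
    · intro h'
      split_ifs at h' with h1
      · have := congrArg List.length h'
        simp at this
      · exact ⟨by omega, h⟩
    · rintro ⟨h1, -⟩
      rw [if_neg (by omega)]
  · rw [crossList_of_head]
    constructor
    · intro h
      have := congrArg List.length h
      simp at this
    · rintro ⟨-, h⟩
      rw [List.isChain_cons_cons] at h
      exact absurd rfl h.1

/-- If a cuff does have a copy on its other side, the two words differ by one letter. -/
lemma cross_cases (n : ℕ) (i : Fin 3) (w : ReducedWord n) :
    cross n i w = w ∨ (cross n i w).1 = i :: w.1 ∨ w.1 = i :: (cross n i w).1 := by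
  rw [ReducedWord.ext_iff]
  obtain ⟨w, hl, hw⟩ := w
  change crossList n i w = w ∨ crossList n i w = i :: w ∨ w = i :: crossList n i w
  rcases chain_or_head (i := i) hw with h | ⟨v, rfl⟩
  · rw [crossList_of_chain h]
    split_ifs
    · exact .inr (.inl rfl)
    · exact .inl rfl
  · rw [crossList_of_head]; exact .inr (.inr rfl)

lemma cross_of_cons {n : ℕ} {i : Fin 3} {w w' : ReducedWord n} (h : w'.1 = i :: w.1) :
    cross n i w' = w := by
  apply Subtype.ext
  change crossList n i w'.1 = w.1
  rw [h, crossList_of_head]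

instance (n : ℕ) : Finite (ReducedWord n) :=
  ((List.finite_length_le (Fin 3) n).subset fun _ h => h.1 :
    {w : List (Fin 3) | w.length ≤ n ∧ w.IsChain (· ≠ ·)}.Finite)

instance (n : ℕ) : Finite (Copy n) :=
  Finite.of_injective (fun σ : Copy n => (σ.word, σ.flag)) fun _ _ h =>
    Copy.ext (congrArg Prod.fst h) (congrArg Prod.snd h)

/-- Crossing a wall. -/
def crossCopy (n : ℕ) : Wall → Copy n → Copy n
  | .inl i, σ => ⟨cross n i σ.word, σ.flag⟩
  | .inr _, σ => ⟨σ.word, !σ.flag⟩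

lemma crossCopy_crossCopy (n : ℕ) (i : Wall) (σ : Copy n) :
    crossCopy n i (crossCopy n i σ) = σ := by
  rcases i with i | i
  · exact Copy.ext (cross_cross n i σ.word) rfl
  · exact Copy.ext rfl (by simp [crossCopy])

lemma crossCopy_comm (n : ℕ) {i j : Wall} (h : Perp i j) (σ : Copy n) :
    crossCopy n i (crossCopy n j σ) = crossCopy n j (crossCopy n i σ) := by
  rcases i with i | i <;> rcases j with j | j
  · exact h.elim
  · rfl
  · rfl
  · exact h.elim

/-- The action of the reflection group on the copies of the hexagon. -/
def copyHom (a : ℝ) (n : ℕ) : HexGroup a →* Equiv.Perm (Copy n) :=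
  (hexSystem a).lift ⟨fun i => Function.Involutive.toPerm (crossCopy n i) (crossCopy_crossCopy n i),
    isLiftable_hexMatrix (fun i => Equiv.ext (crossCopy_crossCopy n i))
      (fun _ _ h => Equiv.ext (crossCopy_comm n h))⟩

instance (a : ℝ) (n : ℕ) : MulAction (HexGroup a) (Copy n) where
  smul g σ := copyHom a n g σ
  one_smul σ := by change copyHom a n 1 σ = σ; rw [map_one]; rfl
  mul_smul g h σ := by
    change copyHom a n (g * h) σ = copyHom a n g (copyHom a n h σ)
    rw [map_mul]; rfl

section CopyAction

variable {a : ℝ} {n : ℕ}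

lemma gen_smul_copy (i : Wall) (σ : Copy n) : gen a i • σ = crossCopy n i σ := by
  change copyHom a n (gen a i) σ = _
  rw [copyHom, gen, CoxeterSystem.lift_apply_simple]
  rfl

lemma cuff_smul_copy (i : Fin 3) (σ : Copy n) :
    gen a (.inl i) • σ = ⟨cross n i σ.word, σ.flag⟩ := gen_smul_copy _ σ

lemma seam_smul_copy (j : Fin 3) (σ : Copy n) :
    gen a (.inr j) • σ = ⟨σ.word, !σ.flag⟩ := gen_smul_copy _ σ

lemma cuff_smul_copy_eq_self_iff {i : Fin 3} {σ : Copy n} : gen a (.inl i) • σ = σ ↔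
    σ.word.1.length = n ∧ (i :: σ.word.1).IsChain (· ≠ ·) := by
  rw [cuff_smul_copy, Copy.ext_iff, ← cross_eq_self_iff]
  simp

lemma seam_smul_copy_ne (j : Fin 3) (σ : Copy n) : gen a (.inr j) • σ ≠ σ := by
  rw [seam_smul_copy]
  intro h
  have := congrArg Copy.flag h
  simp at this

/-- The copy of the hexagon from which the construction starts. -/
def baseCopy (n : ℕ) : Copy n := ⟨⟨[], by simp, List.isChain_nil⟩, false⟩

lemma exists_smul_baseCopy (σ : Copy n) : ∃ g : HexGroup a, g • baseCopy n = σ := by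
  obtain ⟨⟨w, hl, hw⟩, b⟩ := σ
  suffices h : ∃ g : HexGroup a, g • baseCopy n = ⟨⟨w, hl, hw⟩, false⟩ by
    obtain ⟨g, hg⟩ := h
    cases b
    · exact ⟨g, hg⟩
    · exact ⟨gen a (.inr 0) * g, by rw [mul_smul, hg, seam_smul_copy]; rfl⟩
  induction w with
  | nil => exact ⟨1, one_smul _ _⟩
  | cons i w ih =>
    rw [List.length_cons] at hl
    obtain ⟨g, hg⟩ := ih (by omega) hw.tail
    refine ⟨gen a (.inl i) * g, ?_⟩
    rw [mul_smul, hg, cuff_smul_copy]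
    refine Copy.ext (Subtype.ext ?_) rfl
    change crossList n i w = i :: w
    rw [crossList_of_chain hw, if_pos (by omega)]

lemma exists_smul_copy (σ τ : Copy n) : ∃ g : HexGroup a, g • τ = σ := by
  obtain ⟨g, hg⟩ := exists_smul_baseCopy (a := a) σ
  obtain ⟨h, hh⟩ := exists_smul_baseCopy (a := a) τ
  exact ⟨g * h⁻¹, by rw [mul_smul, ← hh, inv_smul_smul, hg]⟩

/-- The orientation character of the reflection group. -/
def sgn (a : ℝ) : HexGroup a →* ℤˣ :=
  (hexSystem a).lift ⟨fun _ => -1, isLiftable_hexMatrix (by simp) (by simp)⟩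

lemma sgn_gen (i : Wall) : sgn a (gen a i) = -1 := by
  rw [sgn, gen, CoxeterSystem.lift_apply_simple]

/-- The orientation of a copy of the hexagon in the surface. -/
def copySgn (σ : Copy n) : ℤˣ := (-1) ^ σ.word.1.length * if σ.flag then -1 else 1

/-- Neighbouring copies have opposite orientations. -/
lemma copySgn_gen_smul {i : Wall} {σ : Copy n} (h : gen a i • σ ≠ σ) :
    copySgn (gen a i • σ) = -copySgn σ := by
  rcases i with i | i
  · rw [cuff_smul_copy] at h ⊢
    rcases cross_cases n i σ.word with h1 | h1 | h1
    · exact (h (Copy.ext h1 rfl)).elim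
    · simp only [copySgn, h1, List.length_cons, pow_succ, mul_neg, mul_one, neg_mul]
    · simp only [copySgn, h1, List.length_cons, pow_succ, mul_neg, mul_one, neg_mul, neg_neg]
  · rw [seam_smul_copy]
    cases hb : σ.flag <;> simp [copySgn, hb]

end CopyAction

/-! ### The metric of the surfaces `X_n` -/

/-- Points of the disjoint union of the hyperbolic planes indexed by the copies of the hexagon. The
surface `X_n` is the quotient of this space by the diagonal action of the reflection group. -/
structure SheetPoint (a : ℝ) (n : ℕ) where
  pt : ℍ
  copy : Copy n

section Metric

variable {a : ℝ} [ha : Fact (1 < a)] {n : ℕ}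

/-- The distances between the representatives of two orbits. -/
def orbitDists (p q : SheetPoint a n) : Set ℝ :=
  {d | ∃ g : HexGroup a, g • q.copy = p.copy ∧ d = dist p.pt (g • q.pt)}

noncomputable instance : Dist (SheetPoint a n) := ⟨fun p q => sInf (orbitDists p q)⟩

lemma sheet_dist_le {p q : SheetPoint a n} {g : HexGroup a} (h : g • q.copy = p.copy) :
    dist p q ≤ dist p.pt (g • q.pt) :=
  csInf_le ⟨0, by rintro _ ⟨g, -, rfl⟩; exact dist_nonneg⟩ ⟨g, h, rfl⟩

/-- The distance between two orbits is attained, because the reflection group acts properly. -/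
lemma exists_sheet_dist_eq (p q : SheetPoint a n) :
    ∃ g : HexGroup a, g • q.copy = p.copy ∧ dist p q = dist p.pt (g • q.pt) := by
  obtain ⟨g₀, h₀⟩ := exists_smul_copy (a := a) p.copy q.copy
  set T : Set (HexGroup a) := {g | g • q.copy = p.copy ∧
    dist p.pt (g • q.pt) ≤ dist p.pt (g₀ • q.pt)}
  have hT : T.Finite := (finite_dist_smul_le p.pt q.pt _).subset fun g hg => hg.2
  obtain ⟨g, hg, hmin⟩ := exists_min_image T (fun g => dist p.pt (g • q.pt)) hT ⟨g₀, h₀, le_rfl⟩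
  refine ⟨g, hg.1, le_antisymm (sheet_dist_le hg.1) (le_csInf ⟨_, g, hg.1, rfl⟩ ?_)⟩
  rintro _ ⟨k, hk, rfl⟩
  rcases le_total (dist p.pt (k • q.pt)) (dist p.pt (g₀ • q.pt)) with h | h
  · exact hmin k ⟨hk, h⟩
  · exact hg.2.trans h

noncomputable instance : PseudoMetricSpace (SheetPoint a n) where
  dist_self p := by
    refine le_antisymm ?_ ?_
    · have := sheet_dist_le (p := p) (q := p) (g := 1) (one_smul _ _)
      rwa [one_smul, dist_self] at this
    · obtain ⟨g, -, h⟩ := exists_sheet_dist_eq p p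
      rw [h]; exact dist_nonneg
  dist_comm := by
    suffices h : ∀ p q : SheetPoint a n, dist p q ≤ dist q p from
      fun p q => le_antisymm (h p q) (h q p)
    intro p q
    obtain ⟨g, hg, h⟩ := exists_sheet_dist_eq q p
    rw [h, dist_comm, ← dist_smul g⁻¹, inv_smul_smul]
    exact sheet_dist_le (by rw [← hg, inv_smul_smul])
  dist_triangle p q r := by
    obtain ⟨g, hg, h⟩ := exists_sheet_dist_eq p q
    obtain ⟨k, hk, h'⟩ := exists_sheet_dist_eq q r
    calc dist p r ≤ dist p.pt ((g * k) • r.pt) := sheet_dist_le (by rw [mul_smul, hk, hg])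
      _ ≤ dist p.pt (g • q.pt) + dist (g • q.pt) ((g * k) • r.pt) := dist_triangle _ _ _
      _ = dist p q + dist q r := by rw [h, h', mul_smul, dist_smul]

end Metric

/-- The underlying metric space of the surface `X_n`. -/
def TreeSpace (a : ℝ) [Fact (1 < a)] (n : ℕ) : Type := SeparationQuotient (SheetPoint a n)

noncomputable instance (a : ℝ) [Fact (1 < a)] (n : ℕ) : MetricSpace (TreeSpace a n) :=
  inferInstanceAs (MetricSpace (SeparationQuotient (SheetPoint a n)))

section Projection

variable {a : ℝ} [ha : Fact (1 < a)] {n : ℕ}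

/-- The point of `X_n` that is represented by the point `x` in the plane with index `σ`. -/
noncomputable def proj (a : ℝ) [Fact (1 < a)] {n : ℕ} (σ : Copy n) (x : ℍ) : TreeSpace a n :=
  SeparationQuotient.mk (⟨x, σ⟩ : SheetPoint a n)

lemma dist_proj_le {σ τ : Copy n} (x y : ℍ) {g : HexGroup a} (h : g • τ = σ) :
    dist (proj a σ x) (proj a τ y) ≤ dist x (g • y) :=
  sheet_dist_le (p := ⟨x, σ⟩) (q := ⟨y, τ⟩) h

lemma exists_dist_proj_eq (σ τ : Copy n) (x y : ℍ) :
    ∃ g : HexGroup a, g • τ = σ ∧ dist (proj a σ x) (proj a τ y) = dist x (g • y) :=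
  exists_sheet_dist_eq (⟨x, σ⟩ : SheetPoint a n) ⟨y, τ⟩

lemma proj_eq_iff {σ τ : Copy n} {x y : ℍ} :
    proj a σ x = proj a τ y ↔ ∃ g : HexGroup a, g • τ = σ ∧ g • y = x := by
  constructor
  · intro h
    obtain ⟨g, hg, h'⟩ := exists_dist_proj_eq (a := a) σ τ x y
    rw [h, dist_self] at h'
    exact ⟨g, hg, (dist_eq_zero.1 h'.symm).symm⟩
  · rintro ⟨g, hg, rfl⟩
    have := dist_proj_le (g • y) y hg
    rw [dist_self] at this
    exact dist_eq_zero.1 (le_antisymm this dist_nonneg)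

lemma proj_smul (g : HexGroup a) (σ : Copy n) (x : ℍ) :
    proj a (g • σ) (g • x) = proj a σ x := proj_eq_iff.2 ⟨g, rfl, rfl⟩

lemma exists_proj_eq (q : TreeSpace a n) (σ : Copy n) : ∃ x, proj a σ x = q := by
  obtain ⟨⟨y, τ⟩, rfl⟩ := SeparationQuotient.surjective_mk q
  obtain ⟨g, hg⟩ := exists_smul_copy (a := a) σ τ
  exact ⟨g • y, proj_eq_iff.2 ⟨g, hg, rfl⟩⟩

lemma exists_proj_hexagon_eq (q : TreeSpace a n) : ∃ σ, ∃ z ∈ hexagon a, proj a σ z = q := by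
  obtain ⟨⟨y, τ⟩, rfl⟩ := SeparationQuotient.surjective_mk q
  obtain ⟨g, hg⟩ := exists_smul_mem_hexagon (a := a) y
  exact ⟨g • τ, g • y, hg, proj_smul g τ y⟩

/-- Points of the hexagons are identified only along walls. -/
lemma proj_hexagon_eq_iff {σ τ : Copy n} {x y : ℍ} (hx : x ∈ hexagon a) (hy : y ∈ hexagon a) :
    proj a σ x = proj a τ y ↔ x = y ∧ ∃ g ∈ wallGroup a y, g • τ = σ := by
  rw [proj_eq_iff]
  constructor
  · rintro ⟨g, hg, rfl⟩
    obtain ⟨h1, h2⟩ := smul_eq_self_of_mem_hexagon hy hx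
    exact ⟨h1, g, h2, hg⟩
  · rintro ⟨rfl, g, hg, h⟩
    exact ⟨g, h, smul_eq_of_mem_wallGroup hg⟩

lemma lipschitz_proj (σ : Copy n) (x y : ℍ) : dist (proj a σ x) (proj a σ y) ≤ dist x y := by
  have := dist_proj_le (a := a) x y (one_smul _ σ)
  rwa [one_smul] at this

lemma continuous_proj (σ : Copy n) : Continuous (proj a σ) :=
  (LipschitzWith.of_dist_le_mul (K := 1) fun x y => by
    rw [NNReal.coe_one, one_mul]; exact lipschitz_proj σ x y).continuous

end Projection

/-! ### Chambers -/

section Chamber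

variable {a : ℝ} [ha : Fact (1 < a)]

/-- A point in the interior of the hexagon. -/
noncomputable def center (a : ℝ) [ha : Fact (1 < a)] : ℍ := (exists_center ha.out).choose

lemma wallSide_center_pos (i : Wall) : 0 < wallSide a i (center a) :=
  (exists_center ha.out).choose_spec i

lemma center_mem_hexagon : center a ∈ hexagon a :=
  mem_hexagon.2 fun i => (wallSide_center_pos i).le

/-- A mirror `g • L`, where `L` is the geodesic that carries the wall `i`, is encoded by the pair
`(g, i)`. This is the reflection in it. -/
def mirrorRefl (m : HexGroup a × Wall) : HexGroup a := m.1 * gen a m.2 * m.1⁻¹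

/-- The signed distance to a mirror (more precisely, its hyperbolic sine). -/
noncomputable def mirrorSide (m : HexGroup a × Wall) (x : ℍ) : ℝ := wallSide a m.2 (m.1⁻¹ • x)

lemma mirrorSide_mirrorRefl (m : HexGroup a × Wall) (x : ℍ) :
    mirrorSide m (mirrorRefl m • x) = -mirrorSide m x := by
  rw [mirrorSide, mirrorRefl, mul_smul, mul_smul, inv_smul_smul, wallSide_gen_smul_self]; rfl

lemma mirrorRefl_smul_eq_self_iff (m : HexGroup a × Wall) (x : ℍ) :
    mirrorRefl m • x = x ↔ mirrorSide m x = 0 := by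
  rw [mirrorRefl, mul_smul, mul_smul, ← eq_inv_smul_iff, gen_smul_eq_self_iff]; rfl

lemma dist_mirrorRefl (m : HexGroup a × Wall) (x y : ℍ) :
    dist x (mirrorRefl m • y) =
      dist (m.1⁻¹ • x) (reflect (wallUnit a m.2) (m.1⁻¹ • y)) := by
  rw [← gen_smul, ← dist_smul m.1 (m.1⁻¹ • x), smul_inv_smul, mirrorRefl, mul_smul, mul_smul]

lemma dist_le_dist_mirrorRefl {m : HexGroup a × Wall} {x y : ℍ}
    (h : 0 ≤ mirrorSide m x * mirrorSide m y) : dist x y ≤ dist x (mirrorRefl m • y) := by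
  rw [dist_mirrorRefl, ← dist_smul m.1⁻¹]
  exact dist_le_dist_reflect (wallUnit a m.2) h

lemma dist_mirrorRefl_lt {m : HexGroup a × Wall} {x y : ℍ}
    (h : mirrorSide m x * mirrorSide m y < 0) : dist x (mirrorRefl m • y) < dist x y := by
  rw [dist_mirrorRefl, ← dist_smul m.1⁻¹ x y]
  exact dist_reflect_lt (wallUnit a m.2) h

lemma mirrorSide_mul_nonneg_iff {m : HexGroup a × Wall} {x y : ℍ} :
    0 ≤ mirrorSide m x * mirrorSide m y ↔ dist x y ≤ dist x (mirrorRefl m • y) :=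
  ⟨dist_le_dist_mirrorRefl, fun h => by
    by_contra hcon
    exact absurd h (not_le.2 (dist_mirrorRefl_lt (not_le.1 hcon)))⟩

lemma gen_ne_one (i : Wall) : gen a i ≠ 1 := by
  intro h
  have h1 : gen a i • center a = center a := by rw [h, one_smul]
  exact (wallSide_center_pos i).ne' ((gen_smul_eq_self_iff i _).1 h1)

lemma mirrorRefl_ne_one (m : HexGroup a × Wall) : mirrorRefl m ≠ 1 := by
  intro h
  rw [mirrorRefl, mul_inv_eq_one, mul_eq_left] at h
  exact gen_ne_one _ h

lemma mirrorSide_center_ne_zero (m : HexGroup a × Wall) : mirrorSide m (center a) ≠ 0 := by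
  intro h
  have h1 := (mirrorRefl_smul_eq_self_iff m _).2 h
  have h2 := (smul_eq_self_of_mem_hexagon (center_mem_hexagon (a := a))
    (w := mirrorRefl m) (by rw [h1]; exact center_mem_hexagon)).2
  rcases mem_wallGroup_cases h2 with h | ⟨i, hi, -⟩ | ⟨i, hi, -⟩ | ⟨i, -, hi, -⟩
  · exact mirrorRefl_ne_one m h
  all_goals exact (wallSide_center_pos _).ne' hi

lemma continuous_mirrorSide (m : HexGroup a × Wall) : Continuous (mirrorSide m) :=
  (continuous_side _).comp (isometry_smul ℍ m.1⁻¹).continuous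

/-- The intersection of the half-planes that are bounded by the mirrors in `R` and contain the
center of the hexagon. -/
def chamber (R : Set (HexGroup a × Wall)) : Set ℍ :=
  {x | ∀ m ∈ R, 0 ≤ mirrorSide m (center a) * mirrorSide m x}

lemma center_mem_chamber (R : Set (HexGroup a × Wall)) : center a ∈ chamber R :=
  fun _ _ => mul_self_nonneg _

lemma isClosed_chamber (R : Set (HexGroup a × Wall)) : IsClosed (chamber R) := by
  have : chamber R = ⋂ m ∈ R, {x | 0 ≤ mirrorSide m (center a) * mirrorSide m x} := by
    ext x; simp [chamber]
  rw [this]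
  exact isClosed_biInter fun m _ =>
    isClosed_le continuous_const (continuous_const.mul (continuous_mirrorSide m))

lemma mul_nonneg_of_mul_nonneg {c x y : ℝ} (hc : c ≠ 0) (hx : 0 ≤ c * x) (hy : 0 ≤ c * y) :
    0 ≤ x * y := by
  have h1 : 0 < c ^ 2 := by positivity
  have h2 : 0 ≤ c ^ 2 * (x * y) := by nlinarith [mul_nonneg hx hy]
  exact nonneg_of_mul_nonneg_right h2 h1

lemma mirrorSide_mul_nonneg {R : Set (HexGroup a × Wall)} {x y : ℍ} (hx : x ∈ chamber R)
    (hy : y ∈ chamber R) {m : HexGroup a × Wall} (hm : m ∈ R) :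
    0 ≤ mirrorSide m x * mirrorSide m y :=
  mul_nonneg_of_mul_nonneg (mirrorSide_center_ne_zero m) (hx m hm) (hy m hm)

/-- The reflections in the mirrors of a chamber fold the hyperbolic plane onto the chamber, without
increasing the distance to a given point of the chamber. Among the points of the orbit that are
no farther away, the one closest to the center lies in the chamber. -/
theorem exists_fold_chamber (R : Set (HexGroup a × Wall)) {x : ℍ} (hx : x ∈ chamber R) (y : ℍ) :
    ∃ u ∈ Subgroup.closure (mirrorRefl '' R), u • y ∈ chamber R ∧ dist x (u • y) ≤ dist x y := by
  set T : Set (HexGroup a) := {u | u ∈ Subgroup.closure (mirrorRefl '' R) ∧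
    dist x (u • y) ≤ dist x y}
  have hT : T.Finite := (finite_dist_smul_le x y (dist x y)).subset fun u hu => hu.2
  obtain ⟨u, hu, hmin⟩ := exists_min_image T (fun u => dist (center a) (u • y)) hT
    ⟨1, one_mem _, by rw [one_smul]⟩
  refine ⟨u, hu.1, fun m hm => ?_, hu.2⟩
  by_contra hcon
  rw [not_le] at hcon
  have h1 := dist_mirrorRefl_lt hcon
  have h2 : 0 ≤ mirrorSide m x * mirrorSide m (mirrorRefl m • u • y) := by
    rw [mirrorSide_mirrorRefl]
    refine mul_nonneg_of_mul_nonneg (mirrorSide_center_ne_zero m) (hx m hm) ?_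
    linarith
  have h3 := dist_le_dist_mirrorRefl h2
  have h4 : mirrorRefl m • mirrorRefl m • u • y = u • y := by
    rw [smul_smul, mirrorRefl]
    have : m.1 * gen a m.2 * m.1⁻¹ * (m.1 * gen a m.2 * m.1⁻¹) =
        m.1 * (gen a m.2 * gen a m.2) * m.1⁻¹ := by group
    rw [this, gen_mul_gen, mul_one, mul_inv_cancel, one_smul]
  rw [h4] at h3
  have h5 : mirrorRefl m * u ∈ T := by
    refine ⟨mul_mem (Subgroup.subset_closure ⟨m, hm, rfl⟩) hu.1, ?_⟩
    rw [mul_smul]; exact h3.trans hu.2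
  have h6 := hmin _ h5
  simp only [mul_smul] at h6
  linarith

/-- No mirror separates two points of the hexagon. -/
lemma wallSide_mul_nonneg {z z' : ℍ} (hz : z ∈ hexagon a) (hz' : z' ∈ hexagon a)
    (g : HexGroup a) (i : Wall) : 0 ≤ wallSide a i (g • z) * wallSide a i (g • z') := by
  rcases lt_or_gt_of_ne ((hexSystem a).length_simple_mul_ne g i) with h | h
  · have h0 : len (gen a i * g) < len (gen a i * (gen a i * g)) := by
      rw [← mul_assoc, gen_mul_gen, one_mul]; exact h
    have h1 := wallSide_nonneg_of_length_lt h0 hz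
    have h2 := wallSide_nonneg_of_length_lt h0 hz'
    rw [mul_smul, wallSide_gen_smul_self] at h1 h2
    nlinarith
  · exact mul_nonneg (wallSide_nonneg_of_length_lt h hz) (wallSide_nonneg_of_length_lt h hz')

lemma chamber_univ : chamber (univ : Set (HexGroup a × Wall)) = hexagon a := by
  ext x
  constructor
  · intro h
    refine mem_hexagon.2 fun i => ?_
    have := h (1, i) (mem_univ _)
    simp only [mirrorSide, inv_one, one_smul] at this
    exact nonneg_of_mul_nonneg_right this (wallSide_center_pos i)
  · exact fun h m _ => wallSide_mul_nonneg center_mem_hexagon h _ _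

/-- The hexagon is isometrically embedded in the quotient of the plane by the reflection group. -/
lemma dist_le_dist_smul {z z' : ℍ} (hz : z ∈ hexagon a) (hz' : z' ∈ hexagon a)
    (g : HexGroup a) : dist z z' ≤ dist z (g • z') := by
  obtain ⟨u, -, h1, h2⟩ := exists_fold_chamber (univ : Set (HexGroup a × Wall))
    (x := z) (by rwa [chamber_univ]) (g • z')
  rw [chamber_univ, smul_smul] at h1
  rw [smul_smul, (smul_eq_self_of_mem_hexagon hz' h1).1] at h2
  exact h2

/-- Every side of the hexagon has a point that is not a corner. -/
lemma exists_edge_point (i : Wall) :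
    ∃ e : ℍ, wallSide a i e = 0 ∧ ∀ l ≠ i, 0 < wallSide a l e := by
  set c := center a
  set d := dist c (gen a i • c) with hd
  have hc : ∀ j, 0 < wallSide a j c := fun j => wallSide_center_pos j
  have hne : c ≠ gen a i • c := fun h => (hc i).ne' ((gen_smul_eq_self_iff i _).1 h.symm)
  have hd0 : 0 < d := dist_pos.2 hne
  obtain ⟨γ, h0, h1, hγ, -⟩ := exists_geodesic c (gen a i • c)
  have m0 : (0 : ℝ) ∈ Icc 0 d := ⟨le_rfl, hd0.le⟩
  have m1 : d ∈ Icc 0 d := ⟨hd0.le, le_rfl⟩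
  have m2 : d / 2 ∈ Icc 0 d := ⟨by linarith, by linarith⟩
  have e1 : dist c (γ (d / 2)) = d / 2 := by
    have := hγ 0 m0 _ m2
    rwa [h0, zero_sub, abs_neg, abs_of_pos (by linarith)] at this
  have e2 : dist (γ (d / 2)) (gen a i • c) = d / 2 := by
    have := hγ _ m2 d m1
    rw [h1, abs_sub_comm, abs_of_nonneg (by linarith)] at this
    linarith
  have key := toVec_of_between e1 e2 (by linarith)
  have hS : 0 < Real.sinh (d / 2 + d / 2) := Real.sinh_pos_iff.2 (by linarith)
  have hs : 0 < Real.sinh (d / 2) := Real.sinh_pos_iff.2 (by linarith)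
  have hside : ∀ l, Real.sinh (d / 2 + d / 2) * wallSide a l (γ (d / 2)) =
      Real.sinh (d / 2) * (wallSide a l c + wallSide a l (gen a i • c)) := by
    intro l
    have := congrArg (bil (wallVec a l)) key
    rw [bil_smul_right, bil_add_right, bil_smul_right, bil_smul_right] at this
    simp only [wallSide, side]
    linarith
  refine ⟨γ (d / 2), ?_, fun l hl => ?_⟩
  · have := hside i
    rw [wallSide_gen_smul_self, add_neg_cancel, mul_zero] at this
    exact (mul_eq_zero.1 this).resolve_left hS.ne'
  · have h2 := hside l
    have h3 : bil (wallVec a l) (wallVec a i) ≤ 0 := by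
      by_cases hp : Perp l i
      · exact (bil_wallVec_of_perp ha.out hp).le
      · linarith [bil_wallVec_le ha.out hl hp]
    rw [wallSide_gen_smul] at h2
    have h4 : 0 < wallSide a l c + (wallSide a l c -
        2 * bil (wallVec a l) (wallVec a i) * wallSide a i c) := by
      have := mul_nonpos_of_nonpos_of_nonneg h3 (hc i).le
      linarith [hc l]
    have h5 : 0 < Real.sinh (d / 2 + d / 2) * wallSide a l (γ (d / 2)) := by
      rw [h2]; exact mul_pos hs h4
    exact pos_of_mul_pos_right h5 hS.le

/-- The only mirror between two neighbouring hexagons is the one that carries their common side. -/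
lemma eq_gen_of_separates {k : HexGroup a} {i j : Wall}
    (h : wallSide a j (k • center a) * wallSide a j (k • gen a i • center a) < 0) :
    k⁻¹ * gen a j * k = gen a i := by
  obtain ⟨e, he0, he⟩ := exists_edge_point (a := a) i
  have heH : e ∈ hexagon a := mem_hexagon.2 fun l => by
    rcases eq_or_ne l i with rfl | hl
    · exact he0.ge
    · exact (he l hl).le
  have h1 := wallSide_mul_nonneg center_mem_hexagon heH k j
  have h2 := wallSide_mul_nonneg center_mem_hexagon heH (k * gen a i) j
  rw [mul_smul, mul_smul, (gen_smul_eq_self_iff i e).2 he0] at h2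
  have h3 : wallSide a j (k • e) = 0 := by
    by_contra hne
    have h4 : 0 < wallSide a j (k • e) ^ 2 := by positivity
    nlinarith [mul_nonneg h1 h2]
  have h5 : (k⁻¹ * gen a j * k) • e = e := by
    rw [mul_smul, mul_smul, (gen_smul_eq_self_iff j _).2 h3, inv_smul_smul]
  have h6 := (smul_eq_self_of_mem_hexagon heH (w := k⁻¹ * gen a j * k) (by rw [h5]; exact heH)).2
  have hwall : ∀ l, wallSide a l e = 0 → l = i := fun l hl => by
    by_contra hne
    exact (he l hne).ne' hl
  rcases mem_wallGroup_cases h6 with h | ⟨l, hl, h⟩ | ⟨l, hl, h⟩ | ⟨l, l', hl, hl', -⟩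
  · refine absurd ?_ (gen_ne_one (a := a) j)
    have : gen a j = k * (k⁻¹ * gen a j * k) * k⁻¹ := by group
    rw [this, h]; group
  · rw [h, hwall _ hl]
  · rw [h, hwall _ hl]
  · exact absurd ((hwall _ hl).trans (hwall _ hl').symm) (by simp)

end Chamber

/-! ### The regions that cover the surfaces -/

section Region

variable {a : ℝ} [ha : Fact (1 < a)] {n : ℕ}

/-- The mirrors that become boundary in the plane with index `σ`. -/
def boundaryMirrors (a : ℝ) {n : ℕ} (σ : Copy n) : Set (HexGroup a × Wall) :=
  {m | mirrorRefl m • σ = σ}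

/-- The region of the plane with index `σ` that covers the surface `X_n`. -/
def region (a : ℝ) [Fact (1 < a)] {n : ℕ} (σ : Copy n) : Set ℍ := chamber (boundaryMirrors a σ)

omit ha in
lemma mem_boundaryMirrors_iff {m : HexGroup a × Wall} {σ : Copy n} :
    m ∈ boundaryMirrors a σ ↔ gen a m.2 • m.1⁻¹ • σ = m.1⁻¹ • σ := by
  rw [eq_inv_smul_iff, smul_smul, smul_smul]; rfl

omit ha in
lemma not_fixes_of_seam (i j : Fin 3) (σ : Copy n) :
    (gen a (.inl i) * gen a (.inr j)) • σ ≠ σ := by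
  rw [mul_smul, seam_smul_copy, cuff_smul_copy]
  intro h
  have := congrArg Copy.flag h
  simp at this

/-- The elements of the reflection group that fix a point and an index are the identity and at most
one reflection, and the latter is a reflection in a boundary mirror. -/
lemma fixes_cases (z : ℍ) (σ : Copy n) :
    (∀ g : HexGroup a, g • z = z → g • σ = σ → g = 1) ∨
      ∃ m ∈ boundaryMirrors a σ, mirrorSide m z = 0 ∧ (∃ i, m.2 = .inl i) ∧
        ∀ g : HexGroup a, g • z = z → g • σ = σ → g = 1 ∨ g = mirrorRefl m := by
  obtain ⟨k, hk⟩ := exists_smul_mem_hexagon (a := a) z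
  have key : ∀ g : HexGroup a, g • z = z → g • σ = σ → g = 1 ∨
      ∃ i, wallSide a (.inl i) (k • z) = 0 ∧ gen a (.inl i) • k • σ = k • σ ∧
        g = mirrorRefl (k⁻¹, .inl i) := by
    intro g hz hσ
    have h1 : (k * g * k⁻¹) • k • z = k • z := by
      rw [mul_smul, mul_smul, inv_smul_smul, hz]
    have h2 : (k * g * k⁻¹) • k • σ = k • σ := by
      rw [mul_smul, mul_smul, inv_smul_smul, hσ]
    have h3 : g = k⁻¹ * (k * g * k⁻¹) * k := by group
    rcases mem_wallGroup_cases (smul_eq_self_of_mem_hexagon hk (by rw [h1]; exact hk)).2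
      with h | ⟨i, hi, h⟩ | ⟨i, -, h⟩ | ⟨i, j, -, -, h⟩
    · left; rw [h3, h]; group
    · right
      refine ⟨i, hi, by rw [← h, h2], ?_⟩
      rw [h] at h3; rw [h3, mirrorRefl, inv_inv]
    · rw [h] at h2; exact absurd h2 (seam_smul_copy_ne _ _)
    · rw [h] at h2; exact absurd h2 (not_fixes_of_seam _ _ _)
  by_cases hex : ∃ i, wallSide a (.inl i) (k • z) = 0 ∧ gen a (.inl i) • k • σ = k • σ
  · obtain ⟨i, hi, hi'⟩ := hex
    refine .inr ⟨(k⁻¹, .inl i), ?_, ?_, ⟨i, rfl⟩, fun g hz hσ => ?_⟩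
    · rw [mem_boundaryMirrors_iff, inv_inv]; exact hi'
    · rw [mirrorSide, inv_inv]; exact hi
    · rcases key g hz hσ with h | ⟨j, hj, -, h⟩
      · exact .inl h
      · obtain rfl := cuff_unique hi hj
        exact .inr h
  · refine .inl fun g hz hσ => (key g hz hσ).resolve_right ?_
    rintro ⟨i, hi, hi', -⟩
    exact hex ⟨i, hi, hi'⟩

lemma eq_mirrorRefl_of_fixes {z : ℍ} {σ : Copy n} {g : HexGroup a} (hz : g • z = z)
    (hσ : g • σ = σ) : g = 1 ∨ ∃ m ∈ boundaryMirrors a σ, mirrorSide m z = 0 ∧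
      g = mirrorRefl m := by
  rcases fixes_cases (a := a) z σ with h | ⟨m, hm, h0, -, h⟩
  · exact .inl (h g hz hσ)
  · exact (h g hz hσ).imp id fun h => ⟨m, hm, h0, h⟩

lemma mirrorRefl_eq_of_fixes {z : ℍ} {σ : Copy n} {m m' : HexGroup a × Wall}
    (hm : m ∈ boundaryMirrors a σ) (hm' : m' ∈ boundaryMirrors a σ) (h : mirrorRefl m • z = z)
    (h' : mirrorRefl m' • z = z) : mirrorRefl m = mirrorRefl m' := by
  rcases fixes_cases (a := a) z σ with h1 | ⟨m₀, -, -, -, h1⟩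
  · exact absurd (h1 _ h hm) (mirrorRefl_ne_one m)
  · rw [(h1 _ h hm).resolve_left (mirrorRefl_ne_one m),
      (h1 _ h' hm').resolve_left (mirrorRefl_ne_one m')]

/-- A uniform radius below which the quotient map is under control. -/
noncomputable def rad (a : ℝ) [ha : Fact (1 < a)] : ℝ := (exists_uniform_radius (a := a)).choose / 3

lemma rad_pos : 0 < rad a := div_pos (exists_uniform_radius (a := a)).choose_spec.1 (by norm_num)

lemma exists_common_fixed_point (x : ℍ) : ∃ z : ℍ, ∀ (g : HexGroup a),
    ∀ y ∈ Metric.ball x (3 * rad a), g • y ∈ Metric.ball x (3 * rad a) → g • z = z := by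
  have := (exists_uniform_radius (a := a)).choose_spec.2 x
  rwa [show 3 * rad a = (exists_uniform_radius (a := a)).choose by rw [rad]; ring]

/-- The quotient map is isometric on small sets that no boundary mirror separates. -/
lemma dist_proj_eq {σ : Copy n} {x y y' : ℍ} (hy : y ∈ Metric.ball x (rad a))
    (hy' : y' ∈ Metric.ball x (rad a))
    (hside : ∀ m ∈ boundaryMirrors a σ, 0 ≤ mirrorSide m y * mirrorSide m y') :
    dist (proj a σ y) (proj a σ y') = dist y y' := by
  refine le_antisymm (lipschitz_proj σ y y') ?_
  obtain ⟨g, hg, h⟩ := exists_dist_proj_eq (a := a) σ σ y y'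
  obtain ⟨z, hz⟩ := exists_common_fixed_point (a := a) x
  have h1 : dist y (g • y') ≤ dist y y' := h ▸ lipschitz_proj σ y y'
  rw [Metric.mem_ball] at hy hy'
  have h2 : dist y y' < 2 * rad a := by
    linarith [dist_triangle y x y', dist_comm x y']
  have h3 : dist (g • y') x < 3 * rad a := by
    linarith [dist_triangle (g • y') y x, dist_comm y (g • y')]
  have h4 := hz g y' (by rw [Metric.mem_ball]; linarith [rad_pos (a := a)]) h3
  rcases eq_mirrorRefl_of_fixes h4 hg with rfl | ⟨m, hm, -, rfl⟩
  · rw [h, one_smul]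
  · rw [h]; exact dist_le_dist_mirrorRefl (hside m hm)

lemma dist_proj_region_eq {σ : Copy n} {x y y' : ℍ} (hy : y ∈ Metric.ball x (rad a))
    (hy' : y' ∈ Metric.ball x (rad a)) (h : y ∈ region a σ) (h' : y' ∈ region a σ) :
    dist (proj a σ y) (proj a σ y') = dist y y' :=
  dist_proj_eq hy hy' fun _ hm => mirrorSide_mul_nonneg h h' hm

/-- Points of the surface can be lifted to the region without changing the distance to a given
point. -/
lemma exists_lift {σ : Copy n} {x : ℍ} (hx : x ∈ region a σ) (q : TreeSpace a n) :
    ∃ y ∈ region a σ, proj a σ y = q ∧ dist x y = dist (proj a σ x) q := by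
  obtain ⟨y₀, rfl⟩ := exists_proj_eq q σ
  obtain ⟨g, hg, h⟩ := exists_dist_proj_eq (a := a) σ σ x y₀
  obtain ⟨u, hu, h1, h2⟩ := exists_fold_chamber _ hx (g • y₀)
  have huσ : u • σ = σ := by
    have : Subgroup.closure (mirrorRefl '' boundaryMirrors a σ) ≤
        MulAction.stabilizer (HexGroup a) σ := by
      rw [Subgroup.closure_le]
      rintro _ ⟨m, hm, rfl⟩
      exact hm
    exact this hu
  have h3 : proj a σ (u • g • y₀) = proj a σ y₀ :=
    proj_eq_iff.2 ⟨u * g, by rw [mul_smul, hg, huσ], mul_smul _ _ _⟩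
  refine ⟨_, h1, h3, le_antisymm (h2.trans h.ge) ?_⟩
  rw [← h3]
  exact lipschitz_proj σ _ _

/-! ### Galleries of hexagons in the region -/

/-- `g` is reached from `1` by crossing walls that are not boundary walls in the plane with index
`σ`. -/
inductive Reach (σ : Copy n) : HexGroup a → Prop
  | one : Reach σ 1
  | step {g : HexGroup a} {i : Wall} : Reach σ g → gen a i • g⁻¹ • σ ≠ g⁻¹ • σ →
      Reach σ (g * gen a i)

/-- Every hexagon whose center lies in the region is the end of a gallery in the region. -/
lemma reach_of_center_mem {σ : Copy n} {g : HexGroup a} (h : g • center a ∈ region a σ) :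
    Reach σ g := by
  induction hn : len g using Nat.strong_induction_on generalizing g with
  | _ N ih =>
    subst hn
    rcases eq_or_ne g 1 with rfl | hg
    · exact .one
    obtain ⟨i, hi⟩ := (hexSystem a).exists_rightDescent_of_ne_one hg
    change len (g * gen a i) < len g at hi
    have hside : wallSide a i (g⁻¹ • center a) ≤ 0 := by
      have h0 : len (gen a i * g⁻¹) < len (gen a i * (gen a i * g⁻¹)) := by
        have e1 : gen a i * g⁻¹ = (g * gen a i)⁻¹ := by rw [mul_inv_rev, gen_inv]
        have e2 : gen a i * (gen a i * g⁻¹) = g⁻¹ := by rw [← mul_assoc, gen_mul_gen, one_mul]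
        rw [e2, e1, len, len, CoxeterSystem.length_inv, CoxeterSystem.length_inv]
        exact hi
      have := wallSide_nonneg_of_length_lt h0 center_mem_hexagon
      rw [mul_smul, wallSide_gen_smul_self] at this
      linarith
    have hne : gen a i • g⁻¹ • σ ≠ g⁻¹ • σ := by
      intro hfix
      have h1 := h (g, i) (mem_boundaryMirrors_iff.2 hfix)
      have h2 : mirrorSide (g, i) (g • center a) = wallSide a i (center a) := by
        rw [mirrorSide, inv_smul_smul]
      have h3 : mirrorSide (g, i) (center a) < 0 :=
        lt_of_le_of_ne hside (mirrorSide_center_ne_zero _)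
      rw [h2] at h1
      nlinarith [wallSide_center_pos (a := a) i]
    have hmem : (g * gen a i) • center a ∈ region a σ := by
      intro m hm
      by_contra hcon
      rw [not_le] at hcon
      have h1 := h m hm
      have h2 : mirrorSide m (g • center a) ≠ 0 := by
        intro h0
        have := mirrorSide_center_ne_zero (a := a) (g⁻¹ * m.1, m.2)
        apply this
        rw [mirrorSide] at h0 ⊢
        rw [mul_inv_rev, inv_inv, mul_smul]
        exact h0
      have h3 : mirrorSide m (g • center a) * mirrorSide m ((g * gen a i) • center a) < 0 := by
        have h4 : 0 < mirrorSide m (center a) * mirrorSide m (g • center a) :=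
          lt_of_le_of_ne h1 (mul_ne_zero (mirrorSide_center_ne_zero m) h2).symm
        have h5 : 0 < mirrorSide m (center a) ^ 2 := by
          have := mirrorSide_center_ne_zero (a := a) m
          positivity
        nlinarith [mul_neg_of_pos_of_neg h4 hcon]
      have h6 := eq_gen_of_separates (a := a) (k := m.1⁻¹ * g) (i := i) (j := m.2) (by
        simpa only [mirrorSide, mul_smul] using h3)
      apply hne
      rw [← h6]
      have h7 : (m.1⁻¹ * g)⁻¹ * gen a m.2 * (m.1⁻¹ * g) = g⁻¹ * mirrorRefl m * g := by
        rw [mirrorRefl]; group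
      rw [h7, mul_smul, mul_smul, smul_inv_smul, show mirrorRefl m • σ = σ from hm]
    have := Reach.step (i := i) (ih _ hi hmem rfl) (by
      rw [mul_inv_rev, gen_inv, mul_smul, smul_smul, gen_mul_gen, one_smul]
      exact hne.symm)
    rwa [mul_assoc, gen_mul_gen, mul_one] at this

/-- The region is a union of images of the hexagon. -/
lemma exists_center_mem {σ : Copy n} {x : ℍ} (hx : x ∈ region a σ) :
    ∃ g : HexGroup a, g⁻¹ • x ∈ hexagon a ∧ g • center a ∈ region a σ := by
  obtain ⟨g₀, h₀⟩ := exists_smul_mem_hexagon (a := a) x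
  set T : Set (HexGroup a) := {g | g⁻¹ • x ∈ hexagon a ∧
    dist (center a) (g • center a) ≤ dist (center a) (g₀⁻¹ • center a)}
  have hT : T.Finite := (finite_dist_smul_le (center a) (center a) _).subset fun g hg => hg.2
  obtain ⟨g, hg, hmin⟩ := exists_min_image T (fun g => dist (center a) (g • center a)) hT
    ⟨g₀⁻¹, by rwa [inv_inv], le_rfl⟩
  refine ⟨g, hg.1, fun m hm => ?_⟩
  by_contra hcon
  rw [not_le] at hcon
  have h1 : 0 ≤ mirrorSide m x * mirrorSide m (g • center a) := by
    have := wallSide_mul_nonneg hg.1 center_mem_hexagon (m.1⁻¹ * g) m.2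
    rwa [mul_smul, mul_smul, smul_inv_smul] at this
  have h2 : mirrorSide m x = 0 := by
    by_contra hne
    have h3 := hx m hm
    have h4 : 0 < mirrorSide m x ^ 2 := by positivity
    nlinarith [mul_nonneg h3 h1]
  have h5 : mirrorRefl m * g ∈ T := by
    refine ⟨?_, ?_⟩
    · have : (mirrorRefl m)⁻¹ • x = x := by
        rw [inv_smul_eq_iff, (mirrorRefl_smul_eq_self_iff m x).2 h2]
      rw [mul_inv_rev, mul_smul, this]
      exact hg.1
    · rw [mul_smul]; exact (dist_mirrorRefl_lt hcon).le.trans hg.2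
  have h6 := hmin _ h5
  have h7 := dist_mirrorRefl_lt hcon
  simp only [mul_smul] at h6
  linarith

lemma exists_reach {σ : Copy n} {x : ℍ} (hx : x ∈ region a σ) :
    ∃ g : HexGroup a, g⁻¹ • x ∈ hexagon a ∧ Reach σ g :=
  let ⟨g, h1, h2⟩ := exists_center_mem hx
  ⟨g, h1, reach_of_center_mem h2⟩

omit ha in
lemma Reach.sgn_mul {σ : Copy n} {g : HexGroup a} (h : Reach σ g) :
    sgn a g * copySgn (g⁻¹ • σ) = copySgn σ := by
  induction h with
  | one => rw [map_one, inv_one, one_smul, one_mul]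
  | step _ hne ih =>
    rw [mul_inv_rev, gen_inv, mul_smul, copySgn_gen_smul hne, map_mul, sgn_gen, ← ih]
    simp

lemma exists_oriented {z : ℍ} {k : HexGroup a} (hk : k ∈ wallGroup a z) (τ : Copy n) :
    ∃ k' ∈ wallGroup a z, k' • τ = k • τ ∧ copySgn (k' • τ) = sgn a k' * copySgn τ := by
  have hseam : ∀ j, copySgn (gen a (.inr j) • τ) = -copySgn τ := fun j =>
    copySgn_gen_smul (seam_smul_copy_ne j τ)
  rcases mem_wallGroup_cases hk with rfl | ⟨i, hi, rfl⟩ | ⟨j, hj, rfl⟩ | ⟨i, j, hi, hj, rfl⟩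
  · exact ⟨1, one_mem _, rfl, by simp⟩
  · by_cases h : gen a (.inl i) • τ = τ
    · exact ⟨1, one_mem _, by rw [h, one_smul], by simp⟩
    · exact ⟨_, hk, rfl, by rw [copySgn_gen_smul h, sgn_gen, neg_one_mul]⟩
  · exact ⟨_, hk, rfl, by rw [hseam, sgn_gen, neg_one_mul]⟩
  · by_cases h : gen a (.inl i) • gen a (.inr j) • τ = gen a (.inr j) • τ
    · exact ⟨_, gen_mem_wallGroup hj, by rw [mul_smul, h], by rw [hseam, sgn_gen, neg_one_mul]⟩
    · exact ⟨_, hk, rfl, by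
        rw [mul_smul, copySgn_gen_smul h, hseam, map_mul, sgn_gen, sgn_gen]; simp⟩

/-- Two points of the region with the same image in the surface differ by an orientation preserving
element of the reflection group. -/
lemma exists_oriented_smul {σ : Copy n} {y y' : ℍ} (hy : y ∈ region a σ) (hy' : y' ∈ region a σ)
    (h : proj a σ y = proj a σ y') :
    ∃ g : HexGroup a, g • σ = σ ∧ g • y = y' ∧ sgn a g = 1 := by
  obtain ⟨g, hg, hr⟩ := exists_reach hy
  obtain ⟨g', hg', hr'⟩ := exists_reach hy'
  rw [← proj_smul g⁻¹, ← proj_smul g'⁻¹ σ y', eq_comm, proj_hexagon_eq_iff hg' hg] at h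
  obtain ⟨hz, k, hk, hkσ⟩ := h
  obtain ⟨k', hk', h1, h2⟩ := exists_oriented hk (g⁻¹ • σ)
  refine ⟨g' * k' * g⁻¹, ?_, ?_, ?_⟩
  · rw [mul_smul, mul_smul, h1, hkσ, smul_inv_smul]
  · rw [mul_smul, mul_smul, smul_eq_of_mem_wallGroup hk', ← hz, smul_inv_smul]
  · have e1 := hr.sgn_mul
    have e2 := hr'.sgn_mul
    rw [h1, hkσ] at h2
    rw [h2, ← e1] at e2
    have e3 : sgn a g' * sgn a k' * copySgn (g⁻¹ • σ) = sgn a g * copySgn (g⁻¹ • σ) := by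
      rw [mul_assoc]; exact e2
    rw [map_mul, map_mul, map_inv, mul_right_cancel e3, mul_inv_cancel]

end Region

/-! ### Local isometries that are covering maps -/

/-- A map between metric spaces that is isometric on all balls of some radius, and along which short
distances can be lifted, is a covering map. -/
theorem isCoveringMap_of_uniform {E X : Type*} [MetricSpace E] [MetricSpace X] {p : E → X} {ε : ℝ}
    (hε : 0 < ε)
    (iso : ∀ x, ∀ y ∈ Metric.ball x ε, ∀ y' ∈ Metric.ball x ε, dist (p y) (p y') = dist y y')
    (lift : ∀ x q, dist (p x) q < ε → ∃ y, p y = q ∧ dist x y = dist (p x) q) :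
    IsCoveringMap p := by
  intro q
  have hcont : Continuous p := Metric.continuous_iff.2 fun x δ hδ =>
    ⟨min δ ε, lt_min hδ hε, fun y hy => by
      rw [iso x y (lt_of_lt_of_le hy (min_le_right _ _)) x (Metric.mem_ball_self hε)]
      exact lt_of_lt_of_le hy (min_le_left _ _)⟩
  rcases isEmpty_or_nonempty (p ⁻¹' {q}) with hem | hne
  · refine .of_preimage_eq_empty _ (Metric.ball_mem_nhds q hε) ?_
    rw [eq_empty_iff_forall_notMem]
    intro x hx
    obtain ⟨y, hy, -⟩ := lift x q hx
    exact hem.false ⟨y, hy⟩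
  have hdisc : DiscreteTopology (p ⁻¹' {q}) := by
    refine DiscreteTopology.of_forall_le_dist hε fun x y hxy => ?_
    by_contra hcon
    rw [not_le] at hcon
    have h1 := iso x x (Metric.mem_ball_self hε) y (by rwa [Metric.mem_ball, dist_comm])
    rw [show p x = q from x.2, show p y = q from y.2, dist_self] at h1
    exact hxy (Subtype.ext (dist_eq_zero.1 h1.symm))
  obtain ⟨e₀⟩ := hne
  have : Nonempty (X → E) := ⟨fun _ => e₀⟩
  have : Nonempty (p ⁻¹' {q}) := ⟨e₀⟩
  have hsurj : ∀ e : p ⁻¹' {q}, ∀ w ∈ Metric.ball q (ε / 2),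
      ∃ y ∈ Metric.ball (e : E) (ε / 2), p y = w := by
    intro e w hw
    have he : p e = q := e.2
    rw [Metric.mem_ball, dist_comm] at hw
    obtain ⟨y, hy, hd⟩ := lift e w (by rw [he]; linarith)
    exact ⟨y, by rw [Metric.mem_ball, dist_comm, hd, he]; exact hw, hy⟩
  have hball : ∀ e : E, Metric.ball e (ε / 2) ⊆ Metric.ball e ε := fun e =>
    Metric.ball_subset_ball (by linarith)
  refine .of_trivialization (t := IsOpen.trivializationDiscrete
    (fun e : p ⁻¹' {q} => Metric.ball (e : E) (ε / 2)) (Metric.ball q (ε / 2)) Metric.isOpen_ball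
    (fun e W hW => ⟨fun h => (h.preimage hcont).inter Metric.isOpen_ball, fun h => ?_⟩)
    (fun e y hy y' hy' h => ?_) (fun e w hw => ?_) (fun e e' hee' => ?_) (fun x hx => ?_))
    (Metric.mem_ball_self (by linarith))
  · rw [Metric.isOpen_iff] at h ⊢
    intro w hw
    obtain ⟨y, hy, rfl⟩ := hsurj e w (hW hw)
    obtain ⟨δ, hδ, hsub⟩ := h y ⟨hw, hy⟩
    refine ⟨min δ ε, lt_min hδ hε, fun w' hw' => ?_⟩
    rw [Metric.mem_ball, dist_comm] at hw'
    obtain ⟨y', rfl, hd⟩ := lift y w' (lt_of_lt_of_le hw' (min_le_right _ _))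
    refine (hsub ?_).1
    rw [Metric.mem_ball, dist_comm, hd]
    exact lt_of_lt_of_le hw' (min_le_left _ _)
  · have := iso e y (hball _ hy) y' (hball _ hy')
    rw [h, dist_self] at this
    exact dist_eq_zero.1 this.symm
  · obtain ⟨y, hy, h⟩ := hsurj e w hw
    exact ⟨y, hy, h⟩
  · rw [Function.onFun, Set.disjoint_left]
    intro x hx hx'
    apply hee'
    have he : p e = q := e.2
    have he' : p e' = q := e'.2
    rw [Metric.mem_ball] at hx hx'
    have h1 : dist (e' : E) e < ε := by
      linarith [dist_triangle (e' : E) x e, dist_comm x (e' : E)]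
    have := iso e e (Metric.mem_ball_self hε) e' h1
    rw [he, he', dist_self] at this
    exact Subtype.ext (dist_eq_zero.1 this.symm)
  · have hx' : dist (p x) q < ε / 2 := hx
    obtain ⟨y, hy, hd⟩ := lift x q (by linarith)
    exact mem_iUnion.2 ⟨⟨y, hy⟩, by rw [Metric.mem_ball, hd]; exact hx'⟩

/-! ### Positioning geodesics -/

lemma cosSin_of_sq_add_sq {x y : ℝ} (h : x ^ 2 + y ^ 2 = 1) :
    ∃ θ : ℝ, Real.cos θ = x ∧ Real.sin θ = y := by
  have h1 : ‖(⟨x, y⟩ : ℂ)‖ = 1 := by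
    rw [← pow_left_inj₀ (norm_nonneg _) zero_le_one two_ne_zero, Complex.sq_norm,
      Complex.normSq_apply]
    simp only; linarith
  have h0 : (⟨x, y⟩ : ℂ) ≠ 0 := by rw [← norm_ne_zero_iff, h1]; exact one_ne_zero
  refine ⟨Complex.arg ⟨x, y⟩, ?_, ?_⟩
  · rw [Complex.cos_arg h0, h1, div_one]
  · rw [Complex.sin_arg, h1, div_one]

/-- The linear action of `SL(2, ℝ)` on Lorentz space, in a contravariant form. -/
noncomputable def slPull (g : SL(2, ℝ)) (v : Vec) : Vec :=
  ((g 0 0 * g 1 1 + g 0 1 * g 1 0) * v.1 - g 0 0 * g 0 1 * v.2.2 + g 1 0 * g 1 1 * v.2.1,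
    2 * g 0 1 * g 1 1 * v.1 - g 0 1 ^ 2 * v.2.2 + g 1 1 ^ 2 * v.2.1,
    -2 * g 0 0 * g 1 0 * v.1 + g 0 0 ^ 2 * v.2.2 - g 1 0 ^ 2 * v.2.1)

lemma sl_det (g : SL(2, ℝ)) : g 0 0 * g 1 1 - g 0 1 * g 1 0 = 1 := by
  have := g.det_coe
  rwa [Matrix.det_fin_two] at this

lemma bil_slPull (g : SL(2, ℝ)) (v w : Vec) : bil (slPull g v) (slPull g w) = bil v w := by
  have h := sl_det g
  have : bil (slPull g v) (slPull g w) =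
      (g 0 0 * g 1 1 - g 0 1 * g 1 0) ^ 2 * bil v w := by
    simp only [bil, slPull]; ring
  rw [this, h]; ring

lemma sl_im_smul (g : SL(2, ℝ)) (z : ℍ) :
    (g • z).im = z.im / ((g 1 0 * z.re + g 1 1) ^ 2 + (g 1 0 * z.im) ^ 2) := by
  rw [← UpperHalfPlane.coe_im, UpperHalfPlane.coe_specialLinearGroup_apply, Complex.div_im]
  have h := sl_det g
  simp [Complex.normSq_apply]
  rw [← sub_div]
  congr 1
  · linear_combination z.im * h
  · ring

lemma sl_re_smul (g : SL(2, ℝ)) (z : ℍ) :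
    (g • z).re = (g 0 0 * g 1 0 * (z.re ^ 2 + z.im ^ 2) +
      (g 0 0 * g 1 1 + g 0 1 * g 1 0) * z.re + g 0 1 * g 1 1) /
        ((g 1 0 * z.re + g 1 1) ^ 2 + (g 1 0 * z.im) ^ 2) := by
  rw [← UpperHalfPlane.coe_re, UpperHalfPlane.coe_specialLinearGroup_apply, Complex.div_re]
  simp [Complex.normSq_apply]
  rw [← add_div]
  congr 1
  · ring
  · ring

lemma sl_denom_pos (g : SL(2, ℝ)) (z : ℍ) :
    0 < (g 1 0 * z.re + g 1 1) ^ 2 + (g 1 0 * z.im) ^ 2 := by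
  have h := sl_det g
  have hy := z.im_pos
  by_contra hcon
  have h1 : g 1 0 * z.im = 0 := by
    nlinarith [sq_nonneg (g 1 0 * z.re + g 1 1), sq_nonneg (g 1 0 * z.im)]
  have h2 : g 1 0 = 0 := (mul_eq_zero.1 h1).resolve_right hy.ne'
  have h3 : g 1 1 = 0 := by
    rw [h2] at hcon
    nlinarith [sq_nonneg (g 1 1)]
  rw [h2, h3] at h
  simp at h

lemma side_sl_smul (g : SL(2, ℝ)) (v : Vec) (z : ℍ) : side v (g • z) = side (slPull g v) z := by
  have hy := z.im_pos
  have hd := sl_denom_pos g z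
  have h := sl_det g
  rw [side_eq, side_eq, sl_im_smul, sl_re_smul]
  set D := (g 1 0 * z.re + g 1 1) ^ 2 + (g 1 0 * z.im) ^ 2 with hD
  set N := g 0 0 * g 1 0 * (z.re ^ 2 + z.im ^ 2) +
      (g 0 0 * g 1 1 + g 0 1 * g 1 0) * z.re + g 0 1 * g 1 1 with hN
  have key : N ^ 2 + z.im ^ 2 = D * ((g 0 0 * z.re + g 0 1) ^ 2 + (g 0 0 * z.im) ^ 2) := by
    have : N ^ 2 + (g 0 0 * g 1 1 - g 0 1 * g 1 0) ^ 2 * z.im ^ 2 =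
        D * ((g 0 0 * z.re + g 0 1) ^ 2 + (g 0 0 * z.im) ^ 2) := by rw [hN, hD]; ring
    rwa [h, one_pow, one_mul] at this
  have e1 : (N / D) ^ 2 + (z.im / D) ^ 2 =
      ((g 0 0 * z.re + g 0 1) ^ 2 + (g 0 0 * z.im) ^ 2) / D := by
    rw [div_pow, div_pow, ← add_div, key]; field_simp
  rw [e1]
  simp only [slPull]
  field_simp
  rw [hD, hN]
  ring

/-- Every point on a geodesic can be moved to `I`, and the geodesic to the imaginary axis, by an
orientation preserving isometry. -/
lemma exists_sl_position {v : Vec} (hv : bil v v = 1) {x : ℍ} (hx : side v x = 0) :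
    ∃ g : SL(2, ℝ), g • x = UpperHalfPlane.I ∧ ∀ z, side v z = (g • z).re / (g • z).im := by
  set h := x.toSL2R
  have hI : h • UpperHalfPlane.I = x := x.toSL2R_smul_I
  set w := slPull h v with hw
  have hw1 : bil w w = 1 := by rw [hw, bil_slPull, hv]
  have hw0 : side w UpperHalfPlane.I = 0 := by rw [hw, ← side_sl_smul, hI, hx]
  have hw2 : w.2.2 = w.2.1 := by
    rw [side_eq] at hw0
    simp at hw0
    linarith
  have hw3 : (-w.1) ^ 2 + (-w.2.1) ^ 2 = 1 := by
    simp only [bil, hw2] at hw1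
    linarith
  obtain ⟨θ, hc, hs⟩ := cosSin_of_sq_add_sq hw3
  let k : SL(2, ℝ) := ⟨!![Real.cos (θ / 2), Real.sin (θ / 2); -Real.sin (θ / 2), Real.cos (θ / 2)],
    by rw [Matrix.det_fin_two_of]; linarith [Real.sin_sq_add_cos_sq (θ / 2)]⟩
  have k00 : k 0 0 = Real.cos (θ / 2) := rfl
  have k01 : k 0 1 = Real.sin (θ / 2) := rfl
  have k10 : k 1 0 = -Real.sin (θ / 2) := rfl
  have k11 : k 1 1 = Real.cos (θ / 2) := rfl
  have hsc := Real.sin_sq_add_cos_sq (θ / 2)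
  have hcos : Real.cos θ = Real.cos (θ / 2) ^ 2 - Real.sin (θ / 2) ^ 2 := by
    rw [← Real.cos_two_mul', mul_div_cancel₀ _ two_ne_zero]
  have hsin : Real.sin θ = 2 * Real.sin (θ / 2) * Real.cos (θ / 2) := by
    rw [← Real.sin_two_mul, mul_div_cancel₀ _ two_ne_zero]
  have hpull : slPull k (-1, 0, 0) = w := by
    refine Prod.ext ?_ (Prod.ext ?_ ?_) <;> simp only [slPull, k00, k01, k10, k11]
    · linarith
    · linarith
    · linarith
  have hkI : k • UpperHalfPlane.I = UpperHalfPlane.I := by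
    refine UpperHalfPlane.ext (Complex.ext ?_ ?_)
    · rw [UpperHalfPlane.coe_re, sl_re_smul, k00, k01, k10, k11]
      simp; ring
    · rw [UpperHalfPlane.coe_im, sl_im_smul, k10, k11]
      simp [add_comm (Real.cos _ ^ 2)]
  have hside : ∀ z : ℍ, side (-1, 0, 0) z = z.re / z.im := by
    intro z; rw [side_eq]; have := z.im_pos; field_simp; simp
  refine ⟨k * h⁻¹, ?_, fun z => ?_⟩
  · rw [mul_smul, ← hI, inv_smul_smul, hkI]
  · rw [← hside, mul_smul, side_sl_smul, hpull, hw, ← side_sl_smul, smul_inv_smul]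

/-- A reflection is an orientation reversing Möbius transformation. -/
lemma exists_gl_reflect (v : {v : Vec // bil v v = 1}) :
    ∃ G : GL (Fin 2) ℝ, G.det.val = -1 ∧ ∀ z, reflect v z = G • z := by
  obtain ⟨⟨p, q, r⟩, hv⟩ := v
  have hdet : p * p + q * r = 1 := by simp only [bil] at hv; linarith
  have hd : (!![p, q; r, -p] : Matrix (Fin 2) (Fin 2) ℝ).det = -1 := by
    rw [Matrix.det_fin_two_of]; linarith
  refine ⟨.mkOfDetNeZero !![p, q; r, -p] (by rw [hd]; norm_num), hd, fun z => ?_⟩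
  set G : GL (Fin 2) ℝ := .mkOfDetNeZero !![p, q; r, -p] (by rw [hd]; norm_num) with hG
  have hy := z.im_pos
  have hGdet : G.det.val = -1 := hd
  have hpos := vecReflect_toVec_pos hv z
  have hr : (vecReflect (p, q, r) (toVec z)).2.2 =
      ((r * z.re - p) ^ 2 + (r * z.im) ^ 2) / z.im := by
    simp only [vecReflect, bil, toVec, Prod.snd_sub, Prod.smul_snd, smul_eq_mul]
    field_simp
    linear_combination -hdet
  have hD : 0 < (r * z.re - p) ^ 2 + (r * z.im) ^ 2 := by
    rw [hr] at hpos
    exact (div_pos_iff_of_pos_right hy).1 hpos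
  have hden : UpperHalfPlane.denom G z = r * z - p := by
    simp [UpperHalfPlane.denom, hG, Matrix.GeneralLinearGroup.mkOfDetNeZero, sub_eq_add_neg]
  have hnum : UpperHalfPlane.num G z = p * z + q := by
    simp [UpperHalfPlane.num, hG, Matrix.GeneralLinearGroup.mkOfDetNeZero]
  refine UpperHalfPlane.ext (Complex.ext ?_ ?_)
  · rw [UpperHalfPlane.coe_re, UpperHalfPlane.coe_re, UpperHalfPlane.re_smul, hnum, hden,
      Complex.div_re]
    have : (reflect ⟨(p, q, r), hv⟩ z).re =
      (vecReflect (p, q, r) (toVec z)).1 / (vecReflect (p, q, r) (toVec z)).2.2 := rfl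
    rw [this, hr]
    simp [Complex.normSq_apply, vecReflect, bil, toVec]
    have hD' : (r * z.re - p) * (r * z.re - p) + r * z.im * (r * z.im) ≠ 0 := by
      have := hD.ne'; intro h; apply this; rw [← h]; ring
    have hD2 := hD.ne'
    rw [← add_div, div_eq_div_iff (by positivity) hD']
    field_simp
    linear_combination (-z.re * ((r * z.re - p) ^ 2 + (r * z.im) ^ 2)) * hdet
  · rw [UpperHalfPlane.coe_im, UpperHalfPlane.coe_im, UpperHalfPlane.im_smul_eq_div_normSq, hGdet,
      hden]
    have : (reflect ⟨(p, q, r), hv⟩ z).im = 1 / (vecReflect (p, q, r) (toVec z)).2.2 := rfl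
    rw [this, hr]
    simp [Complex.normSq_apply]
    congr 1; ring

lemma exists_gl_smul {a : ℝ} [Fact (1 < a)] (g : HexGroup a) :
    ∃ G : GL (Fin 2) ℝ, G.det.val = ((sgn a g : ℤ) : ℝ) ∧ ∀ z : ℍ, g • z = G • z := by
  induction g using (hexSystem a).simple_induction_left with
  | one => exact ⟨1, by simp, fun z => by simp⟩
  | mul_simple_left w i ih =>
    obtain ⟨G, h1, h2⟩ := ih
    obtain ⟨R, h3, h4⟩ := exists_gl_reflect (wallUnit a i)
    refine ⟨R * G, ?_, fun z => ?_⟩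
    · change (R * G).det.val = ((sgn a (gen a i * w) : ℤ) : ℝ)
      rw [map_mul, map_mul, sgn_gen, Units.val_mul, h1, h3]
      simp
    · change (gen a i * w) • z = _
      rw [mul_smul, mul_smul, gen_smul, h4, h2]

/-- The elements of the reflection group with trivial sign are orientation preserving. -/
lemma exists_sl_smul {a : ℝ} [Fact (1 < a)] {g : HexGroup a} (hg : sgn a g = 1) :
    ∃ G : SL(2, ℝ), ∀ z : ℍ, g • z = G • z := by
  obtain ⟨G, h1, h2⟩ := exists_gl_smul g
  rw [hg] at h1
  let S : SL(2, ℝ) := ⟨G.val, by simpa using h1⟩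
  refine ⟨S, fun z => ?_⟩
  have hS : (S : GL (Fin 2) ℝ) = G := by ext; rfl
  rw [h2, ← hS]
  rfl

/-! ### Interior points and boundary points -/

/-- The point reflection of `u` in `c`. -/
lemma exists_antipode (c u : ℍ) :
    ∃ u' : ℍ, dist c u' = dist c u ∧ dist u u' = dist c u + dist c u := by
  set C := Real.cosh (dist c u) with hC
  have hCb : bil (toVec c) (toVec u) = -C := by rw [hC, cosh_dist_eq]; ring
  set V : Vec := (2 * C) • toVec c - toVec u with hV
  have hVV : bil V V = -1 := by
    simp only [hV, bil_sub_left, bil_sub_right, bil_smul_left, bil_smul_right, bil_toVec_self,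
      bil_comm (toVec u) (toVec c), hCb]
    ring
  have hVr : 0 < V.2.2 := by
    have hyc := c.im_pos
    have hyu := u.im_pos
    have e : V.2.2 = ((c.re - u.re) ^ 2 + u.im ^ 2) / (c.im ^ 2 * u.im) := by
      have h1 : C = -bil (toVec c) (toVec u) := by rw [hCb]; ring
      simp only [hV, h1, bil, toVec, Prod.snd_sub, Prod.smul_snd, smul_eq_mul]
      field_simp
      ring
    rw [e]; positivity
  refine ⟨ofVec V hVr, ?_, ?_⟩
  · refine dist_eq_of_bil dist_nonneg ?_
    rw [toVec_ofVec hVr hVV, hV, bil_sub_right, bil_smul_right, bil_toVec_self, hCb, ← hC]; ring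
  · refine dist_eq_of_bil (add_nonneg dist_nonneg dist_nonneg) ?_
    rw [toVec_ofVec hVr hVV, hV, bil_sub_right, bil_smul_right, bil_toVec_self,
      bil_comm (toVec u), hCb, ← two_mul, Real.cosh_two_mul, ← hC]
    have := Real.cosh_sq (dist c u)
    rw [← hC] at this
    linarith

lemma side_re (z : ℍ) : side (-1, 0, 0) z = z.re / z.im := by
  rw [side_eq]; have := z.im_pos; field_simp; simp

/-- A point cannot be an interior point in one chart and a boundary point in another: small geodesic
segments that end at an interior point can be extended to segments with this point as midpoint. -/
lemma chart_re_eq_zero {X : Type*} [MetricSpace X] {U U' : Set X} {φ φ' : X → ℍ}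
    (h : IsChart U φ) (h' : IsChart U' φ') {x : X} (hx : x ∈ U) (hx' : x ∈ U')
    (h0 : (φ' x).re = 0) : (φ x).re = 0 := by
  obtain ⟨hU, hd, V, hV, himg⟩ := h
  obtain ⟨hU', hd', V', hV', himg'⟩ := h'
  have hxV : φ x ∈ V ∩ halfPlane := himg ▸ mem_image_of_mem φ hx
  have hxV' : φ' x ∈ V' ∩ halfPlane := himg' ▸ mem_image_of_mem φ' hx'
  by_contra hne
  have hpos : 0 < (φ x).re := lt_of_le_of_ne hxV.2 (Ne.symm hne)
  obtain ⟨r₁, hr₁, hb₁⟩ := Metric.isOpen_iff.1 (hU.inter hU') x ⟨hx, hx'⟩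
  obtain ⟨r₂, hr₂, hb₂⟩ := Metric.isOpen_iff.1
    (hV.inter (isOpen_lt continuous_const UpperHalfPlane.continuous_re)) (φ x) ⟨hxV.1, hpos⟩
  obtain ⟨r₃, hr₃, hb₃⟩ := Metric.isOpen_iff.1 hV' (φ' x) hxV'.1
  set r := min r₁ (min r₂ r₃) with hr
  have hr0 : 0 < r := lt_min hr₁ (lt_min hr₂ hr₃)
  obtain ⟨w, hw0, hwr⟩ : ∃ w : ℍ, 0 < w.re ∧ dist (φ' x) w < r := by
    have hc : Continuous fun t : ℝ =>
        (UpperHalfPlane.mk ⟨(φ' x).re + t, (φ' x).im⟩ (φ' x).im_pos) := by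
      rw [UpperHalfPlane.isEmbedding_coe.continuous_iff]
      change Continuous fun t : ℝ => (⟨(φ' x).re + t, (φ' x).im⟩ : ℂ)
      have : (fun t : ℝ => (⟨(φ' x).re + t, (φ' x).im⟩ : ℂ)) =
          fun t : ℝ => (φ' x : ℂ) + (t : ℂ) := by
        ext t; apply Complex.ext <;> simp
      rw [this]
      fun_prop
    have h1 : Metric.ball (φ' x) r ∈
        𝓝 ((UpperHalfPlane.mk ⟨(φ' x).re + 0, (φ' x).im⟩ (φ' x).im_pos)) := by
      have : (UpperHalfPlane.mk ⟨(φ' x).re + 0, (φ' x).im⟩ (φ' x).im_pos) = φ' x :=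
        UpperHalfPlane.ext (Complex.ext (by simp) (by simp))
      rw [this]; exact Metric.ball_mem_nhds _ hr0
    obtain ⟨δ, hδ, hb⟩ := Metric.mem_nhds_iff.1 (hc.continuousAt (x := 0) h1)
    refine ⟨UpperHalfPlane.mk ⟨(φ' x).re + δ / 2, (φ' x).im⟩ (φ' x).im_pos, ?_, ?_⟩
    · change 0 < (φ' x).re + δ / 2
      linarith
    · rw [dist_comm]
      exact hb (by rw [Metric.mem_ball, Real.dist_eq, sub_zero, abs_of_pos] <;> linarith)
  have hwV : w ∈ V' ∩ halfPlane := by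
    refine ⟨hb₃ ?_, hw0.le⟩
    rw [Metric.mem_ball, dist_comm]
    exact hwr.trans_le ((min_le_right _ _).trans (min_le_right _ _))
  obtain ⟨y, hy, rfl⟩ : w ∈ φ' '' U' := himg' ▸ hwV
  have hxy : dist x y = dist (φ' x) (φ' y) := (hd' x hx' y hy).symm
  have hyU : y ∈ U := by
    refine (hb₁ ?_).1
    rw [Metric.mem_ball, dist_comm, hxy]
    exact hwr.trans_le (min_le_left _ _)
  obtain ⟨u, hu1, hu2⟩ := exists_antipode (φ x) (φ y)
  rw [hd x hx y hyU, hxy] at hu1 hu2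
  have huV : u ∈ V ∩ halfPlane := by
    have : u ∈ Metric.ball (φ x) r₂ := by
      rw [Metric.mem_ball, dist_comm, hu1]
      exact hwr.trans_le ((min_le_right _ _).trans (min_le_left _ _))
    exact ⟨(hb₂ this).1, show 0 ≤ u.re from le_of_lt (hb₂ this).2⟩
  obtain ⟨y', hy', rfl⟩ : u ∈ φ '' U := himg ▸ huV
  rw [hd x hx y' hy'] at hu1
  rw [hd y hyU y' hy'] at hu2
  have hyU' : y' ∈ U' := by
    refine (hb₁ ?_).2
    rw [Metric.mem_ball, dist_comm, hu1]
    exact hwr.trans_le (min_le_left _ _)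
  rw [← hd' x hx' y' hyU'] at hu1
  rw [← hd' y hy y' hyU'] at hu2
  have key := toVec_of_between (dist_comm (φ' y) (φ' x)) hu1 hu2
  have key2 := congrArg (bil (-1, 0, 0)) key
  rw [bil_smul_right, bil_add_right, bil_smul_right, bil_smul_right] at key2
  have e : ∀ z, bil (-1, 0, 0) (toVec z) = -(z.re / z.im) := fun z => by
    rw [← side_re, side, neg_neg]
  rw [e, e, e, h0, zero_div] at key2
  have hs : 0 < Real.sinh (dist (φ' x) (φ' y)) := by
    refine Real.sinh_pos_iff.2 (dist_pos.2 fun hcon => ?_)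
    rw [← hcon, h0] at hw0
    exact lt_irrefl _ hw0
  have h5 : 0 ≤ (φ' y').re := by
    have : φ' y' ∈ V' ∩ halfPlane := himg' ▸ mem_image_of_mem φ' hyU'
    exact this.2
  have h6 : 0 < (φ' y).re / (φ' y).im := div_pos hw0 (φ' y).im_pos
  have h7 : 0 ≤ (φ' y').re / (φ' y').im := div_nonneg h5 (φ' y').im_pos.le
  nlinarith

lemma chart_re_eq_zero_of_mem_boundary {X : Type*} [MetricSpace X] {U : Set X} {φ : X → ℍ}
    (h : IsChart U φ) {x : X} (hx : x ∈ U) (hb : x ∈ boundary X) : (φ x).re = 0 := by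
  obtain ⟨U', φ', h', hx', h0⟩ := hb
  exact chart_re_eq_zero h h' hx hx' h0

/-- A geodesic segment meets every geodesic that separates its endpoints. -/
lemma exists_side_eq_zero {v : Vec} {x y : ℍ} (h : side v x * side v y ≤ 0) :
    ∃ w, side v w = 0 ∧ dist x w + dist w y = dist x y := by
  obtain ⟨γ, h0, h1, hγ, -⟩ := exists_geodesic x y
  set d := dist x y
  have hd0 : 0 ≤ d := dist_nonneg
  have hcont : ContinuousOn γ (Icc 0 d) := by
    refine LipschitzOnWith.continuousOn (K := 1)
      (LipschitzOnWith.of_dist_le_mul fun s hs t ht => ?_)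
    rw [hγ s hs t ht, NNReal.coe_one, one_mul, Real.dist_eq]
  have hc2 : ContinuousOn (fun t => side v (γ t)) (Icc 0 d) :=
    (continuous_side v).comp_continuousOn hcont
  have m0 : (0 : ℝ) ∈ Icc 0 d := ⟨le_rfl, hd0⟩
  have m1 : d ∈ Icc 0 d := ⟨hd0, le_rfl⟩
  have h0mem : (0 : ℝ) ∈ (fun t => side v (γ t)) '' Icc 0 d := by
    rcases mul_nonpos_iff.1 h with ⟨ha, hb⟩ | ⟨ha, hb⟩
    · exact intermediate_value_Icc' hd0 hc2 ⟨by simpa [h1] using hb, by simpa [h0] using ha⟩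
    · exact intermediate_value_Icc hd0 hc2 ⟨by simpa [h0] using ha, by simpa [h1] using hb⟩
  obtain ⟨t, ht, hw⟩ := h0mem
  refine ⟨γ t, hw, ?_⟩
  have e1 := hγ 0 m0 t ht
  have e2 := hγ t ht d m1
  rw [h0, zero_sub, abs_neg, abs_of_nonneg ht.1] at e1
  rw [h1, abs_sub_comm, abs_of_nonneg (by linarith [ht.2])] at e2
  rw [e1, e2]; ring

/-! ### The local structure of the regions -/

section Local

variable {a : ℝ} [ha : Fact (1 < a)] {n : ℕ}

/-- The elements of the reflection group act linearly on Lorentz space. They preserve every set of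
vectors that the reflections in the walls preserve. -/
lemma exists_linear (g : HexGroup a) : ∃ L : Vec → Vec, (∀ v w, bil (L v) (L w) = bil v w) ∧
    (∀ z : ℍ, toVec (g • z) = L (toVec z)) ∧
    ∀ S : Set Vec, (∀ i, ∀ v ∈ S, vecReflect (wallVec a i) v ∈ S) → ∀ v ∈ S, L v ∈ S := by
  induction g using (hexSystem a).simple_induction_left with
  | one => exact ⟨id, fun _ _ => rfl, fun z => by rw [one_smul]; rfl, fun _ _ _ h => h⟩
  | mul_simple_left w i ih =>
    obtain ⟨L, h1, h2, h3⟩ := ih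
    refine ⟨fun v => vecReflect (wallVec a i) (L v), fun v w => ?_, fun z => ?_,
      fun S hS v hv => hS i _ (h3 S hS v hv)⟩
    · rw [bil_vecReflect (bil_wallVec_self ha.out i), h1]
    · change toVec ((gen a i * w) • z) = _
      rw [mul_smul, gen_smul, toVec_reflect, h2]
      rfl

/-- The unit normal of a mirror. -/
lemma exists_mirror_vec (m : HexGroup a × Wall) :
    ∃ v, bil v v = 1 ∧ ∀ x, mirrorSide m x = side v x := by
  obtain ⟨L, h1, h2, -⟩ := exists_linear m.1
  refine ⟨L (wallVec a m.2), by rw [h1, bil_wallVec_self ha.out], fun x => ?_⟩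
  rw [mirrorSide, wallSide, side, side, ← h1, ← h2, smul_inv_smul]

lemma exists_mirrorSide_eq_zero {m : HexGroup a × Wall} {x y : ℍ}
    (h : mirrorSide m x * mirrorSide m y ≤ 0) :
    ∃ w, mirrorSide m w = 0 ∧ dist x w + dist w y = dist x y := by
  obtain ⟨v, -, hv⟩ := exists_mirror_vec m
  simp only [hv] at h ⊢
  exact exists_side_eq_zero h

lemma mul_nonpos_of_mul {c x y : ℝ} (hc : c ≠ 0) (hx : 0 ≤ c * x) (hy : c * y ≤ 0) :
    x * y ≤ 0 := by
  have := mul_nonneg_of_mul_nonneg hc hx (y := -y) (by linarith)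
  linarith

/-- A boundary mirror that separates a point near `x` from the region passes near `x`. -/
lemma exists_mirror_of_notMem {σ : Copy n} {x y : ℍ} {r : ℝ} (hx : x ∈ region a σ)
    (hy : y ∈ Metric.ball x r) (h : y ∉ region a σ) :
    ∃ m ∈ boundaryMirrors a σ, mirrorSide m (center a) * mirrorSide m y < 0 ∧
      ∃ w ∈ Metric.ball x r, mirrorSide m w = 0 := by
  simp only [region, chamber, mem_ofPred_eq, not_forall, not_le] at h
  obtain ⟨m, hm, hlt⟩ := h
  obtain ⟨w, hw, hd⟩ := exists_mirrorSide_eq_zero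
    (mul_nonpos_of_mul (mirrorSide_center_ne_zero m) (hx m hm) hlt.le)
  refine ⟨m, hm, hlt, w, ?_, hw⟩
  rw [Metric.mem_ball, dist_comm] at hy ⊢
  linarith [dist_nonneg (x := w) (y := y)]

/-- Near a boundary mirror, all other boundary mirrors define the same reflection. -/
lemma mirrorRefl_eq_of_near {σ : Copy n} {x w w' : ℍ} {m m' : HexGroup a × Wall}
    (hm : m ∈ boundaryMirrors a σ) (hm' : m' ∈ boundaryMirrors a σ)
    (hw : w ∈ Metric.ball x (3 * rad a)) (hw' : w' ∈ Metric.ball x (3 * rad a))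
    (h : mirrorSide m w = 0) (h' : mirrorSide m' w' = 0) : mirrorRefl m = mirrorRefl m' := by
  obtain ⟨z, hz⟩ := exists_common_fixed_point (a := a) x
  rw [← mirrorRefl_smul_eq_self_iff] at h h'
  exact mirrorRefl_eq_of_fixes hm hm' (hz _ w hw (by rwa [h])) (hz _ w' hw' (by rwa [h']))

lemma ball_rad_subset (x : ℍ) : Metric.ball x (rad a) ⊆ Metric.ball x (3 * rad a) :=
  Metric.ball_subset_ball (by linarith [rad_pos (a := a)])

lemma mirrorSide_center_mul_nonneg_congr {m m' : HexGroup a × Wall}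
    (h : mirrorRefl m = mirrorRefl m') (y : ℍ) :
    0 ≤ mirrorSide m (center a) * mirrorSide m y ↔
      0 ≤ mirrorSide m' (center a) * mirrorSide m' y := by
  rw [mirrorSide_mul_nonneg_iff, mirrorSide_mul_nonneg_iff, h]

/-- Near a point on a boundary mirror, the region is a half-plane. -/
lemma mem_region_iff_of_mirror {σ : Copy n} {x : ℍ} (hx : x ∈ region a σ)
    {m : HexGroup a × Wall} (hm : m ∈ boundaryMirrors a σ) (h : mirrorSide m x = 0) {y : ℍ}
    (hy : y ∈ Metric.ball x (rad a)) :
    y ∈ region a σ ↔ 0 ≤ mirrorSide m (center a) * mirrorSide m y := by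
  refine ⟨fun hyr => hyr m hm, fun h0 => ?_⟩
  by_contra hcon
  obtain ⟨m', hm', hlt, w, hw, hw0⟩ := exists_mirror_of_notMem hx hy hcon
  have := mirrorRefl_eq_of_near (x := x) hm hm'
    (Metric.mem_ball_self (by linarith [rad_pos (a := a)])) (ball_rad_subset x hw) h hw0
  exact absurd ((mirrorSide_center_mul_nonneg_congr this y).1 h0) (not_le.2 hlt)

/-- Points on no boundary mirror are interior points of the region. -/
lemma exists_ball_subset_region {σ : Copy n} {x : ℍ} (hx : x ∈ region a σ)
    (h : ∀ m ∈ boundaryMirrors a σ, mirrorSide m x ≠ 0) :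
    ∃ r > 0, r ≤ rad a ∧ Metric.ball x r ⊆ region a σ := by
  by_cases hsub : Metric.ball x (rad a) ⊆ region a σ
  · exact ⟨rad a, rad_pos, le_rfl, hsub⟩
  obtain ⟨y₀, hy₀, hn⟩ := not_subset.1 hsub
  obtain ⟨m, hm, -, w, hw, hw0⟩ := exists_mirror_of_notMem hx hy₀ hn
  have hpos : 0 < mirrorSide m (center a) * mirrorSide m x :=
    lt_of_le_of_ne (hx m hm) (mul_ne_zero (mirrorSide_center_ne_zero m) (h m hm)).symm
  have hev : ∀ᶠ y in 𝓝 x, 0 < mirrorSide m (center a) * mirrorSide m y :=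
    (continuous_const.mul (continuous_mirrorSide m)).continuousAt.eventually (lt_mem_nhds hpos)
  obtain ⟨r, hr, hb⟩ := Metric.eventually_nhds_iff_ball.1 hev
  refine ⟨min r (rad a), lt_min hr rad_pos, min_le_right _ _, fun y hy => ?_⟩
  by_contra hcon
  have hy' : y ∈ Metric.ball x (rad a) := Metric.ball_subset_ball (min_le_right _ _) hy
  obtain ⟨m', hm', hlt, w', hw', hw0'⟩ := exists_mirror_of_notMem hx hy' hcon
  have := mirrorRefl_eq_of_near hm hm' (ball_rad_subset x hw) (ball_rad_subset x hw') hw0 hw0'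
  have h0 := hb y (Metric.ball_subset_ball (min_le_left _ _) hy)
  exact absurd ((mirrorSide_center_mul_nonneg_congr this y).1 h0.le) (not_le.2 hlt)

end Local

/-! ### Charts -/

section Charts

variable {a : ℝ} [ha : Fact (1 < a)] {n : ℕ}

/-- The point of the region over `q` that is as close to `x` as `q` is to the image of `x`. -/
noncomputable def liftAt {σ : Copy n} {x : ℍ} (hx : x ∈ region a σ) (q : TreeSpace a n) : ℍ :=
  (exists_lift hx q).choose

lemma liftAt_mem {σ : Copy n} {x : ℍ} (hx : x ∈ region a σ) (q : TreeSpace a n) :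
    liftAt hx q ∈ region a σ := (exists_lift hx q).choose_spec.1

lemma proj_liftAt {σ : Copy n} {x : ℍ} (hx : x ∈ region a σ) (q : TreeSpace a n) :
    proj a σ (liftAt hx q) = q := (exists_lift hx q).choose_spec.2.1

lemma dist_liftAt {σ : Copy n} {x : ℍ} (hx : x ∈ region a σ) (q : TreeSpace a n) :
    dist x (liftAt hx q) = dist (proj a σ x) q := (exists_lift hx q).choose_spec.2.2

lemma liftAt_mem_ball {σ : Copy n} {x : ℍ} (hx : x ∈ region a σ) {q : TreeSpace a n} {r : ℝ}
    (hq : q ∈ Metric.ball (proj a σ x) r) : liftAt hx q ∈ Metric.ball x r := by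
  rwa [Metric.mem_ball, dist_comm, dist_liftAt, dist_comm]

lemma dist_liftAt_liftAt {σ : Copy n} {x : ℍ} (hx : x ∈ region a σ) {q q' : TreeSpace a n}
    (hq : q ∈ Metric.ball (proj a σ x) (rad a)) (hq' : q' ∈ Metric.ball (proj a σ x) (rad a)) :
    dist (liftAt hx q) (liftAt hx q') = dist q q' := by
  rw [← dist_proj_region_eq (liftAt_mem_ball hx hq) (liftAt_mem_ball hx hq') (liftAt_mem hx q)
    (liftAt_mem hx q'), proj_liftAt, proj_liftAt]

lemma proj_mem_ball {σ : Copy n} {x y : ℍ} {r : ℝ} (hy : y ∈ Metric.ball x r) :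
    proj a σ y ∈ Metric.ball (proj a σ x) r :=
  lt_of_le_of_lt (lipschitz_proj σ y x) hy

lemma liftAt_proj {σ : Copy n} {x y : ℍ} (hx : x ∈ region a σ) (hy : y ∈ region a σ)
    (hb : y ∈ Metric.ball x (rad a)) : liftAt hx (proj a σ y) = y := by
  have h := dist_proj_region_eq (liftAt_mem_ball hx (proj_mem_ball (σ := σ) hb)) hb
    (liftAt_mem hx _) hy
  rw [proj_liftAt, dist_self] at h
  exact dist_eq_zero.1 h.symm

lemma isChart_liftAt {σ : Copy n} {x : ℍ} (hx : x ∈ region a σ) {r : ℝ} (hr : r ≤ rad a)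
    {A : SL(2, ℝ)} (hA : ∀ y ∈ Metric.ball x r, y ∈ region a σ ↔ 0 ≤ (A • y).re) :
    IsChart (Metric.ball (proj a σ x) r) (fun q => A • liftAt hx q) := by
  have hsub := Metric.ball_subset_ball (x := proj a σ x) hr
  refine ⟨Metric.isOpen_ball, fun q hq q' hq' => ?_, Metric.ball (A • x) r, Metric.isOpen_ball, ?_⟩
  · rw [dist_smul, dist_liftAt_liftAt hx (hsub hq) (hsub hq')]
  · ext w
    constructor
    · rintro ⟨q, hq, rfl⟩
      have h1 := liftAt_mem_ball hx hq
      refine ⟨?_, (hA _ h1).1 (liftAt_mem hx q)⟩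
      rwa [Metric.mem_ball, dist_smul]
    · rintro ⟨hw, hw0⟩
      have h1 : A⁻¹ • w ∈ Metric.ball x r := by
        rwa [Metric.mem_ball, ← dist_smul A, smul_inv_smul]
      have h2 : A⁻¹ • w ∈ region a σ := (hA _ h1).2 (by rw [smul_inv_smul]; exact hw0)
      refine ⟨proj a σ (A⁻¹ • w), proj_mem_ball h1, ?_⟩
      change A • liftAt hx _ = w
      rw [liftAt_proj hx h2 (Metric.ball_subset_ball hr h1), smul_inv_smul]

/-- The charts of the surface that come from the region. -/
def regionCharts (a : ℝ) [Fact (1 < a)] {n : ℕ} (σ : Copy n) :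
    Set (Set (TreeSpace a n) × (TreeSpace a n → ℍ)) :=
  {c | ∃ (x : ℍ) (hx : x ∈ region a σ) (r : ℝ) (A : SL(2, ℝ)), r ≤ rad a ∧
    (∀ y ∈ Metric.ball x r, y ∈ region a σ ↔ 0 ≤ (A • y).re) ∧
    c = (Metric.ball (proj a σ x) r, fun q => A • liftAt hx q)}

lemma exists_boundary_chart {σ : Copy n} {x : ℍ} (hx : x ∈ region a σ)
    {m : HexGroup a × Wall} (hm : m ∈ boundaryMirrors a σ) (h : mirrorSide m x = 0) :
    ∃ A : SL(2, ℝ), A • x = UpperHalfPlane.I ∧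
      ∀ y ∈ Metric.ball x (rad a), y ∈ region a σ ↔ 0 ≤ (A • y).re := by
  obtain ⟨v, hv, hmv⟩ := exists_mirror_vec m
  have key : ∀ w : Vec, bil w w = 1 → side w x = 0 →
      (∀ y, 0 ≤ mirrorSide m (center a) * mirrorSide m y ↔ 0 ≤ side w y) →
      ∃ A : SL(2, ℝ), A • x = UpperHalfPlane.I ∧
        ∀ y ∈ Metric.ball x (rad a), y ∈ region a σ ↔ 0 ≤ (A • y).re := by
    intro w hw hwx hwy
    obtain ⟨A, h1, h2⟩ := exists_sl_position hw hwx
    refine ⟨A, h1, fun y hy => ?_⟩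
    rw [mem_region_iff_of_mirror hx hm h hy, hwy, h2]
    exact ⟨fun h => by
      have := mul_nonneg h (A • y).im_pos.le
      rwa [div_mul_cancel₀ _ (A • y).im_pos.ne'] at this, fun h => div_nonneg h (A • y).im_pos.le⟩
  rcases lt_or_gt_of_ne (mirrorSide_center_ne_zero m) with hc | hc
  · refine key (-v) (by rw [bil_neg_left, bil_neg_right, neg_neg, hv])
      (by rw [side_neg, ← hmv, h, neg_zero]) fun y => ?_
    rw [side_neg, ← hmv y, neg_nonneg]
    exact ⟨fun h0 => by by_contra hcon; nlinarith,
      fun h0 => mul_nonneg_of_nonpos_of_nonpos hc.le h0⟩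
  · refine key v hv (by rw [← hmv, h]) fun y => ?_
    rw [mul_nonneg_iff_of_pos_left hc, hmv]

lemma exists_interior_chart {σ : Copy n} {x : ℍ} (hx : x ∈ region a σ)
    (h : ∀ m ∈ boundaryMirrors a σ, mirrorSide m x ≠ 0) :
    ∃ (r : ℝ) (A : SL(2, ℝ)), 0 < r ∧ r ≤ rad a ∧ 0 < (A • x).re ∧
      ∀ y ∈ Metric.ball x r, y ∈ region a σ ↔ 0 ≤ (A • y).re := by
  obtain ⟨r, hr, hr', hb⟩ := exists_ball_subset_region hx h
  set o : ℍ := ⟨⟨1, 1⟩, one_pos⟩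
  set A : SL(2, ℝ) := o.toSL2R * x.toSL2R⁻¹
  have hA : A • x = o := by
    have h1 : x.toSL2R⁻¹ • x = UpperHalfPlane.I := by rw [inv_smul_eq_iff, x.toSL2R_smul_I]
    rw [mul_smul, h1, o.toSL2R_smul_I]
  have ho : 0 < o.re := one_pos
  obtain ⟨s, hs, hs'⟩ := Metric.isOpen_iff.1
    (isOpen_lt continuous_const UpperHalfPlane.continuous_re) o ho
  refine ⟨min r s, A, lt_min hr hs, (min_le_left _ _).trans hr', by rw [hA]; exact ho,
    fun y hy => ⟨fun _ => ?_, fun _ => hb (Metric.ball_subset_ball (min_le_left _ _) hy)⟩⟩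
  have : A • y ∈ Metric.ball o s := by
    rw [Metric.mem_ball, ← hA, dist_smul]
    exact lt_of_lt_of_le hy (min_le_right _ _)
  exact le_of_lt (hs' this)

omit ha in
lemma sgn_mirrorRefl (m : HexGroup a × Wall) : sgn a (mirrorRefl m) = -1 := by
  rw [mirrorRefl, map_mul, map_mul, map_inv, sgn_gen, mul_comm, ← mul_assoc, inv_mul_cancel,
    one_mul]

lemma eq_one_of_near {σ : Copy n} {x y : ℍ} {g : HexGroup a} (hσ : g • σ = σ)
    (hs : sgn a g = 1) (hy : y ∈ Metric.ball x (3 * rad a))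
    (hgy : g • y ∈ Metric.ball x (3 * rad a)) : g = 1 := by
  obtain ⟨z, hz⟩ := exists_common_fixed_point (a := a) x
  rcases eq_mirrorRefl_of_fixes (hz g y hy hgy) hσ with h | ⟨m, -, -, h⟩
  · exact h
  · rw [h, sgn_mirrorRefl] at hs
    exact absurd hs (by decide)

/-- Orientations: the changes of coordinates are restrictions of orientation preserving elements
of the reflection group. -/
lemma exists_transition {σ : Copy n} {x x' : ℍ} (hx : x ∈ region a σ) (hx' : x' ∈ region a σ)
    {q : TreeSpace a n} (hq : q ∈ Metric.ball (proj a σ x) (rad a))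
    (hq' : q ∈ Metric.ball (proj a σ x') (rad a)) :
    ∃ g : HexGroup a, sgn a g = 1 ∧ ∀ᶠ p in 𝓝 q, liftAt hx' p = g • liftAt hx p := by
  obtain ⟨g, hgσ, hg, hgs⟩ := exists_oriented_smul (liftAt_mem hx q) (liftAt_mem hx' q)
    (by rw [proj_liftAt, proj_liftAt])
  refine ⟨g, hgs, ?_⟩
  filter_upwards [Metric.isOpen_ball.mem_nhds hq, Metric.isOpen_ball.mem_nhds hq',
    Metric.ball_mem_nhds q (rad_pos (a := a))] with p hp hp' hpq
  obtain ⟨k, hkσ, hk, hks⟩ := exists_oriented_smul (liftAt_mem hx p) (liftAt_mem hx' p)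
    (by rw [proj_liftAt, proj_liftAt])
  have e1 := dist_liftAt_liftAt hx hp hq
  have e2 := dist_liftAt_liftAt hx' hp' hq'
  rw [Metric.mem_ball] at hpq
  have hr := rad_pos (a := a)
  have h1 : k⁻¹ * g = 1 := by
    refine eq_one_of_near (σ := σ) (x := liftAt hx p) (y := liftAt hx q)
      (by rw [mul_smul, hgσ, inv_smul_eq_iff, hkσ]) (by rw [map_mul, map_inv, hgs, hks]; simp) ?_ ?_
    · rw [Metric.mem_ball, dist_comm, e1]; linarith
    · rw [Metric.mem_ball, mul_smul, hg, ← dist_smul k, smul_inv_smul, hk, dist_comm, e2]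
      linarith
  rw [← hk, inv_mul_eq_one.1 h1]

lemma hasOrientedAtlas : HasOrientedAtlas (TreeSpace a n) := by
  refine ⟨regionCharts a (baseCopy n), ?_, fun q => ?_, ?_⟩
  · rintro _ ⟨x, hx, r, A, hr, hA, rfl⟩
    exact isChart_liftAt hx hr hA
  · obtain ⟨x, hx, rfl, -⟩ := exists_lift (center_mem_chamber (boundaryMirrors a (baseCopy n))) q
    by_cases h : ∃ m ∈ boundaryMirrors a (baseCopy n), mirrorSide m x = 0
    · obtain ⟨m, hm, h0⟩ := h
      obtain ⟨A, -, hA⟩ := exists_boundary_chart hx hm h0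
      exact ⟨_, ⟨x, hx, rad a, A, le_rfl, hA, rfl⟩, Metric.mem_ball_self rad_pos⟩
    · push Not at h
      obtain ⟨r, A, hr, hr', -, hA⟩ := exists_interior_chart hx h
      exact ⟨_, ⟨x, hx, r, A, hr', hA, rfl⟩, Metric.mem_ball_self hr⟩
  · rintro _ ⟨x, hx, r, A, hr, hA, rfl⟩ _ ⟨x', hx', r', A', hr', hA', rfl⟩ q ⟨hq, hq'⟩
    obtain ⟨g, hg, h⟩ := exists_transition hx hx' (Metric.ball_subset_ball hr hq)
      (Metric.ball_subset_ball hr' hq')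
    obtain ⟨G, hG⟩ := exists_sl_smul hg
    refine ⟨A' * G * A⁻¹, h.mono fun p hp => ?_⟩
    change A' • liftAt hx' p = (A' * G * A⁻¹) • A • liftAt hx p
    rw [hp, hG, mul_smul, mul_smul, inv_smul_smul]

/-- The boundary of the surface is the image of the boundary mirrors. -/
lemma proj_mem_boundary_iff {σ : Copy n} {x : ℍ} (hx : x ∈ region a σ) :
    proj a σ x ∈ boundary (TreeSpace a n) ↔ ∃ m ∈ boundaryMirrors a σ, mirrorSide m x = 0 := by
  have hl : liftAt hx (proj a σ x) = x := liftAt_proj hx hx (Metric.mem_ball_self rad_pos)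
  constructor
  · intro hb
    by_contra h
    push Not at h
    obtain ⟨r, A, hr, hr', h0, hA⟩ := exists_interior_chart hx h
    have := chart_re_eq_zero_of_mem_boundary (isChart_liftAt hx hr' hA)
      (Metric.mem_ball_self hr) hb
    rw [hl] at this
    exact h0.ne' this
  · rintro ⟨m, hm, h0⟩
    obtain ⟨A, h1, hA⟩ := exists_boundary_chart hx hm h0
    refine ⟨_, _, isChart_liftAt hx le_rfl hA, Metric.mem_ball_self rad_pos, ?_⟩
    simp only [hl, h1, UpperHalfPlane.I_re]

lemma hexagon_subset_region (σ : Copy n) : hexagon a ⊆ region a σ := fun _ hz m _ =>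
  wallSide_mul_nonneg center_mem_hexagon hz m.1⁻¹ m.2

lemma proj_hexagon_mem_boundary_iff {σ : Copy n} {z : ℍ} (hz : z ∈ hexagon a) :
    proj a σ z ∈ boundary (TreeSpace a n) ↔
      ∃ i, wallSide a (.inl i) z = 0 ∧ gen a (.inl i) • σ = σ := by
  rw [proj_mem_boundary_iff (hexagon_subset_region σ hz)]
  constructor
  · rintro ⟨m, hm, h⟩
    have hm' : mirrorRefl m • σ = σ := hm
    rw [← mirrorRefl_smul_eq_self_iff] at h
    rcases mem_wallGroup_cases (smul_eq_self_of_mem_hexagon hz (w := mirrorRefl m)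
      (by rwa [h])).2 with h1 | ⟨i, hi, h1⟩ | ⟨j, -, h1⟩ | ⟨i, j, -, -, h1⟩
    · exact absurd h1 (mirrorRefl_ne_one m)
    · exact ⟨i, hi, h1 ▸ hm'⟩
    · exact absurd (h1 ▸ hm') (seam_smul_copy_ne j σ)
    · exact absurd (h1 ▸ hm') (not_fixes_of_seam i j σ)
  · rintro ⟨i, hi, h⟩
    refine ⟨(1, .inl i), ?_, ?_⟩
    · rw [mem_boundaryMirrors_iff]; simpa using h
    · simpa [mirrorSide] using hi

end Charts

/-! ### The surfaces `X_n` -/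

section Surface

variable {a : ℝ} [ha : Fact (1 < a)] {n : ℕ}

/-- A curve that is `1`-Lipschitz and whose endpoints have maximal distance is a geodesic. -/
lemma dist_eq_of_lipschitz {X : Type*} [PseudoMetricSpace X] {γ : ℝ → X} {d : ℝ}
    (h : ∀ s ∈ Icc 0 d, ∀ t ∈ Icc 0 d, dist (γ s) (γ t) ≤ |s - t|) (hd : dist (γ 0) (γ d) = d) :
    ∀ s ∈ Icc 0 d, ∀ t ∈ Icc 0 d, dist (γ s) (γ t) = |s - t| := by
  have key : ∀ s ∈ Icc 0 d, ∀ t ∈ Icc 0 d, s ≤ t → dist (γ s) (γ t) = |s - t| := by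
    intro s hs t ht hst
    refine le_antisymm (h s hs t ht) ?_
    have h1 := h 0 ⟨le_rfl, hs.1.trans hs.2⟩ s hs
    have h2 := h t ht d ⟨hs.1.trans hs.2, le_rfl⟩
    rw [abs_of_nonpos (by linarith [hs.1])] at h1
    rw [abs_of_nonpos (by linarith [ht.2])] at h2
    rw [abs_of_nonpos (by linarith)]
    linarith [dist_triangle4 (γ 0) (γ s) (γ t) (γ d)]
  intro s hs t ht
  rcases le_total s t with hst | hst
  · exact key s hs t ht hst
  · rw [dist_comm, abs_sub_comm]; exact key t ht s hs hst

lemma isGeodesicSpace : IsGeodesicSpace (TreeSpace a n) := by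
  intro p q
  obtain ⟨x, rfl⟩ := exists_proj_eq p (baseCopy n)
  obtain ⟨y, rfl⟩ := exists_proj_eq q (baseCopy n)
  obtain ⟨g, hg, h⟩ := exists_dist_proj_eq (a := a) (baseCopy n) (baseCopy n) x y
  obtain ⟨γ, h0, h1, h2, -⟩ := exists_geodesic x (g • y)
  have e : proj a (baseCopy n) (g • y) = proj a (baseCopy n) y := by
    conv_lhs => rw [← hg]
    rw [proj_smul]
  refine ⟨fun t => proj a (baseCopy n) (γ t), by simp only [h0], by simp only [h, h1, e], ?_⟩
  rw [h]
  refine dist_eq_of_lipschitz (fun s hs t ht => ?_) (by simp only [h0, h1, e, h])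
  rw [← h2 s hs t ht]
  exact lipschitz_proj _ _ _

instance : CompactSpace (TreeSpace a n) := by
  have : (univ : Set (TreeSpace a n)) = ⋃ σ : Copy n, proj a σ '' hexagon a := by
    ext q
    obtain ⟨σ, z, hz, h⟩ := exists_proj_hexagon_eq q
    simp only [mem_univ, mem_iUnion, true_iff]
    exact ⟨σ, z, hz, h⟩
  refine ⟨this ▸ isCompact_iUnion fun σ => ?_⟩
  exact (isCompact_hexagon ha.out).image (continuous_proj σ)

instance : ConnectedSpace (TreeSpace a n) :=
  Function.Surjective.connectedSpace (fun q => exists_proj_eq q (baseCopy n))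
    (continuous_proj (a := a) (baseCopy n))

lemma exists_reduced_cons (n : ℕ) :
    ∃ (i : Fin 3) (w : List (Fin 3)), w.length = n ∧ (i :: w).IsChain (· ≠ ·) := by
  induction n with
  | zero => exact ⟨0, [], rfl, List.isChain_singleton _⟩
  | succ n ih =>
    obtain ⟨i, w, h1, h2⟩ := ih
    refine ⟨i + 1, i :: w, by rw [List.length_cons, h1], List.isChain_cons_cons.2 ⟨?_, h2⟩⟩
    fin_cases i <;> decide

lemma boundary_nonempty : (boundary (TreeSpace a n)).Nonempty := by
  obtain ⟨i, w, h1, h2⟩ := exists_reduced_cons n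
  obtain ⟨e, he, he'⟩ := exists_edge_point (a := a) (.inl i)
  have heH : e ∈ hexagon a := mem_hexagon.2 fun l => by
    rcases eq_or_ne l (.inl i) with rfl | hl
    · exact he.ge
    · exact (he' l hl).le
  exact ⟨proj a ⟨⟨w, h1.le, h2.tail⟩, false⟩ e, (proj_hexagon_mem_boundary_iff heH).2
    ⟨i, he, cuff_smul_copy_eq_self_iff.2 ⟨h1, h2⟩⟩⟩

/-- The surface `X_n` as a hyperbolic surface. -/
noncomputable def treeSurface (a : ℝ) [Fact (1 < a)] (n : ℕ) : HyperbolicSurface where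
  carrier := TreeSpace a n
  geodesic := isGeodesicSpace
  atlas := hasOrientedAtlas
  boundary_nonempty := boundary_nonempty

end Surface

/-! ### The gluing patterns -/

section Gluing

variable {a : ℝ} [ha : Fact (1 < a)] {n : ℕ}

/-- The copies of the hexagon that form the initial pair of pants. -/
def homeCopy (n : ℕ) (s : Bool) : Copy n := ⟨⟨[], by simp, List.isChain_nil⟩, s⟩

lemma copy_zero_eq (σ : Copy 0) : σ = homeCopy 0 σ.flag := by
  refine Copy.ext (Subtype.ext ?_) rfl
  have := σ.word.2.1
  rwa [Nat.le_zero, List.length_eq_zero_iff] at this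

omit ha in
lemma cuff_smul_copy_zero (i : Fin 3) (σ : Copy 0) : gen a (.inl i) • σ = σ := by
  rw [copy_zero_eq σ]
  exact cuff_smul_copy_eq_self_iff.2 ⟨rfl, List.isChain_singleton _⟩

/-- The two hexagons in the pair of pants. -/
noncomputable def pantsMap (a : ℝ) [Fact (1 < a)] (s : Bool) (z : hexagon a) : treeSurface a 0 :=
  proj a (homeCopy 0 s) z

lemma proj_seam {σ : Copy n} {z : ℍ} {j : Fin 3} (h : wallSide a (.inr j) z = 0) :
    proj a ⟨σ.word, !σ.flag⟩ z = proj a σ z := by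
  rw [← seam_smul_copy (a := a) j σ]
  conv_lhs => rw [← (gen_smul_eq_self_iff _ z).2 h]
  exact proj_smul _ _ _

lemma proj_cuff {σ : Copy n} {z : ℍ} {i : Fin 3} (h : wallSide a (.inl i) z = 0) :
    proj a ⟨cross n i σ.word, σ.flag⟩ z = proj a σ z := by
  rw [← cuff_smul_copy (a := a) i σ]
  conv_lhs => rw [← (gen_smul_eq_self_iff _ z).2 h]
  exact proj_smul _ _ _

theorem isPants : IsPants a (treeSurface a 0) (pantsMap a) := by
  refine ⟨fun s => Isometry.of_dist_eq fun z z' => ?_, fun p => ?_, fun s z s' z' => ?_⟩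
  · refine le_antisymm (lipschitz_proj _ _ _) ?_
    obtain ⟨g, -, h⟩ := exists_dist_proj_eq (a := a) (homeCopy 0 s) (homeCopy 0 s) z z'
    exact (dist_le_dist_smul z.2 z'.2 g).trans h.ge
  · obtain ⟨σ, z, hz, h⟩ := exists_proj_hexagon_eq p
    exact ⟨σ.flag, ⟨z, hz⟩, by rw [pantsMap, ← copy_zero_eq, h]⟩
  · have hiff : pantsMap a s z = pantsMap a s' z' ↔ _ := proj_hexagon_eq_iff z.2 z'.2
    rw [hiff]
    constructor
    · rintro ⟨hz, g, hg, hgs⟩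
      refine ⟨Subtype.ext hz, ?_⟩
      have hseam : ∀ j, wallSide a (.inr j) z' = 0 → OnSeam z := fun j hj =>
        ⟨j, by rw [hz]; exact (side_wall_seam_eq_zero ha.out j _).1 hj⟩
      rcases mem_wallGroup_cases hg with rfl | ⟨i, -, rfl⟩ | ⟨j, hj, rfl⟩ | ⟨i, j, -, hj, rfl⟩
      · rw [one_smul] at hgs
        exact .inl (congrArg Copy.flag hgs).symm
      · rw [cuff_smul_copy_zero] at hgs
        exact .inl (congrArg Copy.flag hgs).symm
      · exact .inr (hseam j hj)
      · exact .inr (hseam j hj)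
    · rintro ⟨rfl, rfl | ⟨j, hj⟩⟩
      · exact ⟨rfl, 1, one_mem _, one_smul _ _⟩
      · refine ⟨rfl, ?_⟩
        rcases eq_or_ne s s' with rfl | hs
        · exact ⟨1, one_mem _, one_smul _ _⟩
        · refine ⟨gen a (.inr j), gen_mem_wallGroup ((side_wall_seam_eq_zero ha.out j _).2 hj), ?_⟩
          rw [seam_smul_copy]
          refine Copy.ext rfl ?_
          cases s <;> cases s' <;> simp_all [homeCopy]

/-- The copy of the pair of pants with index `w` in the surface `X_n`. -/
noncomputable def treeMap (a : ℝ) [Fact (1 < a)] {n : ℕ} (w : ReducedWord n)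
    (p : TreeSpace a 0) : TreeSpace a n :=
  proj a ⟨w, (exists_proj_hexagon_eq p).choose.flag⟩ (exists_proj_hexagon_eq p).choose_spec.choose

lemma treeMap_proj (w : ReducedWord n) (σ : Copy 0) {z : ℍ} (hz : z ∈ hexagon a) :
    treeMap a w (proj a σ z) = proj a ⟨w, σ.flag⟩ z := by
  obtain ⟨h1, h2⟩ := (exists_proj_hexagon_eq (proj a σ z)).choose_spec.choose_spec
  obtain ⟨h3, g, hg, hgs⟩ := (proj_hexagon_eq_iff h1 hz).1 h2
  rw [treeMap, h3, ← hgs]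
  rcases mem_wallGroup_cases hg with rfl | ⟨i, -, rfl⟩ | ⟨j, hj, rfl⟩ | ⟨i, j, -, hj, rfl⟩
  · rw [one_smul]
  · rw [cuff_smul_copy_zero]
  · rw [seam_smul_copy]; exact proj_seam (σ := ⟨w, σ.flag⟩) hj
  · rw [mul_smul, cuff_smul_copy_zero, seam_smul_copy]; exact proj_seam (σ := ⟨w, σ.flag⟩) hj

omit ha in
lemma reach_zero_smul {g : HexGroup a} (h : Reach (baseCopy 0) g) (w : ReducedWord n) :
    (⟨w, (g⁻¹ • baseCopy 0).flag⟩ : Copy n) = g⁻¹ • ⟨w, false⟩ := by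
  induction h with
  | one => rw [inv_one, one_smul, one_smul]; rfl
  | @step g i _ hne ih =>
    rcases i with i | j
    · exact absurd (cuff_smul_copy_zero i _) hne
    · rw [mul_inv_rev, gen_inv, mul_smul, mul_smul, ← ih, seam_smul_copy, seam_smul_copy]

lemma treeMap_proj_region (w : ReducedWord n) {y : ℍ} (hy : y ∈ region a (baseCopy 0)) :
    treeMap a w (proj a (baseCopy 0) y) = proj a ⟨w, false⟩ y := by
  obtain ⟨g, h1, h2⟩ := exists_reach hy
  rw [← proj_smul g⁻¹, treeMap_proj w _ h1, reach_zero_smul h2, proj_smul]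

omit ha in
lemma boundaryMirrors_subset (σ : Copy n) :
    boundaryMirrors a σ ⊆ boundaryMirrors a (baseCopy 0) := by
  rintro ⟨g, i⟩ hm
  rw [mem_boundaryMirrors_iff] at hm ⊢
  rcases i with i | j
  · exact cuff_smul_copy_zero i _
  · exact absurd hm (seam_smul_copy_ne j _)

lemma isLocalIsometry_treeMap (w : ReducedWord n) : IsLocalIsometry (treeMap a w) := by
  intro p
  obtain ⟨x, hx, rfl, -⟩ := exists_lift (center_mem_chamber (boundaryMirrors a (baseCopy 0))) p
  refine ⟨_, Metric.ball_mem_nhds _ (rad_pos (a := a)), fun q hq q' hq' => ?_⟩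
  rw [← dist_liftAt_liftAt hx hq hq', ← proj_liftAt hx q, ← proj_liftAt hx q',
    treeMap_proj_region w (liftAt_mem hx q), treeMap_proj_region w (liftAt_mem hx q'),
    proj_liftAt, proj_liftAt]
  exact dist_proj_eq (liftAt_mem_ball hx hq) (liftAt_mem_ball hx hq') fun m hm =>
    mirrorSide_mul_nonneg (liftAt_mem hx q) (liftAt_mem hx q') (boundaryMirrors_subset _ hm)

theorem isTreeGluing : IsTreeGluing (pantsMap a) n (treeSurface a n) := by
  have hrep : ∀ p : TreeSpace a 0, ∃ s, ∃ z ∈ hexagon a, proj a (homeCopy 0 s) z = p := by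
    intro p
    obtain ⟨σ, z, hz, h⟩ := exists_proj_hexagon_eq p
    exact ⟨σ.flag, z, hz, by rw [← copy_zero_eq, h]⟩
  refine ⟨treeMap a, isLocalIsometry_treeMap, fun q => ?_, fun w p w' p' => ⟨fun h => ?_, ?_⟩⟩
  · obtain ⟨τ, z, hz, rfl⟩ := exists_proj_hexagon_eq q
    exact ⟨τ.word, proj a (homeCopy 0 τ.flag) z, treeMap_proj _ _ hz⟩
  · obtain ⟨s, z, hz, rfl⟩ := hrep p
    obtain ⟨s', z', hz', rfl⟩ := hrep p'
    rw [treeMap_proj w _ hz, treeMap_proj w' _ hz'] at h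
    obtain ⟨rfl, g, hg, hgs⟩ := (proj_hexagon_eq_iff hz hz').1 h
    have hcross : ∀ i b, wallSide a (.inl i) z = 0 → w = cross n i w' →
        w = w' ∨ ∃ i, proj a (homeCopy 0 b) z ∈ cuff (pantsMap a) i ∧
          (w'.1 = i :: w.1 ∨ w.1 = i :: w'.1) := by
      intro i b hi hw
      rcases cross_cases n i w' with h | h | h
      · exact .inl (by rw [hw, h])
      · exact .inr ⟨i, ⟨b, ⟨z, hz⟩, rfl, (side_wall_cuff_eq_zero ha.out i z).1 hi⟩,
          .inr (by rw [hw, h])⟩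
      · exact .inr ⟨i, ⟨b, ⟨z, hz⟩, rfl, (side_wall_cuff_eq_zero ha.out i z).1 hi⟩,
          .inl (by rw [hw, h])⟩
    rcases mem_wallGroup_cases hg with rfl | ⟨i, hi, rfl⟩ | ⟨j, hj, rfl⟩ | ⟨i, j, hi, hj, rfl⟩
    · rw [one_smul] at hgs
      have h1 : w' = w := congrArg Copy.word hgs
      have h2 : s' = s := congrArg Copy.flag hgs
      rw [h1, h2]
      exact ⟨rfl, .inl rfl⟩
    · rw [cuff_smul_copy] at hgs
      have h1 : cross n i w' = w := congrArg Copy.word hgs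
      have h2 : s' = s := congrArg Copy.flag hgs
      rw [h2]
      exact ⟨rfl, hcross i s hi h1.symm⟩
    · rw [seam_smul_copy] at hgs
      have h1 : w' = w := congrArg Copy.word hgs
      have h2 : (!s') = s := congrArg Copy.flag hgs
      rw [← h2]
      exact ⟨proj_seam (σ := homeCopy 0 s') hj, .inl h1.symm⟩
    · rw [mul_smul, cuff_smul_copy, seam_smul_copy] at hgs
      have h1 : cross n i w' = w := congrArg Copy.word hgs
      have h2 : (!s') = s := congrArg Copy.flag hgs
      rw [← h2]
      exact ⟨proj_seam (σ := homeCopy 0 s') hj, hcross i _ hi h1.symm⟩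
  · rintro ⟨rfl, rfl | ⟨i, ⟨s, z, rfl, hi⟩, h⟩⟩
    · rfl
    · rw [← side_wall_cuff_eq_zero ha.out] at hi
      have e : ∀ v : ReducedWord n, treeMap a v (pantsMap a s z) = proj a ⟨v, s⟩ z := fun v =>
        treeMap_proj v _ z.2
      rw [e, e]
      rcases h with h | h
      · rw [← cross_of_cons h]; exact proj_cuff (σ := ⟨w', s⟩) hi
      · rw [← cross_of_cons h]; exact (proj_cuff (σ := ⟨w, s⟩) hi).symm

end Gluing

/-! ### Universal covers -/

/-- Coordinates on the hyperbolic plane in which geodesics are straight lines. -/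
noncomputable def klein (z : ℍ) : ℝ × ℝ := (z.re, z.re ^ 2 + z.im ^ 2)

lemma isEmbedding_klein : IsEmbedding klein := by
  have h1 : Continuous fun q : ℝ × ℝ => (q.1 : ℂ) + (√(q.2 - q.1 ^ 2) : ℝ) * Complex.I := by
    fun_prop
  have h2 : Continuous klein := by
    have := UpperHalfPlane.continuous_re
    have := UpperHalfPlane.continuous_im
    unfold klein
    fun_prop
  refine IsEmbedding.of_comp h2 h1 ?_
  convert UpperHalfPlane.isEmbedding_coe using 1
  ext z
  simp only [Function.comp_apply, klein, add_sub_cancel_left, Real.sqrt_sq z.im_pos.le]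
  apply Complex.ext <;> simp

/-- The side functions are affine in these coordinates, up to a positive factor. -/
lemma exists_klein_combination (z z' : ℍ) {α β : ℝ} (hα : 0 ≤ α) (hβ : 0 ≤ β) (h : α + β = 1) :
    ∃ w : ℍ, klein w = α • klein z + β • klein z' ∧ ∀ v,
      w.im * side v w = α * (z.im * side v z) + β * (z'.im * side v z') := by
  have hy := z.im_pos
  have hy' := z'.im_pos
  set p := α * z.re + β * z'.re with hp
  set q := α * (z.re ^ 2 + z.im ^ 2) + β * (z'.re ^ 2 + z'.im ^ 2) with hq
  have hpq : 0 < q - p ^ 2 := by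
    have e : q - p ^ 2 = α * β * (z.re - z'.re) ^ 2 + (α * z.im ^ 2 + β * z'.im ^ 2) := by
      rw [hq, hp, ← sub_eq_zero]
      obtain rfl : β = 1 - α := by linarith
      ring
    rw [e]
    have h1 : 0 < α * z.im ^ 2 + β * z'.im ^ 2 := by
      rcases hα.eq_or_lt with rfl | hα'
      · have : β = 1 := by linarith
        rw [this]; positivity
      · positivity
    have h2 : 0 ≤ α * β * (z.re - z'.re) ^ 2 := by positivity
    linarith
  set w : ℍ := ⟨⟨p, √(q - p ^ 2)⟩, Real.sqrt_pos.2 hpq⟩ with hw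
  have hre : w.re = p := rfl
  have him : w.im = √(q - p ^ 2) := rfl
  have hsq : w.im ^ 2 = q - p ^ 2 := by rw [him, Real.sq_sqrt hpq.le]
  refine ⟨w, ?_, fun v => ?_⟩
  · rw [klein, hsq, hre, add_sub_cancel, klein, klein, hp, hq]
    simp
  · have hwy := w.im_pos
    rw [side_eq, side_eq, side_eq, hre, hsq]
    field_simp
    rw [hq, hp]
    obtain rfl : β = 1 - α := by linarith
    ring

section Cover

variable {a : ℝ} [ha : Fact (1 < a)] {n : ℕ}

lemma contractibleSpace_chamber (R : Set (HexGroup a × Wall)) : ContractibleSpace (chamber R) := by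
  have hconv : Convex ℝ (klein '' chamber R) := by
    rintro _ ⟨z, hz, rfl⟩ _ ⟨z', hz', rfl⟩ α β hα hβ h
    obtain ⟨w, hw, hs⟩ := exists_klein_combination z z' hα hβ h
    refine ⟨w, fun m hm => ?_, hw⟩
    obtain ⟨v, -, hv⟩ := exists_mirror_vec m
    have h1 := hz m hm
    have h2 := hz' m hm
    rw [hv z] at h1
    rw [hv z'] at h2
    rw [hv w]
    refine nonneg_of_mul_nonneg_right ?_ w.im_pos
    have e : w.im * (mirrorSide m (center a) * side v w) =
        α * (z.im * (mirrorSide m (center a) * side v z)) +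
          β * (z'.im * (mirrorSide m (center a) * side v z')) := by
      linear_combination mirrorSide m (center a) * hs v
    rw [e]
    have := z.im_pos
    have := z'.im_pos
    positivity
  have := hconv.contractibleSpace ⟨_, mem_image_of_mem klein (center_mem_chamber R)⟩
  exact (isEmbedding_klein.homeomorphImage (chamber R)).contractibleSpace

/-- The region as a covering space of the surface. -/
noncomputable def cover (a : ℝ) [Fact (1 < a)] (n : ℕ) (x : region a (baseCopy n)) :
    TreeSpace a n := proj a (baseCopy n) x

lemma isCoveringMap_cover : IsCoveringMap (cover a n) := by
  refine isCoveringMap_of_uniform (rad_pos (a := a)) (fun x y hy y' hy' => ?_) fun x q _ => ?_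
  · exact dist_proj_region_eq hy hy' y.2 y'.2
  · obtain ⟨y, hy, h1, h2⟩ := exists_lift x.2 q
    exact ⟨⟨y, hy⟩, h1, h2⟩

lemma isLocalIsometry_cover : IsLocalIsometry (cover a n) := fun x =>
  ⟨_, Metric.ball_mem_nhds x (rad_pos (a := a)), fun y hy y' hy' =>
    dist_proj_region_eq hy hy' y.2 y'.2⟩

theorem isUniversalCover : IsUniversalCover (region a (baseCopy n)) (treeSurface a n) := by
  have : ContractibleSpace (region a (baseCopy n)) := contractibleSpace_chamber _
  exact ⟨inferInstance, cover a n, isCoveringMap_cover, isLocalIsometry_cover⟩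

end Cover

/-! ### Boundary components -/

/-- The components of a space that is a finite disjoint union of closed connected subsets. -/
lemma card_connectedComponents_of_partition {X I : Type*} [TopologicalSpace X] [Finite I]
    {B : Set X} {S : I → Set X} (hB : ∀ x, x ∈ B ↔ ∃ i, x ∈ S i) (hclosed : ∀ i, IsClosed (S i))
    (hconn : ∀ i, IsConnected (S i)) (hdisj : ∀ i j x, x ∈ S i → x ∈ S j → i = j) :
    Nat.card (ConnectedComponents B) = Nat.card I := by
  let _ : TopologicalSpace I := ⊥
  have : DiscreteTopology I := ⟨rfl⟩
  choose f hf using fun x : B => (hB x).1 x.2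
  have hfeq : ∀ (x : B) i, f x = i ↔ (x : X) ∈ S i := fun x i =>
    ⟨fun h => h ▸ hf x, fun h => hdisj _ _ _ (hf x) h⟩
  have hcont : Continuous f := by
    rw [continuous_iff_isClosed]
    intro T _
    have : f ⁻¹' T = ⋃ i ∈ T, Subtype.val ⁻¹' S i := by
      ext x
      simp only [mem_preimage, mem_iUnion, exists_prop]
      exact ⟨fun h => ⟨_, h, hf x⟩, fun ⟨i, hi, h⟩ => (hfeq x i).2 h ▸ hi⟩
    rw [this]
    exact (toFinite T).isClosed_biUnion fun i _ => (hclosed i).preimage continuous_subtype_val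
  refine Nat.card_congr (Equiv.ofBijective hcont.connectedComponentsLift ⟨?_, fun i => ?_⟩)
  · intro x y
    obtain ⟨x, rfl⟩ := ConnectedComponents.surjective_coe x
    obtain ⟨y, rfl⟩ := ConnectedComponents.surjective_coe y
    intro h
    change f x = f y at h
    have hpre : IsPreconnected (Subtype.val ⁻¹' S (f x) : Set B) := by
      rw [← IsInducing.subtypeVal.isPreconnected_image, Subtype.image_preimage_coe,
        inter_eq_right.2 fun z hz => (hB z).2 ⟨_, hz⟩]
      exact (hconn _).isPreconnected
    rw [ConnectedComponents.coe_eq_coe']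
    exact hpre.subset_connectedComponent (h ▸ hf y) (hf x)
  · obtain ⟨x, hx⟩ := (hconn i).nonempty
    exact ⟨((⟨x, (hB x).2 ⟨i, hx⟩⟩ : B) : ConnectedComponents B), (hfeq _ i).2 hx⟩

lemma exists_midpoint (z z' : ℍ) :
    ∃ (w : ℍ) (c : ℝ), 0 < c ∧ ∀ v, side v w = c * (side v z + side v z') := by
  have hy := z.im_pos
  have hy' := z'.im_pos
  obtain ⟨w, -, h⟩ := exists_klein_combination z z' (α := z'.im / (z.im + z'.im))
    (β := z.im / (z.im + z'.im)) (by positivity) (by positivity) (by field_simp; ring)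
  have hw := w.im_pos
  refine ⟨w, z.im * z'.im / (z.im + z'.im) / w.im, by positivity, fun v => ?_⟩
  have := h v
  field_simp at this ⊢
  linarith

/-- The indices of the boundary components of `X_n`: the cuffs of the outermost pairs of pants that
are not glued to another cuff. -/
def FreeCuff (n : ℕ) : Type :=
  {p : Fin 3 × List (Fin 3) // p.2.length = n ∧ (p.1 :: p.2).IsChain (· ≠ ·)}

instance (n : ℕ) : Finite (FreeCuff n) := by
  have : Finite {l : List (Fin 3) // l.length ≤ n} := List.finite_length_le (Fin 3) n
  exact Finite.of_injective (fun p : FreeCuff n => (p.1.1,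
    (⟨p.1.2, p.2.1.le⟩ : {l : List (Fin 3) // l.length ≤ n}))) fun p q h => by
      simp only [Prod.mk.injEq, Subtype.mk.injEq] at h
      exact Subtype.ext (Prod.ext h.1 h.2)

lemma card_freeCuff (n : ℕ) : Nat.card (FreeCuff n) = 3 * 2 ^ n := by
  induction n with
  | zero =>
    have : FreeCuff 0 ≃ Fin 3 :=
      { toFun := fun p => p.1.1
        invFun := fun i => ⟨(i, []), rfl, List.isChain_singleton _⟩
        left_inv := fun ⟨⟨i, w⟩, h, _⟩ => by
          obtain rfl := List.length_eq_zero_iff.1 h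
          rfl
        right_inv := fun _ => rfl }
    rw [Nat.card_congr this, Nat.card_fin, pow_zero, mul_one]
  | succ n ih =>
    have e : (Σ p : FreeCuff n, {j : Fin 3 // j ≠ p.1.1}) ≃ FreeCuff (n + 1) := by
      refine Equiv.ofBijective (fun x => ⟨(x.2.1, x.1.1.1 :: x.1.1.2),
        by rw [List.length_cons, x.1.2.1], List.isChain_cons_cons.2 ⟨x.2.2, x.1.2.2⟩⟩) ⟨?_, ?_⟩
      · rintro ⟨⟨⟨i, w⟩, h⟩, ⟨j, hj⟩⟩ ⟨⟨⟨i', w'⟩, h'⟩, ⟨j', hj'⟩⟩ heq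
        cases heq
        rfl
      · rintro ⟨⟨j, w⟩, h1, h2⟩
        cases w with
        | nil => simp at h1
        | cons i w =>
          rw [List.isChain_cons_cons] at h2
          exact ⟨⟨⟨(i, w), by simpa using h1, h2.2⟩, ⟨j, h2.1⟩⟩, rfl⟩
    have h2 : ∀ i : Fin 3, Nat.card {j : Fin 3 // j ≠ i} = 2 := by
      intro i
      rw [Nat.card_eq_fintype_card]
      revert i; decide
    have : Fintype (FreeCuff n) := Fintype.ofFinite _
    rw [← Nat.card_congr e, Nat.card_sigma]
    simp only [h2, Finset.sum_const, smul_eq_mul, Finset.card_univ]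
    rw [← Nat.card_eq_fintype_card, ih, pow_succ]
    ring

section Components

variable {a : ℝ} [ha : Fact (1 < a)] {n : ℕ}

/-- The sides of the hexagon that become part of cuffs. -/
def cuffSide (a : ℝ) (i : Fin 3) : Set ℍ := {z | z ∈ hexagon a ∧ wallSide a (.inl i) z = 0}

lemma isPreconnected_cuffSide (i : Fin 3) : IsPreconnected (cuffSide a i) := by
  rw [← isEmbedding_klein.isInducing.isPreconnected_image]
  refine Convex.isPreconnected ?_
  rintro _ ⟨z, ⟨hz, hz0⟩, rfl⟩ _ ⟨z', ⟨hz', hz0'⟩, rfl⟩ α β hα hβ h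
  obtain ⟨w, hw, hs⟩ := exists_klein_combination z z' hα hβ h
  have hwy := w.im_pos
  have := z.im_pos
  have := z'.im_pos
  refine ⟨w, ⟨mem_hexagon.2 fun k => ?_, ?_⟩, hw⟩
  · refine nonneg_of_mul_nonneg_right ?_ hwy
    rw [wallSide, hs]
    have := mem_hexagon.1 hz k
    have := mem_hexagon.1 hz' k
    positivity
  · have := hs (wallVec a (.inl i))
    rw [show side (wallVec a (.inl i)) z = 0 from hz0,
      show side (wallVec a (.inl i)) z' = 0 from hz0'] at this
    simp only [mul_zero, add_zero] at this
    exact (mul_eq_zero.1 this).resolve_left hwy.ne'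

/-- Every cuff side ends at a seam. -/
lemma exists_corner (i : Fin 3) : ∃ z ∈ cuffSide a i, ∃ j, wallSide a (.inr j) z = 0 := by
  obtain ⟨j, hj⟩ : ∃ j, Perp (.inl i) (.inr j) := by
    fin_cases i
    · exact ⟨0, by decide⟩
    · exact ⟨0, by decide⟩
    · exact ⟨1, by decide⟩
  obtain ⟨e, he, -⟩ := exists_edge_point (a := a) (.inl i)
  obtain ⟨w, c, hc, hw⟩ := exists_midpoint e (gen a (.inr j) • e)
  have hi : wallSide a (.inl i) w = 0 := by
    have := wallSide_gen_smul_of_perp (a := a) hj e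
    rw [wallSide, hw, show side _ (gen a (.inr j) • e) = _ from this]
    simp [show side _ e = 0 from he]
  have hj0 : wallSide a (.inr j) w = 0 := by
    rw [wallSide, hw, show side _ (gen a (.inr j) • e) = _ from wallSide_gen_smul_self _ e]; simp
  refine ⟨w, ⟨mem_hexagon.2 fun k => ?_, hi⟩, j, hj0⟩
  rcases k with k | k
  · rcases eq_or_ne k i with rfl | hk
    · exact hi.ge
    · have := wallSide_add_pos (a := a) (i := .inl k) (j := .inl i) (by simpa using hk) id w
      linarith
  · rcases eq_or_ne k j with rfl | hk
    · exact hj0.ge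
    · have := wallSide_add_pos (a := a) (i := .inr k) (j := .inr j) (by simpa using hk) id w
      linarith

lemma isCompact_cuffSide (i : Fin 3) : IsCompact (cuffSide a i) :=
  (isCompact_hexagon ha.out).inter_right (isClosed_eq (continuous_side _) continuous_const)

/-- The word of the pair of pants to which a free cuff belongs. -/
def FreeCuff.word (p : FreeCuff n) : ReducedWord n := ⟨p.1.2, p.2.1.le, p.2.2.tail⟩

/-- The boundary component of a free cuff. -/
def component (a : ℝ) [Fact (1 < a)] (p : FreeCuff n) : Set (TreeSpace a n) :=
  proj a ⟨p.word, false⟩ '' cuffSide a p.1.1 ∪ proj a ⟨p.word, true⟩ '' cuffSide a p.1.1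

lemma isConnected_component (p : FreeCuff n) : IsConnected (component a p) := by
  obtain ⟨z, hz, j, hj⟩ := exists_corner (a := a) p.1.1
  have hc : ∀ b, IsConnected (proj a ⟨p.word, b⟩ '' cuffSide a p.1.1) := fun b =>
    ⟨⟨_, mem_image_of_mem _ hz⟩,
      (isPreconnected_cuffSide _).image _ (continuous_proj _).continuousOn⟩
  refine (hc false).union ⟨_, mem_image_of_mem _ hz, z, hz, ?_⟩ (hc true)
  exact proj_seam (σ := ⟨p.word, false⟩) hj

lemma isClosed_component (p : FreeCuff n) : IsClosed (component a p) :=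
  (((isCompact_cuffSide _).image (continuous_proj _)).union
    ((isCompact_cuffSide _).image (continuous_proj _))).isClosed

lemma mem_component {p : FreeCuff n} {q : TreeSpace a n} :
    q ∈ component a p ↔ ∃ b, ∃ z ∈ cuffSide a p.1.1, proj a ⟨p.word, b⟩ z = q := by
  simp only [component, mem_union, mem_image, Bool.exists_bool]

omit ha in
lemma freeCuff_smul (p : FreeCuff n) (b : Bool) :
    gen a (.inl p.1.1) • (⟨p.word, b⟩ : Copy n) = ⟨p.word, b⟩ :=
  cuff_smul_copy_eq_self_iff.2 p.2

lemma component_disjoint {p p' : FreeCuff n} {q : TreeSpace a n} (h : q ∈ component a p)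
    (h' : q ∈ component a p') : p = p' := by
  obtain ⟨b, z, hz, rfl⟩ := mem_component.1 h
  obtain ⟨b', z', hz', heq⟩ := mem_component.1 h'
  obtain ⟨rfl, g, hg, hgs⟩ := (proj_hexagon_eq_iff hz'.1 hz.1).1 heq
  have hi := cuff_unique hz.2 hz'.2
  have hw : p'.word = p.word := by
    have hcuff : ∀ i c, wallSide a (.inl i) z' = 0 →
        gen a (.inl i) • (⟨p.word, c⟩ : Copy n) = ⟨p.word, c⟩ := by
      intro i c h
      obtain rfl := cuff_unique h hz.2
      exact freeCuff_smul p c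
    have hword := congrArg Copy.word hgs
    rcases mem_wallGroup_cases hg with rfl | ⟨i, h, rfl⟩ | ⟨j, -, rfl⟩ | ⟨i, j, h, -, rfl⟩
    · rw [one_smul] at hword; exact hword.symm
    · rw [hcuff i b h] at hword; exact hword.symm
    · rw [seam_smul_copy] at hword; exact hword.symm
    · rw [mul_smul, seam_smul_copy, hcuff i _ h] at hword; exact hword.symm
  exact Subtype.ext (Prod.ext hi (congrArg Subtype.val hw).symm)

lemma mem_boundary_iff_component (q : TreeSpace a n) :
    q ∈ boundary (TreeSpace a n) ↔ ∃ p : FreeCuff n, q ∈ component a p := by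
  constructor
  · obtain ⟨σ, z, hz, rfl⟩ := exists_proj_hexagon_eq q
    rw [proj_hexagon_mem_boundary_iff hz]
    rintro ⟨i, hi, h⟩
    exact ⟨⟨(i, σ.word.1), cuff_smul_copy_eq_self_iff.1 h⟩,
      mem_component.2 ⟨σ.flag, z, ⟨hz, hi⟩, rfl⟩⟩
  · rintro ⟨p, hp⟩
    obtain ⟨b, z, hz, rfl⟩ := mem_component.1 hp
    exact (proj_hexagon_mem_boundary_iff hz.1).2 ⟨_, hz.2, freeCuff_smul p b⟩

theorem numBoundaryComponents_treeSurface :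
    numBoundaryComponents (treeSurface a n) = 3 * 2 ^ n := by
  rw [← card_freeCuff]
  exact card_connectedComponents_of_partition mem_boundary_iff_component isClosed_component
    isConnected_component fun _ _ _ => component_disjoint

end Components

/-! ### Planarity -/

section Planar

variable {a : ℝ} [ha : Fact (1 < a)] {n : ℕ}

/-- The homomorphism that detects seams. -/
def seamSgn (a : ℝ) : HexGroup a →* ℤˣ :=
  (hexSystem a).lift ⟨Sum.elim (fun _ => 1) (fun _ => -1), isLiftable_hexMatrix
    (by rintro (i | j) <;> simp) (by rintro (i | i) (j | j) <;> simp)⟩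

omit ha in
lemma seamSgn_cuff (i : Fin 3) : seamSgn a (gen a (.inl i)) = 1 := by
  rw [seamSgn, gen, CoxeterSystem.lift_apply_simple]; rfl

omit ha in
lemma seamSgn_seam (j : Fin 3) : seamSgn a (gen a (.inr j)) = -1 := by
  rw [seamSgn, gen, CoxeterSystem.lift_apply_simple]; rfl

omit ha in
lemma seamSgn_conj (g h : HexGroup a) : seamSgn a (g * h * g⁻¹) = seamSgn a h := by
  rw [map_mul, map_mul, map_inv, mul_comm, ← mul_assoc, inv_mul_cancel, one_mul]

/-- The position of the copy of the hexagon with index `w` when the front sides of the copies are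
laid out in the plane. -/
def place (a : ℝ) : List (Fin 3) → HexGroup a
  | [] => 1
  | i :: w => place a w * gen a (.inl i)

/-- The group generated by the reflections in the cuffs. -/
def cuffGroup (a : ℝ) : Subgroup (HexGroup a) := Subgroup.closure (range fun i => gen a (.inl i))

omit ha in
lemma place_mem (w : List (Fin 3)) : place a w ∈ cuffGroup a := by
  induction w with
  | nil => exact one_mem _
  | cons i w ih => exact mul_mem ih (Subgroup.subset_closure ⟨i, rfl⟩)

omit ha in
lemma place_inv_smul (w : ReducedWord n) (b : Bool) :
    (place a w.1)⁻¹ • homeCopy n b = ⟨w, b⟩ := by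
  obtain ⟨w, hl, hw⟩ := w
  induction w with
  | nil => simp only [place, inv_one, one_smul]; rfl
  | cons i w ih =>
    rw [List.length_cons] at hl
    simp only [place, mul_inv_rev, gen_inv, mul_smul]
    rw [ih (by omega) hw.tail, cuff_smul_copy]
    refine Copy.ext (Subtype.ext ?_) rfl
    change crossList n i w = i :: w
    rw [crossList_of_chain hw, if_pos (by omega)]

/-- Cuff reflections do not move the center across a seam, as no seam reflection is conjugate to a
cuff reflection. -/
lemma wallSide_seam_pos {k : HexGroup a} (hk : k ∈ cuffGroup a) (j : Fin 3) :
    0 < wallSide a (.inr j) (k • center a) := by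
  have step : ∀ k i, 0 < wallSide a (.inr j) (k • center a) →
      0 < wallSide a (.inr j) ((k * gen a (.inl i)) • center a) := by
    intro k i h
    by_contra hcon
    have hne : wallSide a (.inr j) ((k * gen a (.inl i)) • center a) ≠ 0 := by
      have := mirrorSide_center_ne_zero (a := a) ((k * gen a (.inl i))⁻¹, .inr j)
      rwa [mirrorSide, inv_inv] at this
    have hlt := lt_of_le_of_ne (not_lt.1 hcon) hne
    rw [mul_smul] at hlt
    have h1 := congrArg (seamSgn a) (eq_gen_of_separates (mul_neg_of_pos_of_neg h hlt))
    have h2 : seamSgn a (k⁻¹ * gen a (.inr j) * k) = -1 := by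
      have := seamSgn_conj k⁻¹ (gen a (.inr j))
      rwa [inv_inv, seamSgn_seam] at this
    rw [h2, seamSgn_cuff] at h1
    exact absurd h1 (by decide)
  induction hk using Subgroup.closure_induction_right with
  | one => rw [one_smul]; exact wallSide_center_pos _
  | mul_right x _ y hy ih =>
    obtain ⟨i, rfl⟩ := hy
    exact step x i ih
  | mul_inv_cancel x _ y hy ih =>
    obtain ⟨i, rfl⟩ := hy
    dsimp only
    rw [gen_inv]
    exact step x i ih

lemma wallSide_seam_nonneg {k : HexGroup a} (hk : k ∈ cuffGroup a) (j : Fin 3) {z : ℍ}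
    (hz : z ∈ hexagon a) : 0 ≤ wallSide a (.inr j) (k • z) :=
  nonneg_of_mul_nonneg_right (wallSide_mul_nonneg center_mem_hexagon hz k (.inr j))
    (wallSide_seam_pos hk j)

/-- An image of a seam meets the hexagon only in seams. -/
lemma exists_seam_of_wallSide_eq_zero {k : HexGroup a} {j : Fin 3} {z : ℍ}
    (hz : z ∈ hexagon a) (h : wallSide a (.inr j) (k • z) = 0) :
    ∃ j, wallSide a (.inr j) z = 0 := by
  have hfix : (k⁻¹ * gen a (.inr j) * k) • z = z := by
    rw [mul_smul, mul_smul, (gen_smul_eq_self_iff _ _).2 h, inv_smul_smul]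
  have hs : seamSgn a (k⁻¹ * gen a (.inr j) * k) = -1 := by
    have := seamSgn_conj k⁻¹ (gen a (.inr j))
    rwa [inv_inv, seamSgn_seam] at this
  rcases mem_wallGroup_cases (smul_eq_self_of_mem_hexagon hz (w := k⁻¹ * gen a (.inr j) * k)
    (by rwa [hfix])).2 with h1 | ⟨i, -, h1⟩ | ⟨l, hl, -⟩ | ⟨i, l, -, hl, -⟩
  · rw [h1, map_one] at hs; exact absurd hs (by decide)
  · rw [h1, seamSgn_cuff] at hs; exact absurd hs (by decide)
  · exact ⟨l, hl⟩
  · exact ⟨l, hl⟩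

/-- The height function: a concave function (in the coordinates `klein`) that is positive on the
layout of the front sides, except on the seams. -/
noncomputable def height (a : ℝ) [Fact (1 < a)] (n : ℕ) (z : ℍ) : ℝ :=
  ⨅ p : ReducedWord n × Fin 3, z.im * wallSide a (.inr p.2) ((place a p.1.1)⁻¹ • z)

instance (n : ℕ) : Nonempty (ReducedWord n) := ⟨⟨[], by simp, List.isChain_nil⟩⟩

lemma height_le (p : ReducedWord n × Fin 3) (z : ℍ) :
    height a n z ≤ z.im * wallSide a (.inr p.2) ((place a p.1.1)⁻¹ • z) :=
  ciInf_le (finite_range _).bddBelow p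

lemma exists_height_eq (z : ℍ) : ∃ p : ReducedWord n × Fin 3,
    height a n z = z.im * wallSide a (.inr p.2) ((place a p.1.1)⁻¹ • z) := by
  obtain ⟨p, hp⟩ := exists_eq_ciInf_of_finite
    (f := fun p : ReducedWord n × Fin 3 => z.im * wallSide a (.inr p.2) ((place a p.1.1)⁻¹ • z))
  exact ⟨p, hp.symm⟩

lemma continuous_height : Continuous (height a n) := by
  have : Fintype (ReducedWord n × Fin 3) := Fintype.ofFinite _
  have h : height a n = fun z => Finset.univ.inf' Finset.univ_nonempty
      (fun p : ReducedWord n × Fin 3 => z.im * wallSide a (.inr p.2) ((place a p.1.1)⁻¹ • z)) := by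
    ext z
    rw [height, Finset.inf'_univ_eq_ciInf]
  rw [h]
  refine Continuous.finset_inf'_apply _ fun p _ => ?_
  exact UpperHalfPlane.continuous_im.mul
    ((continuous_side _).comp (isometry_smul ℍ (place a p.1.1)⁻¹).continuous)

lemma height_center_pos : 0 < height a n (center a) := by
  obtain ⟨p, hp⟩ := exists_height_eq (a := a) (n := n) (center a)
  rw [hp]
  exact mul_pos (center a).im_pos (wallSide_seam_pos (inv_mem (place_mem _)) _)

lemma height_place_nonneg (w : ReducedWord n) {z : ℍ} (hz : z ∈ hexagon a) :
    0 ≤ height a n (place a w.1 • z) := by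
  obtain ⟨p, hp⟩ := exists_height_eq (a := a) (n := n) (place a w.1 • z)
  rw [hp, smul_smul]
  exact mul_nonneg (UpperHalfPlane.im_pos _).le
    (wallSide_seam_nonneg (mul_mem (inv_mem (place_mem _)) (place_mem _)) _ hz)

lemma height_place_eq_zero_iff (w : ReducedWord n) {z : ℍ} (hz : z ∈ hexagon a) :
    height a n (place a w.1 • z) = 0 ↔ ∃ j, wallSide a (.inr j) z = 0 := by
  constructor
  · intro h
    obtain ⟨p, hp⟩ := exists_height_eq (a := a) (n := n) (place a w.1 • z)
    rw [h, smul_smul, eq_comm, mul_eq_zero] at hp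
    exact exists_seam_of_wallSide_eq_zero hz
      (hp.resolve_left (UpperHalfPlane.im_pos _).ne')
  · rintro ⟨j, hj⟩
    refine le_antisymm ?_ (height_place_nonneg w hz)
    have := height_le (a := a) (w, j) (place a w.1 • z)
    rwa [inv_smul_smul, hj, mul_zero] at this

lemma height_concave {z z' w : ℍ} {α β : ℝ} (hα : 0 ≤ α) (hβ : 0 ≤ β) (h : α + β = 1)
    (hw : klein w = α • klein z + β • klein z') :
    α * height a n z + β * height a n z' ≤ height a n w := by
  obtain ⟨w', hw', hs⟩ := exists_klein_combination z z' hα hβ h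
  obtain rfl := isEmbedding_klein.injective (hw.trans hw'.symm)
  obtain ⟨p, hp⟩ := exists_height_eq (a := a) (n := n) w
  obtain ⟨v, -, hv⟩ := exists_mirror_vec (a := a) (place a p.1.1, .inr p.2)
  have h1 := mul_le_mul_of_nonneg_left (height_le (a := a) p z) hα
  have h2 := mul_le_mul_of_nonneg_left (height_le (a := a) p z') hβ
  simp only [mirrorSide] at hv
  rw [hv] at h1 h2 hp
  rw [hp, hs]
  linarith

/-- Front and back sides. -/
def flagSign (b : Bool) : ℝ := if b then -1 else 1

/-- The surface in space: the front sides are lifted by the height function, the back sides are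
lowered by it. The image of the center on the layout plane is the origin. -/
noncomputable def spacePoint (a : ℝ) [Fact (1 < a)] {n : ℕ} (σ : Copy n) (z : ℍ) :
    EuclideanSpace ℝ (Fin 3) :=
  !₂[(klein (place a σ.word.1 • z)).1 - (klein (center a)).1,
    (klein (place a σ.word.1 • z)).2 - (klein (center a)).2,
    flagSign σ.flag * height a n (place a σ.word.1 • z)]

lemma continuous_spacePoint (σ : Copy n) : Continuous (spacePoint a σ) := by
  have h1 : Continuous fun z : ℍ => place a σ.word.1 • z := (isometry_smul ℍ _).continuous
  have h2 := isEmbedding_klein.continuous.comp h1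
  have h3 := (continuous_height (a := a) (n := n)).comp h1
  refine (PiLp.continuous_toLp 2 _).comp (continuous_pi fun i => ?_)
  fin_cases i
  · exact h2.fst.sub continuous_const
  · exact h2.snd.sub continuous_const
  · exact continuous_const.mul h3

/-- The radial projection is injective, because the surface lies on the boundary of a
convex body. -/
lemma spacePoint_radial {σ τ : Copy n} {z z' : ℍ} (hz : z ∈ hexagon a) (hz' : z' ∈ hexagon a)
    {c : ℝ} (hc : 0 < c) (h : spacePoint a σ z = c • spacePoint a τ z') (hc1 : c ≤ 1) : c = 1 := by
  have e0 := congrArg (fun v : EuclideanSpace ℝ (Fin 3) => v 0) h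
  have e1 := congrArg (fun v : EuclideanSpace ℝ (Fin 3) => v 1) h
  have e2 := congrArg (fun v : EuclideanSpace ℝ (Fin 3) => v 2) h
  simp [spacePoint] at e0 e1 e2
  have hk : klein (place a σ.word.1 • z) =
      (1 - c) • klein (center a) + c • klein (place a τ.word.1 • z') := by
    refine Prod.ext ?_ ?_
    · simp; linarith
    · simp; linarith
  have h1 := height_concave (a := a) (n := n) (by linarith) hc.le (by ring) hk
  have h2 := height_center_pos (a := a) (n := n)
  have h3 := height_place_nonneg σ.word hz
  have h4 := height_place_nonneg τ.word hz'
  have h5 : height a n (place a σ.word.1 • z) = c * height a n (place a τ.word.1 • z') := by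
    have := congrArg abs e2
    have habs : ∀ b, |flagSign b| = 1 := by intro b; cases b <;> simp [flagSign]
    rw [abs_mul, abs_mul, abs_mul, habs, habs, abs_of_nonneg h3, abs_of_nonneg h4,
      abs_of_pos hc] at this
    linarith
  nlinarith

lemma spacePoint_ne_zero (σ : Copy n) (z : ℍ) : spacePoint a σ z ≠ 0 := by
  intro h
  have e0 := congrArg (fun v : EuclideanSpace ℝ (Fin 3) => v 0) h
  have e1 := congrArg (fun v : EuclideanSpace ℝ (Fin 3) => v 1) h
  have e2 := congrArg (fun v : EuclideanSpace ℝ (Fin 3) => v 2) h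
  simp [spacePoint] at e0 e1 e2
  have hk : place a σ.word.1 • z = center a :=
    isEmbedding_klein.injective (Prod.ext (by linarith) (by linarith))
  rw [hk] at e2
  have h2 := height_center_pos (a := a) (n := n)
  rcases e2 with h0 | h0
  · revert h0; cases σ.flag <;> simp [flagSign]
  · exact h2.ne' h0

lemma spacePoint_eq_iff {σ τ : Copy n} {z z' : ℍ} (hz : z ∈ hexagon a) (hz' : z' ∈ hexagon a) :
    spacePoint a σ z = spacePoint a τ z' ↔ proj a σ z = proj a τ z' := by
  obtain ⟨w, b⟩ := σ
  obtain ⟨w', b'⟩ := τ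
  constructor
  · intro h
    have e0 := congrArg (fun v : EuclideanSpace ℝ (Fin 3) => v 0) h
    have e1 := congrArg (fun v : EuclideanSpace ℝ (Fin 3) => v 1) h
    have e2 := congrArg (fun v : EuclideanSpace ℝ (Fin 3) => v 2) h
    simp [spacePoint] at e0 e1 e2
    have hk : place a w.1 • z = place a w'.1 • z' := isEmbedding_klein.injective (Prod.ext e0 e1)
    have hg : ((place a w.1)⁻¹ * place a w'.1) • z' = z := by
      rw [mul_smul, ← hk, inv_smul_smul]
    have hcopy : ∀ c, ((place a w.1)⁻¹ * place a w'.1) • (⟨w', c⟩ : Copy n) = ⟨w, c⟩ := by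
      intro c
      rw [mul_smul, ← place_inv_smul (a := a) w' c, smul_inv_smul, place_inv_smul]
    have hproj : ∀ c, proj a (⟨w, c⟩ : Copy n) z = proj a ⟨w', c⟩ z' := fun c =>
      proj_eq_iff.2 ⟨_, hcopy c, hg⟩
    rcases eq_or_ne b b' with rfl | hb
    · exact hproj b
    · rw [hk] at e2
      have h0 : height a n (place a w'.1 • z') = 0 := by
        cases b <;> cases b' <;> simp [flagSign] at hb e2 <;> linarith
      obtain ⟨j, hj⟩ := (height_place_eq_zero_iff w' hz').1 h0
      rw [hproj b, ← proj_seam (σ := ⟨w', b'⟩) hj]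
      congr 2
      cases b <;> cases b' <;> simp_all
  · intro h
    obtain ⟨rfl, g, hg, hgs⟩ := (proj_hexagon_eq_iff hz hz').1 h
    have hcross : ∀ i, wallSide a (.inl i) z = 0 → cross n i w' = w →
        place a w.1 • z = place a w'.1 • z := by
      intro i hi hw
      have hfix := (gen_smul_eq_self_iff (a := a) _ z).2 hi
      rcases cross_cases n i w' with h | h | h
      · rw [← hw, h]
      · rw [← hw, h, place, mul_smul, hfix]
      · rw [hw] at h
        rw [h, place, mul_smul, hfix]
    have hflip : ∀ {u u' : ReducedWord n} {c : Bool} {j}, wallSide a (.inr j) z = 0 →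
        place a u.1 • z = place a u'.1 • z →
        spacePoint a ⟨u, !c⟩ z = spacePoint a ⟨u', c⟩ z := by
      intro u u' c j hj hu
      have := (height_place_eq_zero_iff u' hz).2 ⟨j, hj⟩
      simp only [spacePoint, hu, this, mul_zero]
    rcases mem_wallGroup_cases hg with rfl | ⟨i, hi, rfl⟩ | ⟨j, hj, rfl⟩ | ⟨i, j, hi, hj, rfl⟩
    · rw [one_smul] at hgs; rw [hgs]
    · rw [cuff_smul_copy] at hgs
      obtain ⟨h1, h2⟩ := Copy.mk.inj hgs
      obtain rfl : b' = b := h2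
      simp only [spacePoint, hcross i hi h1]
    · rw [seam_smul_copy] at hgs
      rw [← hgs]
      exact hflip hj rfl
    · rw [mul_smul, seam_smul_copy, cuff_smul_copy] at hgs
      obtain ⟨h1, h2⟩ := Copy.mk.inj hgs
      obtain rfl : (!b') = b := h2
      exact hflip hj (hcross i hi h1)

theorem hasGenusZero : HasGenusZero (treeSurface a n) := by
  choose σ z hz hp using fun q : TreeSpace a n => exists_proj_hexagon_eq q
  set F : TreeSpace a n → EuclideanSpace ℝ (Fin 3) := fun q => spacePoint a (σ q) (z q) with hF
  have hFp : ∀ τ, ∀ y ∈ hexagon a, F (proj a τ y) = spacePoint a τ y := fun τ y hy =>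
    (spacePoint_eq_iff (hz _) hy).2 (hp _)
  have hcont : Continuous F := by
    let Q : (Σ _ : Copy n, hexagon a) → TreeSpace a n := fun x => proj a x.1 x.2
    have : CompactSpace (hexagon a) := isCompact_iff_compactSpace.1 (isCompact_hexagon ha.out)
    have hQ : Continuous Q := continuous_sigma fun τ =>
      (continuous_proj τ).comp continuous_subtype_val
    have hQs : Function.Surjective Q := fun q => ⟨⟨σ q, z q, hz q⟩, hp q⟩
    rw [(hQ.isClosedMap.isQuotientMap hQ hQs).continuous_iff]
    refine continuous_sigma fun τ => ?_
    have : (fun y : hexagon a => F (Q ⟨τ, y⟩)) =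
        fun y : hexagon a => spacePoint a τ (y : ℍ) :=
      funext fun y => hFp τ y y.2
    exact this ▸ (continuous_spacePoint τ).comp continuous_subtype_val
  have hne : ∀ q, F q ≠ 0 := fun q => spacePoint_ne_zero _ _
  have hinj : Function.Injective F := fun p q h => by
    rw [← hp p, ← hp q]
    exact (spacePoint_eq_iff (hz p) (hz q)).1 h
  have hrad : ∀ p q, ∀ c : ℝ, 0 < c → c ≤ 1 → F p = c • F q → p = q := by
    intro p q c hc hc1 h
    obtain rfl := spacePoint_radial (hz p) (hz q) hc h hc1
    exact hinj (by rwa [one_smul] at h)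
  have hcn : Continuous fun q => ‖F q‖⁻¹ • F q :=
    (hcont.norm.inv₀ fun q => norm_ne_zero_iff.2 (hne q)).smul hcont
  have hmem : ∀ q, ‖F q‖⁻¹ • F q ∈ Metric.sphere (0 : EuclideanSpace ℝ (Fin 3)) 1 := fun q => by
    rw [mem_sphere_zero_iff_norm, norm_smul, norm_inv, norm_norm,
      inv_mul_cancel₀ (norm_ne_zero_iff.2 (hne q))]
  have hcs : Continuous fun q => (⟨_, hmem q⟩ : Metric.sphere (0 : EuclideanSpace ℝ (Fin 3)) 1) :=
    hcn.subtype_mk hmem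
  refine ⟨_, (hcs.isClosedEmbedding fun p q h => ?_).isEmbedding⟩
  · have h' : ‖F p‖⁻¹ • F p = ‖F q‖⁻¹ • F q := congrArg Subtype.val h
    have np := norm_pos_iff.2 (hne p)
    have nq := norm_pos_iff.2 (hne q)
    have key : ∀ p q, ‖F p‖⁻¹ • F p = ‖F q‖⁻¹ • F q → F p = (‖F p‖ / ‖F q‖) • F q := by
      intro p q h
      rw [div_eq_mul_inv, mul_smul, ← h, smul_smul,
        mul_inv_cancel₀ (norm_ne_zero_iff.2 (hne p)), one_smul]
    rcases le_total ‖F p‖ ‖F q‖ with hle | hle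
    · exact hrad p q _ (div_pos np nq) ((div_le_one nq).2 hle) (key p q h')
    · exact (hrad q p _ (div_pos nq np) ((div_le_one np).2 hle) (key q p h'.symm)).symm

end Planar

/-! ### Coverings by local isometries -/

section Covering

/-- A locally `1`-Lipschitz curve is `1`-Lipschitz. -/
lemma dist_le_of_locally {Y : Type*} [PseudoMetricSpace Y] {f : ℝ → Y} {d : ℝ} (hd : 0 ≤ d)
    (h : ∀ t ∈ Icc 0 d, ∃ ε > 0, ∀ s ∈ Icc 0 d, ∀ s' ∈ Icc 0 d, |s - t| < ε → |s' - t| < ε →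
      dist (f s) (f s') ≤ |s - s'|) : dist (f 0) (f d) ≤ d := by
  have hf : ContinuousOn f (Icc 0 d) := by
    rw [Metric.continuousOn_iff]
    intro t ht δ hδ
    obtain ⟨ε, hε, h'⟩ := h t ht
    refine ⟨min ε δ, lt_min hε hδ, fun s hs hst => ?_⟩
    rw [Real.dist_eq] at hst
    exact lt_of_le_of_lt (h' s hs t ht (lt_of_lt_of_le hst (min_le_left _ _)) (by simpa using hε))
      (lt_of_lt_of_le hst (min_le_right _ _))
  have hclosed : IsClosed ({t | dist (f 0) (f t) ≤ t} ∩ Icc 0 d) := by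
    rw [inter_comm]
    exact isClosed_Icc.isClosed_le
      (continuous_dist.comp_continuousOn (continuousOn_const.prodMk hf)) continuousOn_id
  refine hclosed.Icc_subset_of_forall_exists_gt (by simp) (fun t ht y hy => ?_) (right_mem_Icc.2 hd)
  obtain ⟨ε, hε, h'⟩ := h t ⟨ht.2.1, ht.2.2.le⟩
  have hty : t < y := hy
  have htd := ht.2.2
  set s := min y (min d (t + ε / 2)) with hs
  have h1 : t < s := lt_min hty (lt_min htd (by linarith))
  have h2 : s ≤ t + ε / 2 := (min_le_right _ _).trans (min_le_right _ _)
  have h3 : s ≤ d := (min_le_right _ _).trans (min_le_left _ _)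
  refine ⟨s, ?_, h1, min_le_left _ _⟩
  have h4 := h' t ⟨ht.2.1, ht.2.2.le⟩ s ⟨ht.2.1.trans h1.le, h3⟩ (by simpa using hε)
    (by rw [abs_of_pos] <;> linarith)
  have h5 : dist (f 0) (f t) ≤ t := ht.1
  rw [abs_sub_comm, abs_of_pos (by linarith)] at h4
  change dist (f 0) (f s) ≤ s
  linarith [dist_triangle (f 0) (f t) (f s)]

variable {E X : Type*} [MetricSpace E] [MetricSpace X] {p : E → X}

lemma exists_lift_path (hp : IsCoveringMap p) {γ : ℝ → X} {d : ℝ} (hd : 0 ≤ d)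
    (hγ : ContinuousOn γ (Icc 0 d)) (e : E) (he : p e = γ 0) :
    ∃ γ' : ℝ → E, ContinuousOn γ' (Icc 0 d) ∧ γ' 0 = e ∧ ∀ t ∈ Icc 0 d, p (γ' t) = γ t := by
  rcases hd.eq_or_lt with rfl | hd
  · refine ⟨fun _ => e, continuousOn_const, rfl, fun t ht => ?_⟩
    rw [he, le_antisymm ht.2 ht.1]
  have hmem : ∀ s : unitInterval, (s : ℝ) * d ∈ Icc 0 d := fun s =>
    ⟨mul_nonneg s.2.1 hd.le, mul_le_of_le_one_left hd.le s.2.2⟩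
  let Γ : C(unitInterval, X) := ⟨fun s => γ (s * d), hγ.comp_continuous (by fun_prop) hmem⟩
  have h0 : Γ 0 = p e := by
    change γ (((0 : unitInterval) : ℝ) * d) = p e
    rw [he]; simp
  have hdiv : ∀ t ∈ Icc 0 d, t / d ∈ Icc (0 : ℝ) 1 := fun t ht =>
    ⟨div_nonneg ht.1 hd.le, (div_le_one hd).2 ht.2⟩
  refine ⟨fun t => hp.liftPath Γ e h0 (projIcc 0 1 zero_le_one (t / d)), ?_, ?_, fun t ht => ?_⟩
  · exact ((hp.liftPath Γ e h0).continuous.comp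
      (continuous_projIcc.comp (continuous_id.div_const d))).continuousOn
  · change hp.liftPath Γ e h0 (projIcc 0 1 zero_le_one (0 / d)) = e
    rw [zero_div, projIcc_left]
    exact hp.liftPath_zero Γ e h0
  · have := congrFun (hp.liftPath_lifts Γ e h0) (projIcc 0 1 zero_le_one (t / d))
    change p (hp.liftPath Γ e h0 _) = γ _ at this
    rw [this, projIcc_of_mem _ (hdiv t ht)]
    change γ (t / d * d) = γ t
    rw [div_mul_cancel₀ _ hd.ne']

/-- A lift of a locally `1`-Lipschitz curve is locally `1`-Lipschitz. -/
lemma locally_of_lift (hl : IsLocalIsometry p) {γ : ℝ → X} {γ' : ℝ → E} {d : ℝ}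
    (hγ' : ContinuousOn γ' (Icc 0 d)) (hlift : ∀ t ∈ Icc 0 d, p (γ' t) = γ t) :
    ∀ t ∈ Icc 0 d, ∃ ε > 0, ∀ s ∈ Icc 0 d, ∀ s' ∈ Icc 0 d, |s - t| < ε → |s' - t| < ε →
      dist (γ' s) (γ' s') = dist (γ s) (γ s') := by
  intro t ht
  obtain ⟨U, hU, hiso⟩ := hl (γ' t)
  have := hγ' t ht hU
  obtain ⟨ε, hε, hb⟩ := Metric.mem_nhdsWithin_iff.1 this
  refine ⟨ε, hε, fun s hs s' hs' h h' => ?_⟩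
  rw [← hlift s hs, ← hlift s' hs']
  exact (hiso _ (hb ⟨h, hs⟩) _ (hb ⟨h', hs'⟩)).symm

/-- Distances can be lifted to a covering of a geodesic space. -/
lemma exists_lift_dist (hX : IsGeodesicSpace X) (hp : IsCoveringMap p) (hl : IsLocalIsometry p)
    (x : E) (q : X) : ∃ y, p y = q ∧ dist x y ≤ dist (p x) q := by
  obtain ⟨γ, h0, h1, h2⟩ := hX (p x) q
  have hd : 0 ≤ dist (p x) q := dist_nonneg
  generalize dist (p x) q = d at *
  have hγ : ContinuousOn γ (Icc 0 d) :=
    LipschitzOnWith.continuousOn (K := 1) (LipschitzOnWith.of_dist_le_mul fun s hs t ht => by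
      rw [h2 s hs t ht, NNReal.coe_one, one_mul, Real.dist_eq])
  obtain ⟨γ', hγ', h0', hlift⟩ := exists_lift_path hp hd hγ x h0.symm
  refine ⟨γ' d, by rw [hlift _ (right_mem_Icc.2 hd), h1], ?_⟩
  rw [← h0']
  refine dist_le_of_locally hd fun t ht => ?_
  obtain ⟨ε, hε, h⟩ := locally_of_lift hl hγ' hlift t ht
  exact ⟨ε, hε, fun s hs s' hs' hst hst' => by rw [h s hs s' hs' hst hst', h2 s hs s' hs']⟩

lemma dist_le_of_isLocalIsometry (hE : IsGeodesicSpace E) (hl : IsLocalIsometry p) (x y : E) :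
    dist (p x) (p y) ≤ dist x y := by
  obtain ⟨γ, h0, h1, h2⟩ := hE x y
  have : dist (p (γ 0)) (p (γ (dist x y))) ≤ dist x y := by
    refine dist_le_of_locally (f := fun t => p (γ t)) dist_nonneg fun t ht => ?_
    obtain ⟨U, hU, hiso⟩ := hl (γ t)
    obtain ⟨ε, hε, hb⟩ := Metric.mem_nhds_iff.1 hU
    refine ⟨ε, hε, fun s hs s' hs' hst hst' => ?_⟩
    rw [hiso _ (hb (by rwa [Metric.mem_ball, h2 s hs t ht])) _
      (hb (by rwa [Metric.mem_ball, h2 s' hs' t ht])), h2 s hs s' hs']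
  rwa [h0, h1] at this

lemma infEDist_preimage (hE : IsGeodesicSpace E) (hX : IsGeodesicSpace X) (hp : IsCoveringMap p)
    (hl : IsLocalIsometry p) (B : Set X) (x : E) :
    Metric.infEDist x (p ⁻¹' B) = Metric.infEDist (p x) B := by
  refine le_antisymm (Metric.le_infEDist.2 fun b hb => ?_) (Metric.le_infEDist.2 fun y hy => ?_)
  · obtain ⟨y, rfl, hy⟩ := exists_lift_dist hX hp hl x b
    refine (Metric.infEDist_le_edist_of_mem (show y ∈ p ⁻¹' B from hb)).trans ?_
    rw [edist_dist, edist_dist]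
    exact ENNReal.ofReal_le_ofReal hy
  · refine (Metric.infEDist_le_edist_of_mem (show p y ∈ B from hy)).trans ?_
    rw [edist_dist, edist_dist]
    exact ENNReal.ofReal_le_ofReal (dist_le_of_isLocalIsometry hE hl x y)

lemma iSup_infEDist_preimage [Nonempty E] (hE : IsGeodesicSpace E) (hX : IsGeodesicSpace X)
    (hp : IsCoveringMap p) (hl : IsLocalIsometry p) (B : Set X) :
    ⨆ x, Metric.infEDist x (p ⁻¹' B) = ⨆ q, Metric.infEDist q B := by
  have hs : Function.Surjective p := fun q =>
    let ⟨y, hy, _⟩ := exists_lift_dist hX hp hl (Classical.arbitrary E) q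
    ⟨y, hy⟩
  rw [← hs.iSup_comp]
  exact iSup_congr fun x => infEDist_preimage hE hX hp hl B x

lemma IsChart.restrict {U U' : Set X} {φ : X → ℍ} (h : IsChart U φ) (hU' : IsOpen U')
    (hsub : U' ⊆ U) : IsChart U' φ := by
  obtain ⟨-, hd, V, hV, himg⟩ := h
  refine ⟨hU', fun x hx y hy => hd x (hsub hx) y (hsub hy),
    V ∩ ⋃ x ∈ U', ⋃ r ∈ {r | Metric.ball x r ⊆ U'}, Metric.ball (φ x) r,
    hV.inter (isOpen_biUnion fun x _ => isOpen_biUnion fun r _ => Metric.isOpen_ball), ?_⟩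
  ext w
  constructor
  · rintro ⟨x, hx, rfl⟩
    have h1 : φ x ∈ V ∩ halfPlane := himg ▸ mem_image_of_mem φ (hsub hx)
    obtain ⟨r, hr, hb⟩ := Metric.isOpen_iff.1 hU' x hx
    exact ⟨⟨h1.1, mem_iUnion₂.2 ⟨x, hx, mem_iUnion₂.2 ⟨r, hb, Metric.mem_ball_self hr⟩⟩⟩, h1.2⟩
  · rintro ⟨⟨hw, hw'⟩, hw0⟩
    obtain ⟨x, hx, hw'⟩ := mem_iUnion₂.1 hw'
    obtain ⟨r, hr, hw'⟩ := mem_iUnion₂.1 hw'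
    obtain ⟨y, hy, rfl⟩ : w ∈ φ '' U := himg ▸ ⟨hw, hw0⟩
    rw [Metric.mem_ball, hd y hy x (hsub hx)] at hw'
    exact ⟨y, hr hw', rfl⟩

/-- Local isometries that are covering maps preserve and reflect the boundary. -/
lemma preimage_boundary (hp : IsCoveringMap p) (hl : IsLocalIsometry p) :
    p ⁻¹' boundary X = boundary E := by
  have hopen := hp.isLocalHomeomorph.isOpenMap
  have key : ∀ x : E, ∃ W, IsOpen W ∧ x ∈ W ∧ ∀ y ∈ W, ∀ z ∈ W, dist (p y) (p z) = dist y z := by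
    intro x
    obtain ⟨U, hU, h⟩ := hl x
    obtain ⟨W, hW, hWo, hx⟩ := mem_nhds_iff.1 hU
    exact ⟨W, hWo, hx, fun y hy z hz => h y (hW hy) z (hW hz)⟩
  ext x
  obtain ⟨W, hW, hxW, hiso⟩ := key x
  constructor
  · rintro ⟨U, φ, hφ, hx, h0⟩
    have hW' : IsOpen (W ∩ p ⁻¹' U) := hW.inter (hφ.1.preimage hp.continuous)
    obtain ⟨-, hd, V, hV, himg⟩ := hφ.restrict (hopen _ hW') (by
      rintro _ ⟨y, hy, rfl⟩; exact hy.2)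
    refine ⟨W ∩ p ⁻¹' U, φ ∘ p, ⟨hW', fun y hy z hz => ?_, V, hV, by rw [image_comp, himg]⟩,
      ⟨hxW, hx⟩, h0⟩
    rw [← hiso y hy.1 z hz.1]
    exact hd _ (mem_image_of_mem p hy) _ (mem_image_of_mem p hz)
  · rintro ⟨U, φ, hφ, hx, h0⟩
    have hW' : IsOpen (U ∩ W) := hφ.1.inter hW
    obtain ⟨-, hd, V, hV, himg⟩ := hφ.restrict hW' inter_subset_left
    have hinj : InjOn p (U ∩ W) := fun y hy z hz h => by
      have := hiso y hy.2 z hz.2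
      rw [h, dist_self] at this
      exact dist_eq_zero.1 this.symm
    have : Nonempty E := ⟨x⟩
    have hinv : ∀ y ∈ U ∩ W, Function.invFunOn p (U ∩ W) (p y) = y := fun y hy =>
      hinj.leftInvOn_invFunOn hy
    refine ⟨p '' (U ∩ W), fun q => φ (Function.invFunOn p (U ∩ W) q), ⟨hopen _ hW', ?_, V, hV, ?_⟩,
      mem_image_of_mem p ⟨hx, hxW⟩, by simp only [hinv x ⟨hx, hxW⟩, h0]⟩
    · rintro _ ⟨y, hy, rfl⟩ _ ⟨z, hz, rfl⟩
      simp only [hinv y hy, hinv z hz]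
      rw [hiso y hy.2 z hz.2]
      exact hd y hy z hz
    · rw [← himg, image_image]
      exact image_congr fun y hy => by rw [hinv y hy]

end Covering

/-- The inradius of a surface, an invariant of commensurability classes. -/
noncomputable def surfaceInradius (X : HyperbolicSurface) : ℝ≥0∞ :=
  ⨆ x : X, Metric.infEDist x (boundary X)

lemma surfaceInradius_eq_of_covering {Z X : HyperbolicSurface} {p : Z → X}
    (hp : IsFiniteIsometricCovering p) : surfaceInradius Z = surfaceInradius X := by
  rw [surfaceInradius, surfaceInradius, ← preimage_boundary hp.1 hp.2.1]
  exact iSup_infEDist_preimage Z.geodesic X.geodesic hp.1 hp.2.1 _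

lemma surfaceInradius_eq_of_commensurable {X Y : HyperbolicSurface} (h : Commensurable X Y) :
    surfaceInradius X = surfaceInradius Y := by
  obtain ⟨Z, p, q, hp, hq⟩ := h
  rw [← surfaceInradius_eq_of_covering hp, surfaceInradius_eq_of_covering hq]

/-! ### Inradii -/

section Inradius

variable {a : ℝ} [ha : Fact (1 < a)] {n : ℕ}

lemma side_combination {v : Vec} {x y w : ℍ} {α β : ℝ}
    (h : toVec w = α • toVec x + β • toVec y) : side v w = α * side v x + β * side v y := by
  rw [side, h, bil_add_right, bil_smul_right, bil_smul_right, side, side]; ring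

lemma mirrorSide_combination {m : HexGroup a × Wall} {x y w : ℍ} {α β : ℝ}
    (h : toVec w = α • toVec x + β • toVec y) :
    mirrorSide m w = α * mirrorSide m x + β * mirrorSide m y := by
  obtain ⟨v, -, hv⟩ := exists_mirror_vec m
  rw [hv, hv, hv, side_combination h]

lemma mem_chamber_of_combination {R : Set (HexGroup a × Wall)} {x y w : ℍ} {α β : ℝ}
    (hα : 0 ≤ α) (hβ : 0 ≤ β) (h : toVec w = α • toVec x + β • toVec y) (hx : x ∈ chamber R)
    (hy : y ∈ chamber R) : w ∈ chamber R := by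
  intro m hm
  have h1 := hx m hm
  have h2 := hy m hm
  rw [mirrorSide_combination h]
  have : mirrorSide m (center a) * (α * mirrorSide m x + β * mirrorSide m y) =
      α * (mirrorSide m (center a) * mirrorSide m x) +
        β * (mirrorSide m (center a) * mirrorSide m y) := by ring
  rw [this]; positivity

lemma isGeodesicSpace_region (σ : Copy n) : IsGeodesicSpace (region a σ) := by
  classical
  intro x y
  obtain ⟨γ, h0, h1, h2, h3⟩ := exists_geodesic (x : ℍ) y
  have hmem : ∀ t ∈ Icc 0 (dist x y), γ t ∈ region a σ := fun t ht => by
    obtain ⟨α, β, hα, hβ, -, h⟩ := h3 t ht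
    exact mem_chamber_of_combination hα hβ h x.2 y.2
  have hd : 0 ≤ dist x y := dist_nonneg
  set Γ : ℝ → region a σ := fun t => if h : γ t ∈ region a σ then ⟨γ t, h⟩ else x with hΓ
  have hΓγ : ∀ t ∈ Icc 0 (dist x y), (Γ t : ℍ) = γ t := fun t ht => by
    simp only [hΓ, dif_pos (hmem t ht)]
  refine ⟨Γ, Subtype.ext ?_, Subtype.ext ?_, fun s hs t ht => ?_⟩
  · rw [hΓγ 0 ⟨le_rfl, hd⟩, h0]
  · rw [hΓγ _ ⟨hd, le_rfl⟩]; exact h1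
  · rw [Subtype.dist_eq, hΓγ s hs, hΓγ t ht]
    exact h2 s hs t ht

/-- The frontier of the region consists of its points on boundary mirrors. -/
lemma mem_frontier_region_iff {σ : Copy n} {x : ℍ} :
    x ∈ frontier (region a σ) ↔
      x ∈ region a σ ∧ ∃ m ∈ boundaryMirrors a σ, mirrorSide m x = 0 := by
  have hcl : IsClosed (region a σ) := isClosed_chamber _
  rw [hcl.frontier_eq, Set.mem_sdiff, and_congr_right_iff]
  intro hx
  constructor
  · intro h
    by_contra hcon
    push Not at hcon
    obtain ⟨r, hr, -, hb⟩ := exists_ball_subset_region hx hcon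
    exact h (mem_interior.2 ⟨_, hb, Metric.isOpen_ball, Metric.mem_ball_self hr⟩)
  · rintro ⟨m, hm, h0⟩ hint
    obtain ⟨r, hr, hb⟩ := Metric.isOpen_iff.1 isOpen_interior x hint
    have hne : center a ≠ x := fun h => mirrorSide_center_ne_zero m (h ▸ h0)
    obtain ⟨γ, -, h1, h2, h3⟩ := exists_geodesic (center a) x
    set d := dist (center a) x
    have hd : 0 < d := dist_pos.2 hne
    set t := max 0 (d - r / 2)
    have ht : t ∈ Icc 0 d := ⟨le_max_left _ _, max_le hd.le (by linarith)⟩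
    have htd : t < d := max_lt hd (by linarith)
    have hdist : dist x (γ t) < r := by
      rw [← h1, h2 d ⟨hd.le, le_rfl⟩ t ht, abs_of_pos (by linarith)]
      linarith [le_max_right 0 (d - r / 2)]
    obtain ⟨α, β, -, -, hα, h⟩ := h3 t ht
    have hfix := (mirrorRefl_smul_eq_self_iff m x).2 h0
    have hmem : mirrorRefl m • γ t ∈ region a σ := by
      refine interior_subset (hb ?_)
      rw [Metric.mem_ball, dist_comm, ← hfix, dist_smul]
      exact hdist
    have h5 := hmem m hm
    rw [mirrorSide_mirrorRefl, mirrorSide_combination h, h0] at h5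
    have := mul_pos (hα hne htd) (pow_pos (abs_pos.2 (mirrorSide_center_ne_zero (a := a) m)) 2)
    rw [sq_abs] at this
    nlinarith

lemma infEDist_frontier (x : region a (baseCopy n)) :
    Metric.infEDist (x : ℍ) (frontier (region a (baseCopy n))) =
      Metric.infEDist (cover a n x) (boundary (TreeSpace a n)) := by
  rw [← infEDist_preimage (isGeodesicSpace_region _) isGeodesicSpace isCoveringMap_cover
    isLocalIsometry_cover, ← Metric.infEDist_image isometry_subtype_coe]
  congr 1
  ext y
  rw [mem_frontier_region_iff]
  constructor
  · rintro ⟨h, h'⟩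
    exact ⟨⟨y, h⟩, (proj_mem_boundary_iff h).2 h', rfl⟩
  · rintro ⟨y, hy, rfl⟩
    exact ⟨y.2, (proj_mem_boundary_iff y.2).1 hy⟩

lemma cover_surjective : Function.Surjective (cover a n) := fun q =>
  let ⟨y, hy, h, _⟩ := exists_lift (center_mem_chamber (boundaryMirrors a (baseCopy n))) q
  ⟨⟨y, hy⟩, h⟩

lemma inradius_region :
    inradius (region a (baseCopy n)) = surfaceInradius (treeSurface a n) := by
  rw [inradius, surfaceInradius, iSup_subtype']
  simp only [infEDist_frontier]
  exact cover_surjective.iSup_comp fun q => Metric.infEDist q (boundary (TreeSpace a n))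

/-- The inradius of the region is attained. -/
lemma exists_eq_inradius (a : ℝ) [Fact (1 < a)] (n : ℕ) : ∃ x ∈ region a (baseCopy n),
    Metric.infEDist x (frontier (region a (baseCopy n))) = inradius (region a (baseCopy n)) ∧
      inradius (region a (baseCopy n)) ≠ ⊤ := by
  obtain ⟨q, -, hq⟩ := isCompact_univ.exists_isMaxOn (univ_nonempty (α := TreeSpace a n))
    (Metric.continuous_infEDist (s := boundary (TreeSpace a n))).continuousOn
  have h : inradius (region a (baseCopy n)) = Metric.infEDist q (boundary (TreeSpace a n)) := by
    rw [inradius_region]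
    exact le_antisymm (iSup_le fun x => hq (mem_univ x)) (le_iSup (fun x => Metric.infEDist x
      (boundary (TreeSpace a n))) q)
  obtain ⟨x, rfl⟩ := cover_surjective q
  exact ⟨x, x.2, by rw [h, infEDist_frontier], by
    rw [h]; exact Metric.infEDist_ne_top boundary_nonempty⟩

omit ha in
/-- Galleries in the region of `X_n` pass through the same copies of the hexagon in `X_{n+1}`. -/
lemma reach_word {g : HexGroup a} (h : Reach (baseCopy n) g) :
    (g⁻¹ • baseCopy (n + 1)).word.1 = (g⁻¹ • baseCopy n).word.1 := by
  induction h with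
  | one => rw [inv_one, one_smul, one_smul]; rfl
  | @step g i _ hne ih =>
    rw [mul_inv_rev, gen_inv, mul_smul, mul_smul]
    rcases i with i | j
    · rw [cuff_smul_copy] at hne
      rw [cuff_smul_copy, cuff_smul_copy]
      change crossList (n + 1) i _ = crossList n i _
      rw [ih]
      set w := (g⁻¹ • baseCopy n).word
      rcases chain_or_head (i := i) w.2.2 with hc | ⟨v, hv⟩
      · have hlt : w.1.length < n := by
          refine lt_of_le_of_ne w.2.1 fun heq => hne ?_
          exact Copy.ext (cross_eq_self_iff.2 ⟨heq, hc⟩) rfl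
        rw [crossList_of_chain hc, crossList_of_chain hc, if_pos hlt, if_pos (by omega)]
      · rw [hv, crossList_of_head, crossList_of_head]
    · rw [seam_smul_copy, seam_smul_copy]
      exact ih

/-- The boundary of `X_{n+1}` does not meet the copies of the hexagon that form `X_n`. -/
lemma mirrorSide_succ_ne_zero {x : ℍ} (hx : x ∈ region a (baseCopy n))
    {m : HexGroup a × Wall} (hm : m ∈ boundaryMirrors a (baseCopy (n + 1))) :
    mirrorSide m x ≠ 0 := by
  intro h
  rw [← mirrorRefl_smul_eq_self_iff] at h
  obtain ⟨g, hg, hr⟩ := exists_reach hx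
  have hlen : (g⁻¹ • baseCopy (n + 1)).word.1.length ≠ n + 1 := by
    rw [reach_word hr]
    have := (g⁻¹ • baseCopy n).word.2.1
    omega
  have hfix : (g⁻¹ * mirrorRefl m * g) • g⁻¹ • x = g⁻¹ • x := by
    rw [mul_smul, mul_smul, smul_inv_smul, h]
  have hσ : (g⁻¹ * mirrorRefl m * g) • g⁻¹ • baseCopy (n + 1) = g⁻¹ • baseCopy (n + 1) := by
    rw [mul_smul, mul_smul, smul_inv_smul, show mirrorRefl m • baseCopy (n + 1) = _ from hm]
  rcases mem_wallGroup_cases (smul_eq_self_of_mem_hexagon hg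
    (w := g⁻¹ * mirrorRefl m * g) (by rwa [hfix])).2 with h1 | ⟨i, -, h1⟩ | ⟨j, -, h1⟩ |
      ⟨i, j, -, -, h1⟩
  · apply mirrorRefl_ne_one m
    have : mirrorRefl m = g * (g⁻¹ * mirrorRefl m * g) * g⁻¹ := by group
    rw [this, h1]; group
  · rw [h1] at hσ
    exact hlen (cuff_smul_copy_eq_self_iff.1 hσ).1
  · rw [h1] at hσ
    exact seam_smul_copy_ne j _ hσ
  · rw [h1] at hσ
    exact not_fixes_of_seam i j _ hσ

lemma region_subset_succ : region a (baseCopy n) ⊆ region a (baseCopy (n + 1)) := by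
  intro x hx m hm
  by_contra hcon
  obtain ⟨v, -, hv⟩ := exists_mirror_vec m
  obtain ⟨w, hw0, hw⟩ := exists_mirrorSide_eq_zero (not_le.1 hcon).le
  have hne : center a ≠ x := by
    rintro h
    rw [← h] at hcon
    exact hcon (mul_self_nonneg _)
  refine mirrorSide_succ_ne_zero (n := n) ?_ hm hw0
  have key := toVec_of_between (y := w) rfl rfl hw.symm
  have hs := Real.sinh_pos_iff.2 (show 0 < dist (center a) w + dist w x by
    rw [hw]; exact dist_pos.2 hne)
  refine mem_chamber_of_combination (x := center a) (y := x)
    (α := Real.sinh (dist w x) / Real.sinh (dist (center a) w + dist w x))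
    (β := Real.sinh (dist (center a) w) / Real.sinh (dist (center a) w + dist w x))
    (div_nonneg (Real.sinh_nonneg_iff.2 dist_nonneg) hs.le)
    (div_nonneg (Real.sinh_nonneg_iff.2 dist_nonneg) hs.le) ?_ (center_mem_chamber _) hx
  have := congrArg (fun u => (Real.sinh (dist (center a) w + dist w x))⁻¹ • u) key
  simp only [smul_add, smul_smul, inv_mul_cancel₀ hs.ne', one_smul] at this
  rw [this, div_eq_inv_mul, div_eq_inv_mul]

/-- Two boundary mirrors of regions of different surfaces define the same reflection if they pass
through the same point. -/
lemma mirrorRefl_eq_of_boundary {N : ℕ} {σ : Copy n} {τ : Copy N} {m m' : HexGroup a × Wall}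
    (hm : m ∈ boundaryMirrors a σ) (hm' : m' ∈ boundaryMirrors a τ) {z : ℍ}
    (h : mirrorRefl m • z = z) (h' : mirrorRefl m' • z = z) : mirrorRefl m = mirrorRefl m' := by
  obtain ⟨k, hk⟩ := exists_smul_mem_hexagon (a := a) z
  have key : ∀ {M : ℕ} {υ : Copy M} {l : HexGroup a × Wall}, l ∈ boundaryMirrors a υ →
      mirrorRefl l • z = z → ∃ i, wallSide a (.inl i) (k • z) = 0 ∧
        mirrorRefl l = k⁻¹ * gen a (.inl i) * k := by
    intro M υ l hl hfix
    have h1 : (k * mirrorRefl l * k⁻¹) • k • z = k • z := by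
      rw [mul_smul, mul_smul, inv_smul_smul, hfix]
    have h2 : (k * mirrorRefl l * k⁻¹) • k • υ = k • υ := by
      rw [mul_smul, mul_smul, inv_smul_smul, show mirrorRefl l • υ = υ from hl]
    have h3 : mirrorRefl l = k⁻¹ * (k * mirrorRefl l * k⁻¹) * k := by group
    rcases mem_wallGroup_cases (smul_eq_self_of_mem_hexagon hk
      (w := k * mirrorRefl l * k⁻¹) (by rwa [h1])).2 with h4 | ⟨i, hi, h4⟩ | ⟨j, -, h4⟩ |
        ⟨i, j, -, -, h4⟩
    · rw [h4] at h3
      exact absurd (h3.trans (by group)) (mirrorRefl_ne_one l)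
    · exact ⟨i, hi, by rw [h3, h4]⟩
    · exact absurd (h4 ▸ h2) (seam_smul_copy_ne j _)
    · exact absurd (h4 ▸ h2) (not_fixes_of_seam i j _)
  obtain ⟨i, hi, e⟩ := key hm h
  obtain ⟨j, hj, e'⟩ := key hm' h'
  rw [e, e', cuff_unique hi hj]

/-- The distance between the frontiers of consecutive regions is bounded below. -/
lemma rad_le_dist_frontier {w y : ℍ} (hw : w ∈ frontier (region a (baseCopy n)))
    (hy : y ∈ frontier (region a (baseCopy (n + 1)))) : rad a ≤ dist w y := by
  by_contra hcon
  rw [not_le] at hcon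
  obtain ⟨hwr, m, hm, hm0⟩ := mem_frontier_region_iff.1 hw
  obtain ⟨-, m', hm', hm0'⟩ := mem_frontier_region_iff.1 hy
  obtain ⟨z, hz⟩ := exists_common_fixed_point (a := a) w
  have h1 := (mirrorRefl_smul_eq_self_iff m w).2 hm0
  have h2 := (mirrorRefl_smul_eq_self_iff m' y).2 hm0'
  have hr := rad_pos (a := a)
  have hwb : w ∈ Metric.ball w (3 * rad a) := Metric.mem_ball_self (by linarith)
  have hyb : y ∈ Metric.ball w (3 * rad a) := by rw [Metric.mem_ball, dist_comm]; linarith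
  have := mirrorRefl_eq_of_boundary hm hm' (hz _ w hwb (by rwa [h1])) (hz _ y hyb (by rwa [h2]))
  rw [this] at h1
  exact mirrorSide_succ_ne_zero hwr hm' ((mirrorRefl_smul_eq_self_iff m' w).1 h1)

lemma inradius_add_rad_le :
    inradius (region a (baseCopy n)) + ENNReal.ofReal (rad a) ≤
      inradius (region a (baseCopy (n + 1))) := by
  obtain ⟨x, hx, hinr, -⟩ := exists_eq_inradius a n
  refine le_trans ?_ (le_iSup₂ (f := fun x (_ : x ∈ region a (baseCopy (n + 1))) =>
    Metric.infEDist x (frontier (region a (baseCopy (n + 1))))) x (region_subset_succ hx))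
  refine Metric.le_infEDist.2 fun y hy => ?_
  obtain ⟨-, m', hm', hm0'⟩ := mem_frontier_region_iff.1 hy
  have hyn : y ∉ region a (baseCopy n) := fun h => mirrorSide_succ_ne_zero h hm' hm0'
  obtain ⟨γ, h0, h1, h2, -⟩ := exists_geodesic x y
  set d := dist x y with hd
  have hcont : ContinuousOn γ (Icc 0 d) :=
    LipschitzOnWith.continuousOn (K := 1) (LipschitzOnWith.of_dist_le_mul fun s hs t ht => by
      rw [h2 s hs t ht, NNReal.coe_one, one_mul, Real.dist_eq])
  have m0 : (0 : ℝ) ∈ Icc 0 d := ⟨le_rfl, dist_nonneg⟩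
  have m1 : d ∈ Icc 0 d := ⟨dist_nonneg, le_rfl⟩
  obtain ⟨t, ht, hfr⟩ : ∃ t ∈ Icc 0 d, γ t ∈ frontier (region a (baseCopy n)) := by
    by_contra hcon
    push Not at hcon
    have hpre : IsPreconnected (γ '' Icc 0 d) := isPreconnected_Icc.image _ hcont
    have hcl : IsClosed (region a (baseCopy n)) := isClosed_chamber _
    have hsub := hpre.subset_left_of_subset_union (u := interior (region a (baseCopy n)))
      (v := (region a (baseCopy n))ᶜ) isOpen_interior hcl.isOpen_compl
      (disjoint_compl_right.mono_left interior_subset) (by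
        rintro _ ⟨t, ht, rfl⟩
        by_cases h : γ t ∈ region a (baseCopy n)
        · left
          have := hcon t ht
          rw [hcl.frontier_eq, Set.mem_sdiff] at this
          exact not_not.1 fun h' => this ⟨h, h'⟩
        · exact .inr h) ⟨x, (⟨0, m0, h0⟩ : x ∈ γ '' Icc 0 d), by
          have := hcon 0 m0
          rw [h0, hcl.frontier_eq, Set.mem_sdiff] at this
          exact not_not.1 fun h' => this ⟨hx, h'⟩⟩
    exact hyn (interior_subset (hsub (show y ∈ γ '' Icc 0 d from ⟨d, m1, h1⟩)))
  have e1 := h2 0 m0 t ht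
  have e2 := h2 t ht d m1
  rw [h0, zero_sub, abs_neg, abs_of_nonneg ht.1] at e1
  rw [h1, abs_sub_comm, abs_of_nonneg (by linarith [ht.2])] at e2
  have e3 : edist x y = edist x (γ t) + edist (γ t) y := by
    rw [edist_dist, edist_dist, edist_dist, ← ENNReal.ofReal_add dist_nonneg dist_nonneg, e1, e2,
      ← hd]
    congr 1; ring
  rw [e3]
  refine add_le_add ?_ ?_
  · rw [← hinr]; exact Metric.infEDist_le_edist_of_mem hfr
  · rw [edist_dist]; exact ENNReal.ofReal_le_ofReal (rad_le_dist_frontier hfr hy)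

theorem strictMono_inradius (a : ℝ) [Fact (1 < a)] :
    StrictMono fun n => inradius (region a (baseCopy n)) := by
  refine strictMono_nat_of_lt_succ fun n => lt_of_lt_of_le ?_ inradius_add_rad_le
  obtain ⟨-, -, -, h⟩ := exists_eq_inradius a n
  exact ENNReal.lt_add_right h (by simpa using rad_pos (a := a))

lemma surfaceInradius_injective (a : ℝ) [Fact (1 < a)] :
    Function.Injective fun n => surfaceInradius (treeSurface a n) := by
  have := (strictMono_inradius a).injective
  simpa only [inradius_region] using this

theorem not_commensurable {m n : ℕ} (h : m ≠ n) :
    ¬ Commensurable (treeSurface a m) (treeSurface a n) := fun hc =>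
  h (surfaceInradius_injective a (surfaceInradius_eq_of_commensurable hc))

theorem infinite_commensurabilityClass (a : ℝ) [Fact (1 < a)]
    (h : ∀ n, IsOI (treeSurface a n)) : Infinite OICommensurabilityClass := by
  let inv : OICommensurabilityClass → ℝ≥0∞ := Quot.lift (fun X => surfaceInradius X.1)
    fun _ _ => surfaceInradius_eq_of_commensurable
  refine Infinite.of_injective (fun n : ℕ => (Quot.mk _ ⟨treeSurface a n, h n⟩ :
    OICommensurabilityClass)) fun m n hmn => ?_
  exact surfaceInradius_injective a (congrArg inv hmn)

end Inradius

/-! ### Lifts of local geodesics -/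

section LocalGeodesic

lemma hyperbolic_coeff_unique {A B A' B' : Vec} {s t : ℝ} (hst : s ≠ t)
    (h1 : Real.cosh s • A + Real.sinh s • B = Real.cosh s • A' + Real.sinh s • B')
    (h2 : Real.cosh t • A + Real.sinh t • B = Real.cosh t • A' + Real.sinh t • B') :
    A = A' ∧ B = B' := by
  have hd : Real.sinh (t - s) ≠ 0 := fun h => hst (by linarith [Real.sinh_eq_zero.1 h])
  have key : ∀ x y x' y' : ℝ, Real.cosh s * x + Real.sinh s * y =
      Real.cosh s * x' + Real.sinh s * y' → Real.cosh t * x + Real.sinh t * y =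
      Real.cosh t * x' + Real.sinh t * y' → x = x' ∧ y = y' := by
    intro x y x' y' e1 e2
    rw [Real.sinh_sub] at hd
    constructor
    · refine mul_left_cancel₀ hd ?_
      linear_combination Real.sinh t * e1 - Real.sinh s * e2
    · refine mul_left_cancel₀ hd ?_
      linear_combination Real.cosh s * e2 - Real.cosh t * e1
  obtain ⟨a1, a2, a3⟩ := A
  obtain ⟨b1, b2, b3⟩ := B
  obtain ⟨a1', a2', a3'⟩ := A'
  obtain ⟨b1', b2', b3'⟩ := B'
  simp only [Prod.smul_mk, Prod.mk_add_mk, smul_eq_mul, Prod.mk.injEq] at h1 h2 ⊢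
  obtain ⟨k1, k1'⟩ := key _ _ _ _ h1.1 h2.1
  obtain ⟨k2, k2'⟩ := key _ _ _ _ h1.2.1 h2.2.1
  obtain ⟨k3, k3'⟩ := key _ _ _ _ h1.2.2 h2.2.2
  exact ⟨⟨k1, k2, k3⟩, k1', k2', k3'⟩

/-- A geodesic segment in the hyperboloid model. -/
lemma exists_hyperbolic_coeff {γ : ℝ → ℍ} {u v : ℝ} (huv : u < v)
    (h : ∀ s ∈ Icc u v, ∀ t ∈ Icc u v, dist (γ s) (γ t) = |s - t|) :
    ∃ A B : Vec, ∀ t ∈ Icc u v, toVec (γ t) = Real.cosh t • A + Real.sinh t • B := by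
  have hS : Real.sinh (v - u) ≠ 0 := (Real.sinh_pos_iff.2 (by linarith)).ne'
  refine ⟨(Real.sinh (v - u))⁻¹ • (Real.sinh v • toVec (γ u) - Real.sinh u • toVec (γ v)),
    (Real.sinh (v - u))⁻¹ • (Real.cosh u • toVec (γ v) - Real.cosh v • toVec (γ u)),
    fun t ht => ?_⟩
  have e1 := h u ⟨le_rfl, huv.le⟩ t ht
  have e2 := h t ht v ⟨huv.le, le_rfl⟩
  have e3 := h u ⟨le_rfl, huv.le⟩ v ⟨huv.le, le_rfl⟩
  rw [abs_sub_comm, abs_of_nonneg (by linarith [ht.1])] at e1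
  rw [abs_sub_comm, abs_of_nonneg (by linarith [ht.2])] at e2
  rw [abs_sub_comm, abs_of_nonneg (by linarith)] at e3
  have key := toVec_of_between e1 e2 (by rw [e3]; ring)
  rw [show t - u + (v - t) = v - u by ring] at key
  have key2 : toVec (γ t) = (Real.sinh (v - u))⁻¹ •
      (Real.sinh (v - t) • toVec (γ u) + Real.sinh (t - u) • toVec (γ v)) := by
    rw [← key, smul_smul, inv_mul_cancel₀ hS, one_smul]
  rw [key2, Real.sinh_sub v t, Real.sinh_sub t u]
  module

/-- A local geodesic of the hyperbolic plane is the intersection of the hyperboloid with a plane. -/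
lemma exists_hyperbolic_coeff_of_locally {γ : ℝ → ℍ} {L : ℝ} (hL : 0 < L)
    (h : ∀ t ∈ Icc 0 L, ∃ ε > 0, ∀ s ∈ Icc 0 L, ∀ s' ∈ Icc 0 L, |s - t| < ε → |s' - t| < ε →
      dist (γ s) (γ s') = |s - s'|) :
    ∃ A B : Vec, ∀ t ∈ Icc 0 L, toVec (γ t) = Real.cosh t • A + Real.sinh t • B := by
  have hloc : ∀ t : Icc 0 L, ∃ ε > 0, ∃ q : Vec × Vec, ∀ s ∈ Icc 0 L, |s - t| < ε →
      toVec (γ s) = Real.cosh s • q.1 + Real.sinh s • q.2 := by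
    rintro ⟨t, ht⟩
    obtain ⟨ε, hε, h'⟩ := h t ht
    have huv : max 0 (t - ε / 2) < min L (t + ε / 2) :=
      max_lt (lt_min hL (by linarith [ht.1])) (lt_min (by linarith [ht.2]) (by linarith))
    have hmem : ∀ s ∈ Icc (max 0 (t - ε / 2)) (min L (t + ε / 2)), s ∈ Icc 0 L ∧ |s - t| < ε := by
      rintro s ⟨h1, h2⟩
      have := le_max_left 0 (t - ε / 2)
      have := le_max_right 0 (t - ε / 2)
      have := min_le_left L (t + ε / 2)
      have := min_le_right L (t + ε / 2)
      exact ⟨⟨by linarith, by linarith⟩, abs_lt.2 ⟨by linarith, by linarith⟩⟩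
    obtain ⟨A, B, hAB⟩ := exists_hyperbolic_coeff huv fun s hs s' hs' =>
      h' s (hmem s hs).1 s' (hmem s' hs').1 (hmem s hs).2 (hmem s' hs').2
    refine ⟨ε / 2, by linarith, (A, B), fun s hs hst => hAB s ?_⟩
    rw [abs_lt] at hst
    exact ⟨max_le hs.1 (by linarith), le_min hs.2 (by linarith)⟩
  choose ε hε q hq using hloc
  have hconst : IsLocallyConstant q := by
    rw [IsLocallyConstant.iff_eventually_eq]
    intro t
    filter_upwards [Metric.ball_mem_nhds t (hε t)] with t' ht'
    have hd : |(t' : ℝ) - t| < ε t := ht'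
    obtain ⟨s, hs, hst', hs1, hs2⟩ : ∃ s ∈ Icc 0 L, s ≠ t' ∧ |s - t'| < ε t' ∧ |s - t| < ε t := by
      set δ := min (ε t') (ε t - |(t' : ℝ) - t|) with hδ
      have hδ0 : 0 < δ := lt_min (hε t') (by linarith)
      have hδ1 : δ ≤ ε t' := min_le_left _ _
      have hδ2 : δ ≤ ε t - |(t' : ℝ) - t| := min_le_right _ _
      have fin : ∀ s : ℝ, s ∈ Icc 0 L → s ≠ t' → |s - t'| < δ →
          ∃ s ∈ Icc 0 L, s ≠ t' ∧ |s - t'| < ε t' ∧ |s - t| < ε t := fun s h1 h2 h3 =>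
        ⟨s, h1, h2, by linarith, by linarith [abs_sub_le s t' t]⟩
      rcases lt_or_ge (t' : ℝ) L with hlt | hge
      · refine fin (min L (t' + δ / 2)) ⟨le_min hL.le (by linarith [t'.2.1]), min_le_left _ _⟩
          (lt_min hlt (by linarith)).ne' ?_
        rw [abs_of_pos (by linarith [lt_min hlt (show (t' : ℝ) < t' + δ / 2 by linarith)])]
        linarith [min_le_right L (t' + δ / 2)]
      · have hlt : max 0 ((t' : ℝ) - δ / 2) < t' := max_lt (by linarith) (by linarith)
        refine fin (max 0 (t' - δ / 2)) ⟨le_max_left _ _, max_le hL.le (by linarith [t'.2.2])⟩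
          hlt.ne ?_
        rw [abs_of_neg (by linarith)]
        linarith [le_max_right 0 ((t' : ℝ) - δ / 2)]
    have e1 := (hq t s hs hs2).symm.trans (hq t' s hs hs1)
    have e2 := (hq t t' t'.2 hd).symm.trans (hq t' t' t'.2 (by simpa using hε t'))
    obtain ⟨h1, h2⟩ := hyperbolic_coeff_unique hst' e1 e2
    exact (Prod.ext h1 h2).symm
  have : PreconnectedSpace (Icc 0 L) := Subtype.preconnectedSpace isPreconnected_Icc
  set t₀ : Icc 0 L := ⟨0, le_rfl, hL.le⟩
  refine ⟨(q t₀).1, (q t₀).2, fun t ht => ?_⟩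
  rw [hconst.apply_eq_of_preconnectedSpace t₀ ⟨t, ht⟩]
  exact hq ⟨t, ht⟩ t ht (by simpa using hε ⟨t, ht⟩)

end LocalGeodesic

/-! ### Perpendicularity -/

section Perpendicular

lemma cosh_dist_of_re_eq_zero (z w : ℍ) (hw : w.re = 0) :
    Real.cosh (dist z w) = (z.re ^ 2 + z.im ^ 2 + w.im ^ 2) / (2 * w.im * z.im) := by
  have := z.im_pos
  have := w.im_pos
  rw [cosh_dist_eq]
  simp only [bil, toVec, hw]
  field_simp
  ring

lemma sq_norm_eq (z : ℍ) : ‖(z : ℂ)‖ ^ 2 = z.re ^ 2 + z.im ^ 2 := by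
  rw [Complex.sq_norm, Complex.normSq_apply]
  simp only [UpperHalfPlane.coe_re, UpperHalfPlane.coe_im]; ring

/-- A curve that starts perpendicularly to the boundary stays closer to its starting point than to
any other boundary point nearby. -/
lemma StartsPerpendicularly.eventually_dist_le {X : Type*} [MetricSpace X] {γ : ℝ → X}
    (h : StartsPerpendicularly γ) (hγ : ContinuousWithinAt γ (Ici 0) 0) :
    γ 0 ∈ boundary X ∧ ∃ U, IsOpen U ∧ γ 0 ∈ U ∧ ∀ᶠ t in 𝓝[≥] (0 : ℝ),
      ∀ q ∈ U ∩ boundary X, dist (γ t) (γ 0) ≤ dist (γ t) q := by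
  obtain ⟨U, φ, hφ, h0, hre, hev⟩ := h
  refine ⟨⟨U, φ, hφ, h0, hre⟩, U, hφ.1, h0, ?_⟩
  filter_upwards [hev, hγ (hφ.1.mem_nhds h0)] with t ht htU q hq
  have hqre := chart_re_eq_zero_of_mem_boundary hφ hq.1 hq.2
  rw [← hφ.2.1 _ htU _ h0, ← hφ.2.1 _ htU _ hq.1]
  have hN : (φ (γ t)).re ^ 2 + (φ (γ t)).im ^ 2 = (φ (γ 0)).im ^ 2 := by
    rw [← sq_norm_eq, ht, sq_norm_eq, hre]; ring
  rw [← abs_of_nonneg (dist_nonneg (x := φ (γ t)) (y := φ (γ 0))),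
    ← abs_of_nonneg (dist_nonneg (x := φ (γ t)) (y := φ q)), ← Real.cosh_le_cosh,
    cosh_dist_of_re_eq_zero _ _ hre, cosh_dist_of_re_eq_zero _ _ hqre, hN]
  have h1 := (φ (γ t)).im_pos
  have h2 := (φ (γ 0)).im_pos
  have h3 := (φ q).im_pos
  rw [div_le_div_iff₀ (by positivity) (by positivity)]
  have : 0 ≤ 2 * (φ (γ 0)).im * (φ (γ t)).im * ((φ (γ 0)).im - (φ q).im) ^ 2 := by positivity
  nlinarith

/-- If `x` is a point on a geodesic that is closer to `z` than all other points of the geodesic near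
`x`, then the distance from `z` to `x` is the distance from `z` to the geodesic. -/
lemma sq_side_eq_sq_sinh {v : Vec} (hv : bil v v = 1) {x z : ℍ} (hx : side v x = 0) {r : ℝ}
    (hr : 0 < r) (h : ∀ w ∈ Metric.ball x r, side v w = 0 → dist z x ≤ dist z w) :
    side v z ^ 2 = Real.sinh (dist z x) ^ 2 := by
  obtain ⟨g, hgx, hg⟩ := exists_sl_position hv hx
  set ζ := g • z with hζ
  have hd : ∀ w : ℍ, dist z (g⁻¹ • w) = dist ζ w := fun w => by
    rw [hζ, ← dist_smul g z, smul_inv_smul]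
  have hzx : dist z x = dist ζ UpperHalfPlane.I := by
    rw [← hd, ← hgx, inv_smul_smul]
  have hη := ζ.im_pos
  set N := ζ.re ^ 2 + ζ.im ^ 2 with hN
  have hN0 : 0 < N := by rw [hN]; positivity
  have hcont : ContinuousAt (fun y : ℝ => dist UpperHalfPlane.I
      (UpperHalfPlane.mk ⟨0, max y (1 / 2)⟩ (by simp : (0 : ℝ) < max y (1 / 2)))) 1 := by
    refine continuousAt_const.dist (Continuous.continuousAt ?_)
    rw [UpperHalfPlane.isEmbedding_coe.continuous_iff]
    change Continuous fun y : ℝ => (⟨0, max y (1 / 2)⟩ : ℂ)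
    have : (fun y : ℝ => (⟨0, max y (1 / 2)⟩ : ℂ)) =
        fun y : ℝ => ((max y (1 / 2) : ℝ) : ℂ) * Complex.I := by
      ext y; apply Complex.ext <;> simp
    rw [this]; fun_prop
  have hev : ∀ᶠ y : ℝ in 𝓝 1, 0 ≤ (y - 1) * (y - N) := by
    have h1 : dist UpperHalfPlane.I (UpperHalfPlane.mk ⟨0, max (1 : ℝ) (1 / 2)⟩
        (by simp : (0 : ℝ) < max 1 (1 / 2))) < r := by
      have : UpperHalfPlane.mk ⟨0, max (1 : ℝ) (1 / 2)⟩ (by simp : (0 : ℝ) < max 1 (1 / 2)) =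
          UpperHalfPlane.I := by
        refine UpperHalfPlane.ext (Complex.ext ?_ ?_)
        · simp
        · simp; norm_num
      rw [this, dist_self]; exact hr
    filter_upwards [hcont.eventually (gt_mem_nhds h1),
      lt_mem_nhds (show (1 / 2 : ℝ) < 1 by norm_num)]
      with y hy hy2
    simp only [max_eq_left hy2.le] at hy
    set w : ℍ := UpperHalfPlane.mk ⟨0, y⟩ (by change (0 : ℝ) < y; linarith)
    have hwre : w.re = 0 := rfl
    have hwim : w.im = y := rfl
    have h2 := h (g⁻¹ • w) (by
      rw [Metric.mem_ball, ← dist_smul g, smul_inv_smul, hgx, dist_comm]; exact hy) (by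
      rw [hg, smul_inv_smul, hwre, zero_div])
    rw [hd, hzx] at h2
    rw [← abs_of_nonneg (dist_nonneg (x := ζ) (y := UpperHalfPlane.I)),
      ← abs_of_nonneg (dist_nonneg (x := ζ) (y := w)), ← Real.cosh_le_cosh,
      cosh_dist_of_re_eq_zero _ _ UpperHalfPlane.I_re, cosh_dist_of_re_eq_zero _ _ hwre, hwim,
      UpperHalfPlane.I_im, ← hN, div_le_div_iff₀ (by positivity) (by positivity)] at h2
    have h3 : 0 ≤ (2 * ζ.im) * ((y - 1) * (y - N)) := by nlinarith
    exact nonneg_of_mul_nonneg_right h3 (by positivity)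
  have hN1 : N = 1 := by
    obtain ⟨δ, hδ, hb⟩ := Metric.eventually_nhds_iff_ball.1 hev
    rcases lt_trichotomy N 1 with hlt | heq | hgt
    · have hy := hb (max ((1 + N) / 2) (1 - δ / 2)) (by
        rw [Metric.mem_ball, Real.dist_eq, abs_of_neg (by
          have : max ((1 + N) / 2) (1 - δ / 2) < 1 := max_lt (by linarith) (by linarith)
          linarith)]
        linarith [le_max_right ((1 + N) / 2) (1 - δ / 2)])
      have h1 : max ((1 + N) / 2) (1 - δ / 2) < 1 := max_lt (by linarith) (by linarith)
      have h2 := le_max_left ((1 + N) / 2) (1 - δ / 2)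
      nlinarith
    · exact heq
    · have hy := hb (min ((1 + N) / 2) (1 + δ / 2)) (by
        rw [Metric.mem_ball, Real.dist_eq, abs_of_pos (by
          have : 1 < min ((1 + N) / 2) (1 + δ / 2) := lt_min (by linarith) (by linarith)
          linarith)]
        linarith [min_le_right ((1 + N) / 2) (1 + δ / 2)])
      have h1 : 1 < min ((1 + N) / 2) (1 + δ / 2) := lt_min (by linarith) (by linarith)
      have h2 := min_le_left ((1 + N) / 2) (1 + δ / 2)
      nlinarith
  have hc : Real.cosh (dist ζ UpperHalfPlane.I) = 1 / ζ.im := by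
    rw [cosh_dist_of_re_eq_zero _ _ UpperHalfPlane.I_re, UpperHalfPlane.I_im, ← hN, hN1]
    field_simp; norm_num
  rw [hg, ← hζ, hzx, Real.sinh_sq, hc]
  field_simp
  linarith

variable {a : ℝ} [ha : Fact (1 < a)] {n : ℕ}

/-- The lift of a geodesic that is perpendicular to the boundary is perpendicular to a boundary
mirror. -/
lemma exists_mirror_of_startsPerpendicularly {γ : ℝ → TreeSpace a n}
    {c : ℝ → region a (baseCopy n)} {L : ℝ} (hL : 0 < L) (hp : StartsPerpendicularly γ)
    (hlift : ∀ t ∈ Icc 0 L, cover a n (c t) = γ t)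
    (hgeo : ∃ ε > 0, ∀ s ∈ Icc 0 L, ∀ s' ∈ Icc 0 L, |s| < ε → |s'| < ε →
      dist (γ s) (γ s') = |s - s'| ∧ dist (c s) (c s') = |s - s'|) {A B : Vec}
    (hAB : ∀ t ∈ Icc 0 L, toVec (c t) = Real.cosh t • A + Real.sinh t • B) :
    bil A B = 0 ∧ bil B B = 1 ∧ ∃ m ∈ boundaryMirrors a (baseCopy n),
      ∀ v, bil v v = 1 → (∀ x, mirrorSide m x = side v x) → B = v ∨ B = -v := by
  obtain ⟨ε, hε, hgeo⟩ := hgeo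
  have m0 : (0 : ℝ) ∈ Icc 0 L := ⟨le_rfl, hL.le⟩
  have hA : toVec (c 0) = A := by
    rw [hAB 0 m0, Real.cosh_zero, Real.sinh_zero, one_smul, zero_smul, add_zero]
  have hAA : bil A A = -1 := by rw [← hA, bil_toVec_self]
  have hcont : ContinuousWithinAt γ (Ici 0) 0 := by
    rw [Metric.continuousWithinAt_iff]
    intro δ hδ
    refine ⟨min δ (min ε L), lt_min hδ (lt_min hε hL), fun t ht htd => ?_⟩
    rw [Real.dist_eq, sub_zero, lt_min_iff, lt_min_iff] at htd
    have ht0 : 0 ≤ t := ht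
    rw [(hgeo t ⟨ht0, (abs_of_nonneg ht0 ▸ htd.2.2).le⟩ 0 m0 htd.2.1 (by simpa using hε)).1,
      sub_zero]
    exact htd.1
  obtain ⟨hb, U, hU, h0U, hev⟩ := hp.eventually_dist_le hcont
  rw [← hlift 0 m0] at hb
  obtain ⟨m, hm, hm0⟩ := (proj_mem_boundary_iff (c 0).2).1 hb
  -- a small positive time at which all local statements apply
  obtain ⟨t, ht, htε, htL, hclose⟩ : ∃ t : ℝ, 0 < t ∧ t < ε ∧ t ≤ L ∧
      ∀ q ∈ U ∩ boundary (TreeSpace a n), dist (γ t) (γ 0) ≤ dist (γ t) q := by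
    obtain ⟨δ, hδ, hb⟩ := Metric.mem_nhdsWithin_iff.1 hev
    set t := min (δ / 2) (min (ε / 2) L)
    have ht : 0 < t := lt_min (by linarith) (lt_min (by linarith) hL)
    have h1 : t ≤ δ / 2 := min_le_left _ _
    have h2 : t ≤ ε / 2 := (min_le_right _ _).trans (min_le_left _ _)
    have h3 : t ≤ L := (min_le_right _ _).trans (min_le_right _ _)
    exact ⟨t, ht, by linarith, h3, hb ⟨by
      rw [Metric.mem_ball, Real.dist_eq, sub_zero, abs_of_pos ht]; linarith, ht.le⟩⟩
  have mt : t ∈ Icc 0 L := ⟨ht.le, htL⟩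
  have hs : Real.sinh t ≠ 0 := (Real.sinh_pos_iff.2 ht).ne'
  have hγt := hgeo t mt 0 m0 (by rwa [abs_of_pos ht]) (by simpa using hε)
  rw [sub_zero, abs_of_pos ht] at hγt
  have hct : dist ((c t : ℍ)) (c 0) = t := hγt.2
  have e1 : bil A B = 0 := by
    have h1 := cosh_dist_eq (c t) (c 0)
    rw [hct, hA, hAB t mt, bil_add_left, bil_smul_left, bil_smul_left, hAA, bil_comm B] at h1
    have : Real.sinh t * bil A B = 0 := by linarith
    exact (mul_eq_zero.1 this).resolve_left hs
  have e2 : bil B B = 1 := by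
    have h1 := bil_toVec_self (c t)
    rw [hAB t mt, bil_add_left, bil_add_right, bil_add_right] at h1
    simp only [bil_smul_left, bil_smul_right, hAA, bil_comm B A, e1] at h1
    have h2 := Real.cosh_sq t
    have : Real.sinh t ^ 2 * (bil B B - 1) = 0 := by nlinarith
    have := (mul_eq_zero.1 this).resolve_left (pow_ne_zero 2 hs)
    linarith
  refine ⟨e1, e2, m, hm, fun v hv hmv => ?_⟩
  have hv0 : side v (c 0) = 0 := by rw [← hmv, hm0]
  have hvA : bil v A = 0 := by rw [side, hA] at hv0; linarith
  obtain ⟨r, hr, hrU⟩ := Metric.isOpen_iff.1 hU (γ 0) h0U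
  have hsq := sq_side_eq_sq_sinh hv (x := c 0) (z := c t) hv0 (lt_min hr (rad_pos (a := a)))
    fun w hw hvw => by
      have hwr : w ∈ region a (baseCopy n) :=
        (mem_region_iff_of_mirror (c 0).2 hm hm0
          (Metric.ball_subset_ball (min_le_right _ _) hw)).2 (by rw [hmv w, hvw, mul_zero])
      have hwb : proj a (baseCopy n) w ∈ boundary (TreeSpace a n) :=
        (proj_mem_boundary_iff hwr).2 ⟨m, hm, by rw [hmv, hvw]⟩
      have hwU : proj a (baseCopy n) w ∈ U := by
        refine hrU (Metric.mem_ball.2 ?_)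
        rw [← hlift 0 m0]
        exact lt_of_le_of_lt (lipschitz_proj _ _ _) (lt_of_lt_of_le hw (min_le_left _ _))
      have h1 := hclose _ ⟨hwU, hwb⟩
      rw [hγt.1, ← hlift t mt] at h1
      rw [hct]
      exact h1.trans (lipschitz_proj _ _ _)
  rw [hct, side, hAB t mt, bil_add_right, bil_smul_right, bil_smul_right, hvA] at hsq
  have h1 : Real.sinh t ^ 2 * (bil v B ^ 2 - 1) = 0 := by nlinarith
  have h2 : bil v B ^ 2 = 1 := by
    have := (mul_eq_zero.1 h1).resolve_left (pow_ne_zero 2 hs); linarith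
  have key : ∀ u : Vec, bil u u = 1 → bil u A = 0 → bil u B = 1 → B = u := by
    intro u hu huA huB
    have h3 : side (B - u) (c 0) = 0 := by
      rw [side, hA, bil_sub_left, bil_comm B A, e1, huA]; simp
    have h4 : bil (B - u) (B - u) ≤ 0 := by
      simp only [bil_sub_left, bil_sub_right, e2, hu, huB, bil_comm B u]; norm_num
    exact sub_eq_zero.1 (eq_zero_of_side_eq_zero h3 h4)
  rcases sq_eq_one_iff.1 h2 with h3 | h3
  · exact .inl (key v hv hvA h3)
  · exact .inr (key (-v) (by rw [bil_neg_left, bil_neg_right, neg_neg, hv])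
      (by rw [bil_neg_left, hvA, neg_zero]) (by rw [bil_neg_left, h3, neg_neg]))

end Perpendicular

/-! ### Orthogeodesics and the lattice of boundary normals -/

section OrthoIntegrality

lemma bil_cuff_cuff {a : ℝ} (ha : 1 < a) {i j : Fin 3} (hij : i ≠ j) :
    bil (wallVec a (.inl i)) (wallVec a (.inl j)) = -a := by
  have h2 := hexT_sq ha
  have h3 : 0 < hexK a := by linarith [one_lt_hexK ha]
  have h4 := hexK_eq ha
  have g : bil (wallVec a (.inl 1)) (wallVec a (.inl 2)) = -a := by
    simp only [bil, wallVec, Matrix.cons_val]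
    have : (a * a + (-hexT a * (hexT a / hexK a) + hexT a * -(hexT a * hexK a)) / 2) *
        (2 * hexK a) = -a * (2 * hexK a) := by
      field_simp
      rw [h2]
      linear_combination (-(a + 1)) * h4
    exact mul_right_cancel₀ (by positivity) this
  fin_cases i <;> fin_cases j <;>
    first
    | exact absurd rfl hij
    | exact g
    | exact (bil_comm _ _).trans g
    | simp [bil, wallVec]

/-- The form is nondegenerate: three vectors with nonzero Gram determinant span Lorentz space. -/
lemma eq_zero_of_bil_eq_zero {a : ℝ} (ha : 1 < a) {u v s w : Vec} (huu : bil u u = 1)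
    (hvv : bil v v = 1) (hss : bil s s = 1) (huv : bil u v = -a) (hus : bil u s = 0)
    (hvs : bil v s = 0) (hwu : bil w u = 0) (hwv : bil w v = 0) (hws : bil w s = 0) : w = 0 := by
  obtain ⟨u1, u2, u3⟩ := u
  obtain ⟨v1, v2, v3⟩ := v
  obtain ⟨s1, s2, s3⟩ := s
  obtain ⟨w1, w2, w3⟩ := w
  set D := u1 * (v2 * s3 - v3 * s2) - u2 * (v1 * s3 - v3 * s1) + u3 * (v1 * s2 - v2 * s1) with hD
  have hgram : -D ^ 2 / 4 =
      bil (u1, u2, u3) (u1, u2, u3) * (bil (v1, v2, v3) (v1, v2, v3) *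
        bil (s1, s2, s3) (s1, s2, s3) - bil (v1, v2, v3) (s1, s2, s3) ^ 2) -
      bil (u1, u2, u3) (v1, v2, v3) * (bil (u1, u2, u3) (v1, v2, v3) *
        bil (s1, s2, s3) (s1, s2, s3) - bil (v1, v2, v3) (s1, s2, s3) *
        bil (u1, u2, u3) (s1, s2, s3)) +
      bil (u1, u2, u3) (s1, s2, s3) * (bil (u1, u2, u3) (v1, v2, v3) *
        bil (v1, v2, v3) (s1, s2, s3) - bil (v1, v2, v3) (v1, v2, v3) *
        bil (u1, u2, u3) (s1, s2, s3)) := by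
    simp only [bil, hD]; ring
  rw [huu, hvv, hss, huv, hus, hvs] at hgram
  have hD0 : D ≠ 0 := by
    intro h
    rw [h] at hgram
    nlinarith
  simp only [bil] at hwu hwv hws
  have e1 : D * w1 = 0 := by
    rw [hD]
    linear_combination (v2 * s3 - v3 * s2) * hwu - (u2 * s3 - u3 * s2) * hwv +
      (u2 * v3 - u3 * v2) * hws
  have e2 : D * w2 = 0 := by
    rw [hD]
    linear_combination 2 * ((v1 * s2 - v2 * s1) * hwu - (u1 * s2 - u2 * s1) * hwv +
      (u1 * v2 - u2 * v1) * hws)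
  have e3 : D * w3 = 0 := by
    rw [hD]
    linear_combination (-2) * ((v1 * s3 - v3 * s1) * hwu - (u1 * s3 - u3 * s1) * hwv +
      (u1 * v3 - u3 * v1) * hws)
  rw [(mul_eq_zero.1 e1).resolve_left hD0, (mul_eq_zero.1 e2).resolve_left hD0,
    (mul_eq_zero.1 e3).resolve_left hD0]
  rfl

/-- The reflection in a seam moves the opposite cuff `i`. The image is determined by its products
with the cuffs `p`, `q` that are perpendicular to the seam and with the seam itself. -/
lemma vecReflect_seam_cuff {a : ℝ} (ha : 1 < a) {i j p q : Fin 3} (hip : i ≠ p) (hiq : i ≠ q)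
    (hpq : p ≠ q) (hp : Perp (.inl p) (.inr j)) (hq : Perp (.inl q) (.inr j)) :
    vecReflect (wallVec a (.inr j)) (wallVec a (.inl i)) =
      (2 * a / (a - 1)) • (wallVec a (.inl p) + wallVec a (.inl q)) - wallVec a (.inl i) := by
  have h1 : a - 1 ≠ 0 := by linarith
  rw [eq_sub_iff_add_eq, ← sub_eq_zero]
  refine eq_zero_of_bil_eq_zero ha (bil_wallVec_self ha (.inl p)) (bil_wallVec_self ha (.inl q))
    (bil_wallVec_self ha (.inr j)) (bil_cuff_cuff ha hpq) (bil_wallVec_of_perp ha hp)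
    (bil_wallVec_of_perp ha hq) ?_ ?_ ?_ <;>
  simp only [vecReflect, bil_sub_left, bil_add_left, bil_smul_left, bil_wallVec_self ha,
    bil_cuff_cuff ha hip, bil_cuff_cuff ha hiq, bil_cuff_cuff ha hpq, bil_cuff_cuff ha hpq.symm,
    bil_wallVec_of_perp ha hp, bil_wallVec_of_perp ha hq, bil_wallVec_of_perp ha hp.symm,
    bil_wallVec_of_perp ha hq.symm]
  · field_simp; ring
  · field_simp; ring
  · ring

/-- The lattice spanned by the unit normals of the cuffs of the hexagon. -/
noncomputable def cuffLattice (a : ℝ) : AddSubgroup Vec :=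
  AddSubgroup.closure (range fun i => wallVec a (.inl i))

lemma cuff_mem_cuffLattice (a : ℝ) (i : Fin 3) : wallVec a (.inl i) ∈ cuffLattice a :=
  AddSubgroup.subset_closure ⟨i, rfl⟩

lemma exists_int_bil {a : ℝ} (ha : 1 < a) (hint : ∃ k : ℤ, a = k) {v w : Vec}
    (hv : v ∈ cuffLattice a) (hw : w ∈ cuffLattice a) : ∃ k : ℤ, bil v w = k := by
  have hzero : ∀ w : Vec, bil 0 w = 0 := fun w => by simp [bil]
  induction hv using AddSubgroup.closure_induction with
  | mem v hv =>
    obtain ⟨i, rfl⟩ := hv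
    induction hw using AddSubgroup.closure_induction with
    | mem w hw =>
      obtain ⟨j, rfl⟩ := hw
      obtain ⟨k, hk⟩ := hint
      rcases eq_or_ne i j with rfl | hij
      · exact ⟨1, by rw [Int.cast_one]; exact bil_wallVec_self ha _⟩
      · exact ⟨-k, by push_cast; rw [← hk]; exact bil_cuff_cuff ha hij⟩
    | zero => exact ⟨0, by rw [bil_comm, hzero, Int.cast_zero]⟩
    | add x y _ _ hx hy =>
      obtain ⟨k, hk⟩ := hx
      obtain ⟨l, hl⟩ := hy
      exact ⟨k + l, by rw [bil_add_right, hk, hl, Int.cast_add]⟩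
    | neg x _ hx =>
      obtain ⟨k, hk⟩ := hx
      exact ⟨-k, by rw [bil_neg_right, hk, Int.cast_neg]⟩
  | zero => exact ⟨0, by rw [hzero, Int.cast_zero]⟩
  | add x y _ _ hx hy =>
    obtain ⟨k, hk⟩ := hx
    obtain ⟨l, hl⟩ := hy
    exact ⟨k + l, by rw [bil_add_left, hk, hl, Int.cast_add]⟩
  | neg x _ hx =>
    obtain ⟨k, hk⟩ := hx
    exact ⟨-k, by rw [bil_neg_left, hk, Int.cast_neg]⟩

lemma int_smul_mem_cuffLattice {a : ℝ} (k : ℤ) {v : Vec} (hv : v ∈ cuffLattice a) :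
    (k : ℝ) • v ∈ cuffLattice a := by
  rw [Int.cast_smul_eq_zsmul]
  exact (cuffLattice a).zsmul_mem hv k

/-- If `a` and `2 a / (a - 1)` are integers, which happens for `a = 2, 3` only, then the lattice
is invariant under the reflection group. -/
lemma vecReflect_mem_cuffLattice {a : ℝ} (ha : 1 < a) (hint : ∃ k : ℤ, a = k)
    (hint' : ∃ k : ℤ, 2 * a / (a - 1) = k) (i : Wall) {v : Vec} (hv : v ∈ cuffLattice a) :
    vecReflect (wallVec a i) v ∈ cuffLattice a := by
  rcases i with i | j
  · obtain ⟨k, hk⟩ := exists_int_bil ha hint hv (cuff_mem_cuffLattice a i)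
    rw [vecReflect, hk]
    have := int_smul_mem_cuffLattice (2 * k) (cuff_mem_cuffLattice a i)
    push_cast at this
    exact (cuffLattice a).sub_mem hv this
  obtain ⟨k, hk⟩ := hint'
  induction hv using AddSubgroup.closure_induction with
  | mem v hv =>
    obtain ⟨i, rfl⟩ := hv
    by_cases hij : Perp (.inl i) (.inr j)
    · have : vecReflect (wallVec a (.inr j)) (wallVec a (.inl i)) = wallVec a (.inl i) := by
        rw [vecReflect, bil_wallVec_of_perp ha hij, mul_zero, zero_smul, sub_zero]
      change vecReflect (wallVec a (.inr j)) (wallVec a (.inl i)) ∈ _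
      rw [this]
      exact cuff_mem_cuffLattice a i
    · have : ∃ p q : Fin 3, i ≠ p ∧ i ≠ q ∧ p ≠ q ∧ Perp (.inl p) (.inr j) ∧
          Perp (.inl q) (.inr j) := by
        revert i j; decide
      obtain ⟨p, q, hip, hiq, hpq, hp, hq⟩ := this
      change vecReflect (wallVec a (.inr j)) (wallVec a (.inl i)) ∈ _
      rw [vecReflect_seam_cuff ha hip hiq hpq hp hq, hk]
      exact (cuffLattice a).sub_mem (int_smul_mem_cuffLattice k ((cuffLattice a).add_mem
        (cuff_mem_cuffLattice a p) (cuff_mem_cuffLattice a q))) (cuff_mem_cuffLattice a i)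
  | zero =>
    have : vecReflect (wallVec a (.inr j)) 0 = 0 := by simp [vecReflect, bil]
    rw [this]
    exact (cuffLattice a).zero_mem
  | add x y _ _ hx hy =>
    have : vecReflect (wallVec a (.inr j)) (x + y) =
        vecReflect (wallVec a (.inr j)) x + vecReflect (wallVec a (.inr j)) y := by
      simp only [vecReflect, bil_add_left]; module
    rw [this]
    exact (cuffLattice a).add_mem hx hy
  | neg x _ hx =>
    have : vecReflect (wallVec a (.inr j)) (-x) = -vecReflect (wallVec a (.inr j)) x := by
      simp only [vecReflect, bil_neg_left]; module
    rw [this]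
    exact (cuffLattice a).neg_mem hx

variable {a : ℝ} [ha : Fact (1 < a)] {n : ℕ}

/-- The unit normals of the boundary mirrors belong to the lattice: they are images under the
reflection group of the normals of cuffs. -/
lemma exists_boundaryMirror_vec (hint : ∃ k : ℤ, a = k) (hint' : ∃ k : ℤ, 2 * a / (a - 1) = k)
    {m : HexGroup a × Wall} (hm : m ∈ boundaryMirrors a (baseCopy n)) :
    ∃ v ∈ cuffLattice a, bil v v = 1 ∧ ∀ x, mirrorSide m x = side v x := by
  obtain ⟨L, h1, h2, h3⟩ := exists_linear m.1
  refine ⟨L (wallVec a m.2), h3 (cuffLattice a) (fun i v hv =>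
    vecReflect_mem_cuffLattice ha.out hint hint' i hv) _ ?_,
    by rw [h1, bil_wallVec_self ha.out], fun x => ?_⟩
  · rw [mem_boundaryMirrors_iff] at hm
    rcases m with ⟨g, i | j⟩
    · exact cuff_mem_cuffLattice a i
    · exact absurd hm (seam_smul_copy_ne j _)
  · rw [mirrorSide, wallSide, side, side, ← h1, ← h2, smul_inv_smul]

lemma isOI (hint : ∃ k : ℤ, a = k) (hint' : ∃ k : ℤ, 2 * a / (a - 1) = k) (n : ℕ) :
    IsOI (treeSurface a n) := by
  rintro L γ ⟨hL, hloc, hp, hp'⟩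
  change ℝ → TreeSpace a n at γ
  have hγ : ContinuousOn γ (Icc 0 L) := by
    intro t ht
    obtain ⟨ε, hε, h⟩ := hloc t ht
    rw [Metric.continuousWithinAt_iff]
    intro δ hδ
    refine ⟨min δ ε, lt_min hδ hε, fun s hs hst => ?_⟩
    rw [Real.dist_eq, lt_min_iff] at hst
    refine (h s hs t ht hst.2 (by simpa using hε)).trans_lt hst.1
  obtain ⟨e, he⟩ := cover_surjective (γ 0)
  obtain ⟨c, hc, -, hlift⟩ := exists_lift_path isCoveringMap_cover hL.le hγ e he
  have hgeo : ∀ t ∈ Icc 0 L, ∃ ε > 0, ∀ s ∈ Icc 0 L, ∀ s' ∈ Icc 0 L, |s - t| < ε →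
      |s' - t| < ε → dist (γ s) (γ s') = |s - s'| ∧ dist (c s) (c s') = |s - s'| := by
    intro t ht
    obtain ⟨ε, hε, h⟩ := hloc t ht
    obtain ⟨ε', hε', h'⟩ := locally_of_lift isLocalIsometry_cover hc hlift t ht
    refine ⟨min ε ε', lt_min hε hε', fun s hs s' hs' h1 h2 => ?_⟩
    rw [lt_min_iff] at h1 h2
    have h3 := h s hs s' hs' h1.1 h2.1
    exact ⟨h3, (h' s hs s' hs' h1.2 h2.2).trans h3⟩
  obtain ⟨A, B, hAB⟩ := exists_hyperbolic_coeff_of_locally (γ := fun t => (c t : ℍ)) hL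
    fun t ht => by
      obtain ⟨ε, hε, h⟩ := hgeo t ht
      exact ⟨ε, hε, fun s hs s' hs' h1 h2 => (h s hs s' hs' h1 h2).2⟩
  have m0 : (0 : ℝ) ∈ Icc 0 L := ⟨le_rfl, hL.le⟩
  have mL : L ∈ Icc 0 L := ⟨hL.le, le_rfl⟩
  have hsub : ∀ t ∈ Icc 0 L, L - t ∈ Icc 0 L := fun t ht => ⟨by linarith [ht.2], by linarith [ht.1]⟩
  obtain ⟨e1, e2, m, hm, hB⟩ := exists_mirror_of_startsPerpendicularly hL hp hlift (by
    obtain ⟨ε, hε, h⟩ := hgeo 0 m0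
    exact ⟨ε, hε, fun s hs s' hs' h1 h2 => h s hs s' hs' (by rwa [sub_zero]) (by rwa [sub_zero])⟩)
    hAB
  -- the same for the reversed curve
  obtain ⟨-, -, m', hm', hB'⟩ := exists_mirror_of_startsPerpendicularly (c := fun t => c (L - t))
    (A := Real.cosh L • A + Real.sinh L • B) (B := -(Real.sinh L • A + Real.cosh L • B)) hL hp'
    (fun t ht => hlift _ (hsub t ht)) (by
      obtain ⟨ε, hε, h⟩ := hgeo L mL
      refine ⟨ε, hε, fun s hs s' hs' h1 h2 => ?_⟩
      have := h _ (hsub s hs) _ (hsub s' hs') (by simpa using h1) (by simpa using h2)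
      rwa [show |L - s - (L - s')| = |s - s'| by rw [abs_sub_comm]; congr 1; ring] at this)
    (fun t ht => by
      rw [hAB _ (hsub t ht), Real.cosh_sub, Real.sinh_sub]; module)
  obtain ⟨v, hvΛ, hv, hmv⟩ := exists_boundaryMirror_vec hint hint' hm
  obtain ⟨v', hvΛ', hv', hmv'⟩ := exists_boundaryMirror_vec hint hint' hm'
  have hBΛ : B ∈ cuffLattice a := by
    rcases hB v hv hmv with rfl | rfl
    exacts [hvΛ, (cuffLattice a).neg_mem hvΛ]
  have hBΛ' : -(Real.sinh L • A + Real.cosh L • B) ∈ cuffLattice a := by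
    rcases hB' v' hv' hmv' with h | h <;> rw [h]
    exacts [hvΛ', (cuffLattice a).neg_mem hvΛ']
  obtain ⟨k, hk⟩ := exists_int_bil ha.out hint hBΛ hBΛ'
  refine ⟨-k, ?_⟩
  rw [bil_neg_right, bil_add_right, bil_smul_right, bil_smul_right, bil_comm B A, e1, e2] at hk
  push_cast
  linarith

end OrthoIntegrality

end OrthoIntegral

theorem theorem1p3 :
    Infinite OrthoIntegral.OICommensurabilityClass ∧
    ∀ a : ℝ, a = 2 ∨ a = 3 →
      ∃ (P : OrthoIntegral.HyperbolicSurface) (h : Bool → OrthoIntegral.hexagon a → P)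
        (X : ℕ → OrthoIntegral.HyperbolicSurface),
        OrthoIntegral.IsPants a P h ∧
        (∀ n, OrthoIntegral.IsTreeGluing h n (X n)) ∧
        (∀ n, OrthoIntegral.IsOI (X n)) ∧
        (∀ n, OrthoIntegral.HasGenusZero (X n)) ∧
        (∀ n, OrthoIntegral.numBoundaryComponents (X n) = 3 * 2 ^ n) ∧
        (∃ C : ℕ → Set ℍ, (∀ n, OrthoIntegral.IsUniversalCover (C n) (X n)) ∧
          StrictMono (fun n => OrthoIntegral.inradius (C n))) ∧
        Pairwise (fun m n => ¬ OrthoIntegral.Commensurable (X m) (X n)) := by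
  have : Fact ((1 : ℝ) < 2) := ⟨by norm_num⟩
  refine ⟨OrthoIntegral.infinite_commensurabilityClass 2
    (OrthoIntegral.isOI ⟨2, by norm_num⟩ ⟨4, by norm_num⟩), fun a ha => ?_⟩
  have : Fact (1 < a) := ⟨by rcases ha with rfl | rfl <;> norm_num⟩
  have hint : ∃ k : ℤ, a = k := by
    rcases ha with rfl | rfl
    exacts [⟨2, by norm_num⟩, ⟨3, by norm_num⟩]
  have hint' : ∃ k : ℤ, 2 * a / (a - 1) = k := by
    rcases ha with rfl | rfl
    exacts [⟨4, by norm_num⟩, ⟨3, by norm_num⟩]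
  exact ⟨OrthoIntegral.treeSurface a 0, OrthoIntegral.pantsMap a, OrthoIntegral.treeSurface a,
    OrthoIntegral.isPants, fun n => OrthoIntegral.isTreeGluing, OrthoIntegral.isOI hint hint',
    fun n => OrthoIntegral.hasGenusZero,
    fun n => OrthoIntegral.numBoundaryComponents_treeSurface,
    ⟨fun n => OrthoIntegral.region a (OrthoIntegral.baseCopy n),
      fun n => OrthoIntegral.isUniversalCover, OrthoIntegral.strictMono_inradius a⟩,
    fun m n h => OrthoIntegral.not_commensurable h⟩
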